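/- Let $k$ be an algebraically closed field of characteristic zero. A $k$-linear category is finite semisimple if it has finite direct sums and there are finitely many objects $L_i$ with $\dim_k\mathrm{Hom}(L_i,L_j)=\delta_{ij}$ such that every object is isomorphic to a finite direct sum of the $L_i$. A multi-fusion category is a rigid finite semisimple $k$-linear monoidal category. For a finite group $A$ and a 3-cocycle $\omega$ on $A$ with values in $k^\times$ (trivial action), $\mathrm{Vec}_A^{\omega}$ denotes the monoidal category of finite dimensional $A$-graded vector spaces with the usual tensor product and with associativity constraint equal to $\omega(a,b,c)$ on the component of degrees $(a,b,c)$; $\mathrm{Vec}_A=\mathrm{Vec}_A^{1}$. A module category over such a category is a nonzero finite semisimple $k$-linear category $\mathcal M$ with a $k$-linear action. For a module category $\mathcal M$ over $\mathcal D$, the dual category $\mathcal D^*_{\mathcal M}$ is the category of $k$-linear $\mathcal D$-module endofunctors of $\mathcal M$, with module natural transformations as morphisms and composition as tensor product; it acts on $\mathcal M$ by evaluation. A module category is indecomposable if it is nonzero and is not a direct sum of two nonzero module subcategories. Let $A$ be a finite group, let $\mathcal M$ be a module category over $\mathrm{Vec}_A$, and let $\mathcal C\subset(\mathrm{Vec}_A)^*_{\mathcal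 M}$ be a full monoidal subcategory which is a multi-fusion category and over which $\mathcal M$ is indecomposable. Then there exist a finite group $\bar A$, a 3-cocycle $\omega$ on $\bar A$ with values in $k^\times$, a $k$-linear tensor functor $F:\mathrm{Vec}_A\to\mathrm{Vec}_{\bar A}^{\omega}$ which is surjective (every object of $\mathrm{Vec}_{\bar A}^{\omega}$ is a direct summand of $F(X)$ for some $X$), and a $k$-linear action of $\mathrm{Vec}_{\bar A}^{\omega}$ on $\mathcal M$ such that the action of $\mathrm{Vec}_A$ on $\mathcal M$ factors through $F$ (that is, there are natural isomorphisms $X\otimes m\simeq F(X)\otimes m$ compatible with the associativity and unit isomorphisms of the two actions), and such that $\mathcal C=(\mathrm{Vec}_{\bar A}^{\omega})^*_{\mathcal M}$ inside $(\mathrm{Vec}_A)^*_{\mathcal M}$: the dual tensor functor $F^*:(\mathrm{Vec}_{\bar A}^{\omega})^*_{\mathcal M}\to(\mathrm{Vec}_A)^*_{\mathcal M}$, which restricts the module structure of an endofunctor along $F$, is fully faithful, and an object of $(\mathrm{Vec}_A)^*_{\mathcal M}$ is isomorphic to an object in the image of $F^*$ if and only if it is isomorphic to an object of $\mathcal C$.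 -/

import Mathlib

open CategoryTheory CategoryTheory.Limits CategoryTheory.MonoidalCategory
open scoped TensorProduct CategoryTheory.MonoidalCategory.MonoidalLeftAction

universe u w v v₁ v₂ v₃ u₁ u₂ u₃

noncomputable section

namespace TensorCat

/-! ### Finite semisimple and multi-fusion categories -/

/-- A `k`-linear category is finite semisimple if it has finite direct sums and there are
finitely many objects `L i` with `dim Hom (L i, L j) = δ i j` such that every object is isomorphic
to a finite direct sum of the `L i`. -/
structure IsFiniteSemisimple (k : Type u) [Field k] (C : Type u₁) [Category.{v₁} C]
    [Preadditive C] [Linear k C] : Prop where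
  [hasFiniteBiproducts : HasFiniteBiproducts C]
  exists_simples : ∃ (n : ℕ) (L : Fin n → C),
    (∀ i j, Module.rank k (L i ⟶ L j) = if i = j then 1 else 0) ∧
    ∀ X : C, ∃ (m : ℕ) (f : Fin m → Fin n), Nonempty (X ≅ ⨁ fun j => L (f j))

/-- A multi-fusion category: a rigid finite semisimple monoidal category over `k`
with `k`-bilinear tensor product. -/
structure IsMultiFusion (k : Type u) [Field k] (C : Type u₁) [Category.{v₁} C]
    [Preadditive C] [Linear k C] [MonoidalCategory C] [MonoidalPreadditive C]
    [MonoidalLinear k C] : Prop where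
  semisimple : IsFiniteSemisimple k C
  rightDual : ∀ X : C, Nonempty (HasRightDual X)
  leftDual : ∀ X : C, Nonempty (HasLeftDual X)

/-! ### Twisted group-graded vector spaces -/

/-- Multiplicative 3-cocycles on the group `A` with values in the abelian group `S` with
trivial action. -/
structure ThreeCocycle (A : Type w) (S : Type u) [Group A] [CommGroup S] where
  toFun : A → A → A → S
  cocycle : ∀ a b c d : A,
    toFun a b c * toFun a (b * c) d * toFun b c d = toFun (a * b) c d * toFun a b (c * d)

/-- The trivial 3-cocycle. -/
instance (A : Type w) (S : Type u) [Group A] [CommGroup S] : One (ThreeCocycle A S) :=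
  ⟨{ toFun := fun _ _ _ => 1, cocycle := by simp }⟩

/-- Objects of `Vec_A^ω`: finite dimensional `A`-graded vector spaces, the grading being given by
the projections `proj g` onto the homogeneous components. The cocycle `ω` only enters in
the associativity constraint. -/
structure GrVec (k : Type u) [Field k] (A : Type w) [Group A] [Fintype A]
    (ω : ThreeCocycle A kˣ) where
  carrier : Type u
  [addCommGroup : AddCommGroup carrier]
  [module : Module k carrier]
  [finite : Module.Finite k carrier]
  proj : A → Module.End k carrier
  isGrading : CompleteOrthogonalIdempotents proj

namespace GrVec

attribute [instance] GrVec.addCommGroup GrVec.module GrVec.finite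

variable {k : Type u} [Field k] {A : Type w} [Group A] [Fintype A] {ω : ThreeCocycle A kˣ}

/-- Linear maps of degree zero. -/
def homSubmodule (V W : GrVec k A ω) : Submodule k (V.carrier →ₗ[k] W.carrier) where
  carrier := {f | ∀ g v, f (V.proj g v) = W.proj g (f v)}
  add_mem' hf hg x v := by simp [hf x v, hg x v]
  zero_mem' := by simp
  smul_mem' c f hf x v := by simp [hf x v]

instance : Category.{u} (GrVec k A ω) where
  Hom V W := homSubmodule V W
  id V := ⟨LinearMap.id, fun _ _ => rfl⟩
  comp f g := ⟨g.1 ∘ₗ f.1, fun x v => by simp [f.2 x v, g.2 x]⟩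

/-- The linear map underlying a morphism. -/
def lin {V W : GrVec k A ω} (f : V ⟶ W) : V.carrier →ₗ[k] W.carrier := f.1

/-- A degree zero linear map as a morphism. -/
def ofLin {V W : GrVec k A ω} (f : V.carrier →ₗ[k] W.carrier)
    (hf : ∀ g v, f (V.proj g v) = W.proj g (f v)) : V ⟶ W := ⟨f, hf⟩

instance : Preadditive (GrVec k A ω) where
  homGroup V W := inferInstanceAs (AddCommGroup (homSubmodule V W))
  add_comp _ _ _ _ _ _ := Subtype.ext (LinearMap.comp_add _ _ _)
  comp_add _ _ _ _ _ _ := Subtype.ext (LinearMap.add_comp _ _ _)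

instance : Linear k (GrVec k A ω) where
  homModule V W := inferInstanceAs (Module k (homSubmodule V W))
  smul_comp _ _ _ r f g := Subtype.ext (LinearMap.comp_smul g.1 r f.1)
  comp_smul _ _ _ f r g := Subtype.ext (LinearMap.smul_comp r g.1 f.1)

@[simp] lemma lin_ofLin {V W : GrVec k A ω} (f : V.carrier →ₗ[k] W.carrier) (hf) :
    lin (ofLin (V := V) (W := W) f hf) = f := rfl
@[simp] lemma lin_id (V : GrVec k A ω) : lin (𝟙 V) = LinearMap.id := rfl
@[simp] lemma lin_comp {V W U : GrVec k A ω} (f : V ⟶ W) (g : W ⟶ U) :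
    lin (f ≫ g) = lin g ∘ₗ lin f := rfl
@[simp] lemma lin_add {V W : GrVec k A ω} (f g : V ⟶ W) : lin (f + g) = lin f + lin g := rfl
@[simp] lemma lin_zero {V W : GrVec k A ω} : lin (0 : V ⟶ W) = 0 := rfl
@[simp] lemma lin_smul {V W : GrVec k A ω} (r : k) (f : V ⟶ W) : lin (r • f) = r • lin f := rfl
lemma lin_proj {V W : GrVec k A ω} (f : V ⟶ W) (g : A) (v : V.carrier) :
    lin f (V.proj g v) = W.proj g (lin f v) := f.2 g v
lemma hom_ext {V W : GrVec k A ω} {f g : V ⟶ W} (h : lin f = lin g) : f = g := Subtype.ext h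

/-- `v` is homogeneous of degree `g`. -/
def Homog (V : GrVec k A ω) (g : A) (v : V.carrier) : Prop := V.proj g v = v

lemma homog_proj (V : GrVec k A ω) (g : A) (v : V.carrier) : V.Homog g (V.proj g v) :=
  LinearMap.congr_fun (V.isGrading.idem g) v

lemma sum_proj (V : GrVec k A ω) (v : V.carrier) : ∑ g, V.proj g v = v := by
  have := LinearMap.congr_fun V.isGrading.complete v
  simpa using this

lemma Homog.proj_of_ne {V : GrVec k A ω} {g x : A} {v : V.carrier} (hv : V.Homog g v)
    (h : x ≠ g) : V.proj x v = 0 := by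
  rw [← hv]
  exact LinearMap.congr_fun (V.isGrading.ortho h) v

lemma Homog.map {V W : GrVec k A ω} {g : A} {v : V.carrier} (hv : V.Homog g v) (f : V ⟶ W) :
    W.Homog g (lin f v) := by
  unfold Homog
  rw [← lin_proj, hv]

lemma lin_ext {V : GrVec k A ω} {U : Type*} [AddCommGroup U] [Module k U]
    {f f' : V.carrier →ₗ[k] U} (h : ∀ g v, V.Homog g v → f v = f' v) : f = f' := by
  ext v
  rw [← V.sum_proj v, map_sum, map_sum]
  exact Finset.sum_congr rfl fun g _ => h g _ (V.homog_proj g v)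

lemma lin_ext₂ {V W : GrVec k A ω} {U : Type*} [AddCommGroup U] [Module k U]
    {f f' : V.carrier ⊗[k] W.carrier →ₗ[k] U}
    (h : ∀ g v g' v', V.Homog g v → W.Homog g' v' → f (v ⊗ₜ v') = f' (v ⊗ₜ v')) : f = f' := by
  apply TensorProduct.ext
  refine lin_ext fun g v hv => lin_ext fun g' v' hv' => ?_
  exact h g v g' v' hv hv'

lemma lin_ext₃ {V W X : GrVec k A ω} {U : Type*} [AddCommGroup U] [Module k U]
    {f f' : (V.carrier ⊗[k] W.carrier) ⊗[k] X.carrier →ₗ[k] U}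
    (h : ∀ g v g' v' g'' v'', V.Homog g v → W.Homog g' v' → X.Homog g'' v'' →
      f ((v ⊗ₜ v') ⊗ₜ v'') = f' ((v ⊗ₜ v') ⊗ₜ v'')) : f = f' := by
  apply TensorProduct.ext
  refine lin_ext₂ fun g v g' v' hv hv' => lin_ext fun g'' v'' hv'' => ?_
  exact h g v g' v' g'' v'' hv hv' hv''

lemma lin_ext₃' {V W X : GrVec k A ω} {U : Type*} [AddCommGroup U] [Module k U]
    {f f' : V.carrier ⊗[k] (W.carrier ⊗[k] X.carrier) →ₗ[k] U}
    (h : ∀ g v g' v' g'' v'', V.Homog g v → W.Homog g' v' → X.Homog g'' v'' →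
      f (v ⊗ₜ (v' ⊗ₜ v'')) = f' (v ⊗ₜ (v' ⊗ₜ v''))) : f = f' := by
  apply TensorProduct.ext
  refine lin_ext fun g v hv => lin_ext₂ fun g' v' g'' v'' hv' hv'' => ?_
  exact h g v g' v' g'' v'' hv hv' hv''

/-- The degree `g` projection of `V ⊗ W`: the sum of the `V_h ⊗ W_l` with `h * l = g`. -/
def tensorProj (V W : GrVec k A ω) (g : A) : Module.End k (V.carrier ⊗[k] W.carrier) :=
  ∑ h : A, TensorProduct.map (V.proj h) (W.proj (h⁻¹ * g))

open Classical in
lemma tensorProj_tmul {V W : GrVec k A ω} {g h : A} {v : V.carrier} {w : W.carrier}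
    (hv : V.Homog g v) (hw : W.Homog h w) (x : A) :
    tensorProj V W x (v ⊗ₜ w) = if x = g * h then v ⊗ₜ w else 0 := by
  rw [tensorProj, LinearMap.sum_apply, Finset.sum_eq_single g]
  · rw [TensorProduct.map_tmul, hv]
    split_ifs with hx
    · subst hx; rw [inv_mul_cancel_left, hw]
    · rw [hw.proj_of_ne, TensorProduct.tmul_zero]
      rintro rfl; exact hx (by simp)
  · intro b _ hb
    rw [TensorProduct.map_tmul, hv.proj_of_ne hb, TensorProduct.zero_tmul]
  · simp

/-- The tensor product of graded vector spaces. -/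
abbrev tensor (V W : GrVec k A ω) : GrVec k A ω where
  carrier := V.carrier ⊗[k] W.carrier
  proj := tensorProj V W
  isGrading := by
    classical
    rw [CompleteOrthogonalIdempotents.iff_ortho_complete]
    constructor
    · intro x y hxy
      refine lin_ext₂ fun g v h w hv hw => ?_
      simp only [Module.End.mul_apply, tensorProj_tmul hv hw, LinearMap.zero_apply]
      split_ifs with hy
      · rw [tensorProj_tmul hv hw, if_neg (by rw [← hy]; exact hxy)]
      · simp
    · refine lin_ext₂ fun g v h w hv hw => ?_
      simp [LinearMap.sum_apply, tensorProj_tmul hv hw]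

lemma Homog.tmul {V W : GrVec k A ω} {g h : A} {v : V.carrier} {w : W.carrier}
    (hv : V.Homog g v) (hw : W.Homog h w) : (tensor V W).Homog (g * h) (v ⊗ₜ[k] w) := by
  classical
  change tensorProj V W _ _ = _
  rw [tensorProj_tmul hv hw, if_pos rfl]

/-- A linear map is of degree zero if it sends homogeneous elements to
homogeneous elements of the same degree. -/
lemma degreeZero_of_homog {V W : GrVec k A ω} {f : V.carrier →ₗ[k] W.carrier}
    (h : ∀ g v, V.Homog g v → W.Homog g (f v)) (g : A) (v : V.carrier) :
    f (V.proj g v) = W.proj g (f v) := by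
  classical
  suffices f ∘ₗ V.proj g = W.proj g ∘ₗ f from LinearMap.congr_fun this v
  refine lin_ext fun x v hv => ?_
  simp only [LinearMap.comp_apply]
  by_cases hx : g = x
  · subst hx; rw [hv, h _ _ hv]
  · rw [hv.proj_of_ne hx, (h _ _ hv).proj_of_ne hx, map_zero]

lemma degreeZero_tensor {V W U : GrVec k A ω} {f : V.carrier ⊗[k] W.carrier →ₗ[k] U.carrier}
    (h : ∀ g v g' v', V.Homog g v → W.Homog g' v' → U.Homog (g * g') (f (v ⊗ₜ v')))
    (g : A) (v : V.carrier ⊗[k] W.carrier) :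
    f (tensorProj V W g v) = U.proj g (f v) := by
  classical
  suffices f ∘ₗ tensorProj V W g = U.proj g ∘ₗ f from LinearMap.congr_fun this v
  refine lin_ext₂ fun a v b w hv hw => ?_
  simp only [LinearMap.comp_apply]
  rw [tensorProj_tmul hv hw]
  by_cases hx : g = a * b
  · rw [if_pos hx]; subst hx; rw [h _ _ _ _ hv hw]
  · rw [if_neg hx, (h _ _ _ _ hv hw).proj_of_ne hx, map_zero]

lemma degreeZero_tensor₃ {U V W X : GrVec k A ω}
    {f : (U.carrier ⊗[k] V.carrier) ⊗[k] W.carrier →ₗ[k] X.carrier}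
    (h : ∀ a x b y d z, U.Homog a x → V.Homog b y → W.Homog d z →
      X.Homog (a * b * d) (f ((x ⊗ₜ y) ⊗ₜ z)))
    (g : A) (v : (U.carrier ⊗[k] V.carrier) ⊗[k] W.carrier) :
    f (tensorProj (tensor U V) W g v) = X.proj g (f v) := by
  classical
  suffices f ∘ₗ tensorProj (tensor U V) W g = X.proj g ∘ₗ f from LinearMap.congr_fun this v
  refine lin_ext₃ fun a x b y d z hx hy hz => ?_
  simp only [LinearMap.comp_apply]
  rw [tensorProj_tmul (hx.tmul hy) hz]
  by_cases hg : g = a * b * d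
  · rw [if_pos hg]; subst hg; rw [h _ _ _ _ _ _ hx hy hz]
  · rw [if_neg hg, (h _ _ _ _ _ _ hx hy hz).proj_of_ne hg, map_zero]

lemma degreeZero_tensor₃' {U V W X : GrVec k A ω}
    {f : U.carrier ⊗[k] (V.carrier ⊗[k] W.carrier) →ₗ[k] X.carrier}
    (h : ∀ a x b y d z, U.Homog a x → V.Homog b y → W.Homog d z →
      X.Homog (a * (b * d)) (f (x ⊗ₜ (y ⊗ₜ z))))
    (g : A) (v : U.carrier ⊗[k] (V.carrier ⊗[k] W.carrier)) :
    f (tensorProj U (tensor V W) g v) = X.proj g (f v) := by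
  classical
  suffices f ∘ₗ tensorProj U (tensor V W) g = X.proj g ∘ₗ f from LinearMap.congr_fun this v
  refine lin_ext₃' fun a x b y d z hx hy hz => ?_
  simp only [LinearMap.comp_apply]
  rw [tensorProj_tmul hx (hy.tmul hz)]
  by_cases hg : g = a * (b * d)
  · rw [if_pos hg]; subst hg; rw [h _ _ _ _ _ _ hx hy hz]
  · rw [if_neg hg, (h _ _ _ _ _ _ hx hy hz).proj_of_ne hg, map_zero]

open Classical in
/-- The unit object: `k` in degree `1`. -/
abbrev unit : GrVec k A ω where
  carrier := k
  proj g := if g = 1 then 1 else 0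
  isGrading := by
    rw [CompleteOrthogonalIdempotents.iff_ortho_complete]
    refine ⟨fun x y hxy => ?_, by simp⟩
    by_cases hx : x = 1
    · have hy : y ≠ 1 := fun h => hxy (hx.trans h.symm)
      simp [hy]
    · simp [hx]

lemma homog_unit (r : k) : (unit : GrVec k A ω).Homog 1 r := by
  simp only [Homog, if_pos]
  rfl

/-- `c`-twisted associativity map:
`(u ⊗ v) ⊗ w ↦ c a b d • u ⊗ (v ⊗ w)` for `u, v, w` homogeneous of degrees `a, b, d`. -/
def assocLin (c : A → A → A → kˣ) (U V W : GrVec k A ω) :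
    (U.carrier ⊗[k] V.carrier) ⊗[k] W.carrier →ₗ[k] U.carrier ⊗[k] (V.carrier ⊗[k] W.carrier) :=
  ∑ a : A, ∑ b : A, ∑ d : A, (c a b d : k) •
    ((TensorProduct.assoc k U.carrier V.carrier W.carrier).toLinearMap ∘ₗ
      TensorProduct.map (TensorProduct.map (U.proj a) (V.proj b)) (W.proj d))

/-- The map in the direction opposite to `assocLin`. -/
def assocInvLin (c : A → A → A → kˣ) (U V W : GrVec k A ω) :
    U.carrier ⊗[k] (V.carrier ⊗[k] W.carrier) →ₗ[k] (U.carrier ⊗[k] V.carrier) ⊗[k] W.carrier :=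
  ∑ a : A, ∑ b : A, ∑ d : A, (c a b d : k) •
    ((TensorProduct.assoc k U.carrier V.carrier W.carrier).symm.toLinearMap ∘ₗ
      TensorProduct.map (U.proj a) (TensorProduct.map (V.proj b) (W.proj d)))

lemma assocLin_apply (c : A → A → A → kˣ) {U V W : GrVec k A ω} {a b d : A}
    {x : U.carrier} {y : V.carrier} {z : W.carrier}
    (hx : U.Homog a x) (hy : V.Homog b y) (hz : W.Homog d z) :
    assocLin c U V W ((x ⊗ₜ y) ⊗ₜ z) = (c a b d : k) • (x ⊗ₜ (y ⊗ₜ z)) := by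
  simp only [assocLin, LinearMap.sum_apply, LinearMap.smul_apply, LinearMap.comp_apply,
    TensorProduct.map_tmul]
  rw [Finset.sum_eq_single a, Finset.sum_eq_single b, Finset.sum_eq_single d, hx, hy, hz]
  · simp
  · intro e _ he; simp [hz.proj_of_ne he]
  · simp
  · intro e _ he; simp [hy.proj_of_ne he]
  · simp
  · intro e _ he; simp [hx.proj_of_ne he]
  · simp

lemma assocInvLin_apply (c : A → A → A → kˣ) {U V W : GrVec k A ω} {a b d : A}
    {x : U.carrier} {y : V.carrier} {z : W.carrier}
    (hx : U.Homog a x) (hy : V.Homog b y) (hz : W.Homog d z) :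
    assocInvLin c U V W (x ⊗ₜ (y ⊗ₜ z)) = (c a b d : k) • ((x ⊗ₜ y) ⊗ₜ z) := by
  simp only [assocInvLin, LinearMap.sum_apply, LinearMap.smul_apply, LinearMap.comp_apply,
    TensorProduct.map_tmul]
  rw [Finset.sum_eq_single a, Finset.sum_eq_single b, Finset.sum_eq_single d, hx, hy, hz]
  · simp
  · intro e _ he; simp [hz.proj_of_ne he]
  · simp
  · intro e _ he; simp [hy.proj_of_ne he]
  · simp
  · intro e _ he; simp [hx.proj_of_ne he]
  · simp

/-- The operator acting by the scalar `c g` on the degree `g` component. -/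
def scalarLin (c : A → kˣ) (V : GrVec k A ω) : V.carrier →ₗ[k] V.carrier :=
  ∑ g : A, (c g : k) • V.proj g

lemma scalarLin_apply (c : A → kˣ) {V : GrVec k A ω} {g : A} {v : V.carrier} (hv : V.Homog g v) :
    scalarLin c V v = (c g : k) • v := by
  simp only [scalarLin, LinearMap.sum_apply, LinearMap.smul_apply]
  rw [Finset.sum_eq_single g, hv]
  · intro e _ he; simp [hv.proj_of_ne he]
  · simp

lemma Homog.smul {V : GrVec k A ω} {g : A} {v : V.carrier} (hv : V.Homog g v) (r : k) :
    V.Homog g (r • v) := by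
  unfold Homog; rw [map_smul, hv]

/-- The tensor product of two morphisms. -/
def tensorMor {V V' W W' : GrVec k A ω} (f : V ⟶ V') (g : W ⟶ W') : tensor V W ⟶ tensor V' W' :=
  ofLin (TensorProduct.map (lin f) (lin g))
    (degreeZero_tensor (U := tensor V' W') fun _ _ _ _ hv hw => (hv.map f).tmul (hw.map g))

/-- The associativity constraint, given by `ω a b d` on the component of degree `(a, b, d)`. -/
def assocIso (U V W : GrVec k A ω) : tensor (tensor U V) W ≅ tensor U (tensor V W) where
  hom := ofLin (assocLin (fun a b d => ω.toFun a b d) U V W) <| by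
    refine degreeZero_tensor₃ (X := tensor U (tensor V W)) fun a x b y d z hx hy hz => ?_
    rw [assocLin_apply _ hx hy hz, mul_assoc]
    exact (hx.tmul (hy.tmul hz)).smul _
  inv := ofLin (assocInvLin (fun a b d => (ω.toFun a b d)⁻¹) U V W) <| by
    refine degreeZero_tensor₃' (X := tensor (tensor U V) W) fun a x b y d z hx hy hz => ?_
    rw [assocInvLin_apply _ hx hy hz, ← mul_assoc]
    exact ((hx.tmul hy).tmul hz).smul _
  hom_inv_id := by
    refine hom_ext (lin_ext₃ fun a x b y d z hx hy hz => ?_)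
    simp [assocLin_apply _ hx hy hz, assocInvLin_apply _ hx hy hz]
  inv_hom_id := by
    refine hom_ext (lin_ext₃' fun a x b y d z hx hy hz => ?_)
    simp [assocLin_apply _ hx hy hz, assocInvLin_apply _ hx hy hz]

/-- The left unit constraint, given by `(ω 1 1 g)⁻¹` in degree `g`. -/
def leftUnitIso (V : GrVec k A ω) : tensor unit V ≅ V where
  hom := ofLin (scalarLin (fun g => (ω.toFun 1 1 g)⁻¹) V ∘ₗ
      (TensorProduct.lid k V.carrier).toLinearMap) <| by
    refine degreeZero_tensor (V := unit) fun g r h v hr hv => ?_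
    by_cases hg : g = 1
    · subst hg
      simp only [LinearMap.comp_apply, LinearEquiv.coe_coe, TensorProduct.lid_tmul, one_mul]
      rw [map_smul, scalarLin_apply _ hv]
      exact (hv.smul _).smul _
    · have : r = 0 := by rw [← hr, (homog_unit r).proj_of_ne hg]
      subst this
      simp [Homog]
  inv := ofLin ((TensorProduct.lid k V.carrier).symm.toLinearMap ∘ₗ
      scalarLin (fun g => ω.toFun 1 1 g) V) <| by
    refine degreeZero_of_homog (W := tensor unit V) fun g v hv => ?_
    simp only [LinearMap.comp_apply, scalarLin_apply _ hv, map_smul]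
    have := (homog_unit (A := A) (ω := ω) (1 : k)).tmul hv
    rw [one_mul] at this
    exact this.smul _
  hom_inv_id := by
    refine hom_ext (TensorProduct.ext (LinearMap.ext_ring (lin_ext fun g v hv => ?_)))
    simp [scalarLin_apply _ hv]
  inv_hom_id := by
    refine hom_ext (lin_ext fun g v hv => ?_)
    simp [scalarLin_apply _ hv]

/-- The right unit constraint, given by `ω g 1 1` in degree `g`. -/
def rightUnitIso (V : GrVec k A ω) : tensor V unit ≅ V where
  hom := ofLin (scalarLin (fun g => ω.toFun g 1 1) V ∘ₗ
      (TensorProduct.rid k V.carrier).toLinearMap) <| by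
    refine degreeZero_tensor (W := unit) fun h v g r hv hr => ?_
    by_cases hg : g = 1
    · subst hg
      simp only [LinearMap.comp_apply, LinearEquiv.coe_coe, TensorProduct.rid_tmul, mul_one]
      rw [map_smul, scalarLin_apply _ hv]
      exact (hv.smul _).smul _
    · have : r = 0 := by rw [← hr, (homog_unit r).proj_of_ne hg]
      subst this
      simp [Homog]
  inv := ofLin ((TensorProduct.rid k V.carrier).symm.toLinearMap ∘ₗ
      scalarLin (fun g => (ω.toFun g 1 1)⁻¹) V) <| by
    refine degreeZero_of_homog (W := tensor V unit) fun g v hv => ?_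
    simp only [LinearMap.comp_apply, scalarLin_apply _ hv, map_smul]
    have := hv.tmul (homog_unit (A := A) (ω := ω) (1 : k))
    rw [mul_one] at this
    exact this.smul _
  hom_inv_id := by
    refine hom_ext (TensorProduct.ext (lin_ext fun g v hv => LinearMap.ext_ring ?_))
    simp [scalarLin_apply _ hv]
  inv_hom_id := by
    refine hom_ext (lin_ext fun g v hv => ?_)
    simp [scalarLin_apply _ hv]

lemma tensorMor_tmul {V V' W W' : GrVec k A ω} (f : V ⟶ V') (g : W ⟶ W')
    (v : V.carrier) (w : W.carrier) :
    lin (tensorMor f g) (v ⊗ₜ[k] w) = lin f v ⊗ₜ[k] lin g w := rfl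

lemma assocIso_apply {U V W : GrVec k A ω} {a b d : A}
    {x : U.carrier} {y : V.carrier} {z : W.carrier}
    (hx : U.Homog a x) (hy : V.Homog b y) (hz : W.Homog d z) :
    lin (assocIso U V W).hom ((x ⊗ₜ[k] y) ⊗ₜ[k] z) =
      (ω.toFun a b d : k) • (x ⊗ₜ[k] (y ⊗ₜ[k] z)) :=
  assocLin_apply _ hx hy hz

lemma leftUnitIso_apply {V : GrVec k A ω} {g : A} {v : V.carrier} (hv : V.Homog g v) (r : k) :
    lin (leftUnitIso V).hom (r ⊗ₜ[k] v) = r • ((ω.toFun 1 1 g)⁻¹ : kˣ).1 • v := by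
  change scalarLin _ V (r • v) = _
  rw [map_smul, scalarLin_apply _ hv]

lemma rightUnitIso_apply {V : GrVec k A ω} {g : A} {v : V.carrier} (hv : V.Homog g v) (r : k) :
    lin (rightUnitIso V).hom (v ⊗ₜ[k] r) = r • (ω.toFun g 1 1 : k) • v := by
  change scalarLin _ V (r • v) = _
  rw [map_smul, scalarLin_apply _ hv]

lemma assocIso_naturality {U V W U' V' W' : GrVec k A ω}
    (f : U ⟶ U') (g : V ⟶ V') (h : W ⟶ W') :
    tensorMor (tensorMor f g) h ≫ (assocIso U' V' W').hom =
      (assocIso U V W).hom ≫ tensorMor f (tensorMor g h) :=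
  hom_ext (lin_ext₃ fun _ x _ y _ z hx hy hz => by
    change lin (assocIso U' V' W').hom ((lin f x ⊗ₜ[k] lin g y) ⊗ₜ[k] lin h z) =
      lin (tensorMor f (tensorMor g h)) (lin (assocIso U V W).hom ((x ⊗ₜ[k] y) ⊗ₜ[k] z))
    rw [assocIso_apply hx hy hz, assocIso_apply (hx.map f) (hy.map g) (hz.map h), map_smul]
    rfl)

lemma leftUnitIso_naturality {V W : GrVec k A ω} (f : V ⟶ W) :
    tensorMor (𝟙 unit) f ≫ (leftUnitIso W).hom = (leftUnitIso V).hom ≫ f :=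
  hom_ext (TensorProduct.ext (LinearMap.ext_ring (lin_ext fun _ v hv => by
    change lin (leftUnitIso W).hom ((1 : k) ⊗ₜ[k] lin f v) =
      lin f (lin (leftUnitIso V).hom ((1 : k) ⊗ₜ[k] v))
    rw [leftUnitIso_apply hv, leftUnitIso_apply (hv.map f), map_smul, map_smul])))

lemma rightUnitIso_naturality {V W : GrVec k A ω} (f : V ⟶ W) :
    tensorMor f (𝟙 unit) ≫ (rightUnitIso W).hom = (rightUnitIso V).hom ≫ f :=
  hom_ext (TensorProduct.ext (lin_ext fun _ v hv => LinearMap.ext_ring (by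
    change lin (rightUnitIso W).hom (lin f v ⊗ₜ[k] (1 : k)) =
      lin f (lin (rightUnitIso V).hom (v ⊗ₜ[k] (1 : k)))
    rw [rightUnitIso_apply hv, rightUnitIso_apply (hv.map f), map_smul, map_smul])))

lemma assocIso_pentagon (U V W X : GrVec k A ω) :
    tensorMor (assocIso U V W).hom (𝟙 X) ≫ (assocIso U (tensor V W) X).hom ≫
      tensorMor (𝟙 U) (assocIso V W X).hom =
    (assocIso (tensor U V) W X).hom ≫ (assocIso U V (tensor W X)).hom := by
  refine hom_ext (TensorProduct.ext (lin_ext₃ fun a x b y c z hx hy hz =>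
    lin_ext fun d t ht => ?_))
  have h := congrArg Units.val (ω.cocycle a b c d)
  simp only [Units.val_mul] at h
  have h1 := assocIso_apply hx (hy.tmul hz) ht
  have h2 := assocIso_apply (hx.tmul hy) hz ht
  have h3 := assocIso_apply hx hy (hz.tmul ht)
  change lin (tensorMor (𝟙 U) (assocIso V W X).hom) (lin (assocIso U (tensor V W) X).hom
      (lin (assocIso U V W).hom ((x ⊗ₜ[k] y) ⊗ₜ[k] z) ⊗ₜ[k] t)) =
    lin (assocIso U V (tensor W X)).hom (lin (assocIso (tensor U V) W X).hom
      (((x ⊗ₜ[k] y) ⊗ₜ[k] z) ⊗ₜ[k] t))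
  rw [assocIso_apply hx hy hz, ← TensorProduct.smul_tmul', map_smul, h1, map_smul, map_smul, h2,
    map_smul, h3]
  change _ • _ • x ⊗ₜ[k] (lin (assocIso V W X).hom ((y ⊗ₜ[k] z) ⊗ₜ[k] t)) = _
  rw [assocIso_apply hy hz ht, TensorProduct.tmul_smul, smul_smul, smul_smul, smul_smul, ← h]

/-- The cocycle identity at `(a, 1, 1, b)`. -/
lemma cocycle_unit {A : Type w} [Group A] (ω : ThreeCocycle A kˣ) (a b : A) :
    ω.toFun a 1 b * (ω.toFun 1 1 b)⁻¹ = ω.toFun a 1 1 := by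
  have h := ω.cocycle a 1 1 b
  simp only [mul_one, one_mul] at h
  rw [mul_inv_eq_iff_eq_mul]
  refine (mul_left_cancel (a := ω.toFun a 1 b) ?_).symm
  rw [← h]; ac_rfl

lemma assocIso_triangle (V W : GrVec k A ω) :
    (assocIso V unit W).hom ≫ tensorMor (𝟙 V) (leftUnitIso W).hom =
      tensorMor (rightUnitIso V).hom (𝟙 W) := by
  refine hom_ext (TensorProduct.ext (TensorProduct.ext (lin_ext fun a x hx =>
    LinearMap.ext_ring (lin_ext fun b y hy => ?_))))
  have h1 := assocIso_apply hx (homog_unit 1) hy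
  have h := congrArg Units.val (cocycle_unit ω a b)
  rw [Units.val_mul] at h
  change lin (tensorMor (𝟙 V) (leftUnitIso W).hom) (lin (assocIso V unit W).hom
      ((x ⊗ₜ[k] (1 : k)) ⊗ₜ[k] y)) = lin (rightUnitIso V).hom (x ⊗ₜ[k] (1 : k)) ⊗ₜ[k] y
  rw [h1, map_smul, rightUnitIso_apply hx]
  change _ • x ⊗ₜ[k] (lin (leftUnitIso W).hom ((1 : k) ⊗ₜ[k] y)) = _
  rw [leftUnitIso_apply hy, one_smul, one_smul, TensorProduct.tmul_smul, smul_smul, h,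
    TensorProduct.smul_tmul']

/-- The monoidal category `Vec_A^ω`. -/
instance : MonoidalCategory (GrVec k A ω) where
  tensorObj := tensor
  tensorHom := tensorMor
  whiskerLeft V _ _ f := tensorMor (𝟙 V) f
  whiskerRight f W := tensorMor f (𝟙 W)
  tensorUnit := unit
  associator := assocIso
  leftUnitor := leftUnitIso
  rightUnitor := rightUnitIso
  tensorHom_def _ _ := hom_ext (lin_ext₂ fun _ _ _ _ _ _ => rfl)
  id_tensorHom_id _ _ := hom_ext (lin_ext₂ fun _ _ _ _ _ _ => rfl)
  tensorHom_comp_tensorHom _ _ _ _ := hom_ext (lin_ext₂ fun _ _ _ _ _ _ => rfl)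
  whiskerLeft_id _ _ := hom_ext (lin_ext₂ fun _ _ _ _ _ _ => rfl)
  id_whiskerRight _ _ := hom_ext (lin_ext₂ fun _ _ _ _ _ _ => rfl)
  associator_naturality := assocIso_naturality
  leftUnitor_naturality := leftUnitIso_naturality
  rightUnitor_naturality := rightUnitIso_naturality
  pentagon := assocIso_pentagon
  triangle := assocIso_triangle

instance : MonoidalPreadditive (GrVec k A ω) where
  whiskerLeft_zero := hom_ext (TensorProduct.map_zero_right _)
  zero_whiskerRight := hom_ext (TensorProduct.map_zero_left _)
  whiskerLeft_add _ _ := hom_ext (TensorProduct.map_add_right _ _ _)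
  add_whiskerRight _ _ := hom_ext (TensorProduct.map_add_left _ _ _)

instance : MonoidalLinear k (GrVec k A ω) where
  whiskerLeft_smul _ _ _ _ _ := hom_ext (TensorProduct.map_smul_right _ _ _)
  smul_whiskerRight _ _ _ _ _ := hom_ext (TensorProduct.map_smul_left _ _ _)

end GrVec

/-- The category `Vec_A` of finite dimensional `A`-graded vector spaces, with trivial cocycle. -/
abbrev Vec (k : Type u) [Field k] (A : Type w) [Group A] [Fintype A] :=
  GrVec k A (1 : ThreeCocycle A kˣ)

/-! ### Module categories -/

open Functor.LaxLeftLinear Functor.OplaxLeftLinear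

/-- The left action of `C` on `M` is `k`-bilinear on morphisms. -/
class IsLinearAction (k : Type u) [Field k] (C : Type u₁) [Category.{v₁} C] [Preadditive C]
    [Linear k C] [MonoidalCategory C] (M : Type u₂) [Category.{v₂} M] [Preadditive M]
    [Linear k M] [MonoidalLeftAction C M] : Prop where
  actionHomRight_add (c : C) {m n : M} (f g : m ⟶ n) : c ⊴ₗ (f + g) = c ⊴ₗ f + c ⊴ₗ g
  actionHomRight_smul (c : C) {m n : M} (r : k) (f : m ⟶ n) : c ⊴ₗ (r • f) = r • c ⊴ₗ f
  actionHomLeft_add {c d : C} (f g : c ⟶ d) (m : M) : (f + g) ⊵ₗ m = f ⊵ₗ m + g ⊵ₗ m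
  actionHomLeft_smul {c d : C} (r : k) (f : c ⟶ d) (m : M) : (r • f) ⊵ₗ m = r • f ⊵ₗ m

/-- `M` is an indecomposable module category over `C`: it is nonzero, and if `M` is the direct sum
of two full subcategories which are stable under the action of `C`, then one of them is zero. -/
structure IsIndecomposable (C : Type u₁) [Category.{v₁} C] [MonoidalCategory C]
    (M : Type u₂) [Category.{v₂} M] [Preadditive M] [MonoidalLeftAction C M] : Prop where
  exists_nonzero : ∃ m : M, ¬ IsZero m
  eq_zero_or_eq_zero : ∀ P Q : ObjectProperty M,
    P.IsClosedUnderIsomorphisms → Q.IsClosedUnderIsomorphisms →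
    (∀ (c : C) (m : M), P m → P (c ⊙ₗ m)) → (∀ (c : C) (m : M), Q m → Q (c ⊙ₗ m)) →
    (∀ m n : M, P m → Q n → (∀ f : m ⟶ n, f = 0) ∧ ∀ f : n ⟶ m, f = 0) →
    (∀ x : M, ∃ (m n : M) (b : BinaryBicone m n),
      P m ∧ Q n ∧ Nonempty b.IsBilimit ∧ Nonempty (x ≅ b.pt)) →
    (∀ m, P m → IsZero m) ∨ (∀ m, Q m → IsZero m)

/-- A full monoidal subcategory of a category acting on `M` acts on `M`. -/
instance fullSubcategoryAction {C : Type u₁} [Category.{v₁} C] [MonoidalCategory C]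
    {M : Type u₂} [Category.{v₂} M] [MonoidalLeftAction C M]
    (P : ObjectProperty C) [P.IsMonoidal] : MonoidalLeftAction P.FullSubcategory M where
  actionObj c m := c.obj ⊙ₗ m
  actionHomLeft f m := f.hom ⊵ₗ m
  actionHomRight c _ _ f := c.obj ⊴ₗ f
  actionHom f g := f.hom ⊙ₗₘ g
  actionAssocIso c d m := αₗ c.obj d.obj m
  actionUnitIso m := λₗ[C] m
  actionHom_def f g := MonoidalLeftAction.actionHom_def f.hom g
  actionHomRight_id c m := MonoidalLeftAction.actionHomRight_id c.obj m
  id_actionHomLeft c m := MonoidalLeftAction.id_actionHomLeft c.obj m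
  actionHom_comp f₁ f₂ g₁ g₂ := MonoidalLeftAction.actionHom_comp f₁.hom f₂.hom g₁ g₂
  actionAssocIso_hom_naturality f g h :=
    MonoidalLeftAction.actionAssocIso_hom_naturality f.hom g.hom h
  actionUnitIso_hom_naturality f := MonoidalLeftAction.actionUnitIso_hom_naturality (C := C) f
  whiskerLeft_actionHomLeft c _ _ f m :=
    MonoidalLeftAction.whiskerLeft_actionHomLeft c.obj f.hom m
  whiskerRight_actionHomLeft c f m :=
    MonoidalLeftAction.whiskerRight_actionHomLeft c.obj f.hom m
  associator_actionHom c d e m :=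
    MonoidalLeftAction.associator_actionHom c.obj d.obj e.obj m
  leftUnitor_actionHom c m := MonoidalLeftAction.leftUnitor_actionHom c.obj m
  rightUnitor_actionHom c m := MonoidalLeftAction.rightUnitor_actionHom c.obj m

/-! ### The dual category -/

/-- Objects of the dual category `C^*_M`: `k`-linear endofunctors of `M` commuting with the action
of `C`, that is, `k`-linear module endofunctors. -/
structure Dual (k : Type u) [Field k] (C : Type u₁) [Category.{v₁} C] [MonoidalCategory C]
    (M : Type u₂) [Category.{v₂} M] [Preadditive M] [Linear k M] [MonoidalLeftAction C M] where
  functor : M ⥤ M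
  [additive : functor.Additive]
  [linear : functor.Linear k]
  [leftLinear : functor.LeftLinear C]

namespace Dual

attribute [instance] Dual.additive Dual.linear Dual.leftLinear

variable {k : Type u} [Field k] {C : Type u₁} [Category.{v₁} C] [MonoidalCategory C]
    {M : Type u₂} [Category.{v₂} M] [Preadditive M] [Linear k M] [MonoidalLeftAction C M]

/-- The isomorphism `c ⊙ F m ≅ F (c ⊙ m)` of a module endofunctor. -/
def lineator (F : Dual k C M) (c : C) (m : M) : c ⊙ₗ F.functor.obj m ≅ F.functor.obj (c ⊙ₗ m) :=
  Functor.LeftLinear.μₗIso F.functor c m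

lemma lineator_hom (F : Dual k C M) (c : C) (m : M) :
    (F.lineator c m).hom = μₗ F.functor c m := rfl

/-- Construction of a `LeftLinear` structure from isomorphisms. -/
@[reducible]
def leftLinearOfIso (F : M ⥤ M) (e : ∀ (c : C) (m : M), c ⊙ₗ F.obj m ≅ F.obj (c ⊙ₗ m))
    (naturality_left : ∀ {c d : C} (f : c ⟶ d) (m : M),
      f ⊵ₗ F.obj m ≫ (e d m).hom = (e c m).hom ≫ F.map (f ⊵ₗ m))
    (naturality_right : ∀ (c : C) {m n : M} (f : m ⟶ n),
      c ⊴ₗ F.map f ≫ (e c n).hom = (e c m).hom ≫ F.map (c ⊴ₗ f))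
    (associativity : ∀ (c d : C) (m : M), (e (c ⊗ d) m).hom ≫ F.map (αₗ c d m).hom =
      (αₗ c d (F.obj m)).hom ≫ c ⊴ₗ (e d m).hom ≫ (e c (d ⊙ₗ m)).hom)
    (unitality : ∀ m : M, (λₗ[C] (F.obj m)).hom = (e (𝟙_ C) m).hom ≫ F.map (λₗ[C] m).hom) :
    F.LeftLinear C where
  μₗ c m := (e c m).hom
  δₗ c m := (e c m).inv
  μₗ_naturality_left := naturality_left
  μₗ_naturality_right := naturality_right
  μₗ_associativity := associativity
  μₗ_unitality := unitality
  δₗ_naturality_left f m := by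
    rw [Iso.eq_inv_comp, ← Category.assoc, ← naturality_left, Category.assoc, Iso.hom_inv_id,
      Category.comp_id]
  δₗ_naturality_right c _ _ f := by
    rw [Iso.eq_inv_comp, ← Category.assoc, ← naturality_right, Category.assoc, Iso.hom_inv_id,
      Category.comp_id]
  δₗ_associativity c d m := by
    rw [Iso.inv_comp_eq, ← Category.assoc, associativity]
    simp
  δₗ_unitality_inv m := by
    rw [Iso.eq_comp_inv, ← cancel_epi (λₗ[C] (F.obj m)).hom, Iso.hom_inv_id_assoc, unitality,
      Category.assoc, ← F.map_comp, Iso.hom_inv_id, F.map_id, Category.comp_id]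
  μₗ_comp_δₗ c m := (e c m).hom_inv_id
  δₗ_comp_μₗ c m := (e c m).inv_hom_id

/-- The identity functor. -/
abbrev one : Dual k C M where
  functor := 𝟭 M
  leftLinear := leftLinearOfIso _ (fun _ _ => Iso.refl _) (by simp) (by simp) (by simp) (by simp)

/-- The composition `m ↦ F (G m)`. -/
abbrev comp (F G : Dual k C M) : Dual k C M where
  functor := G.functor ⋙ F.functor
  leftLinear := leftLinearOfIso _
    (fun c m => F.lineator c (G.functor.obj m) ≪≫ F.functor.mapIso (G.lineator c m))
    (fun f m => by simp [lineator, ← Functor.map_comp])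
    (fun c _ _ f => by simp [lineator, ← Functor.map_comp])
    (fun c d m => by
      simp only [lineator, Iso.trans_hom, Functor.mapIso_hom, Functor.comp_map, Functor.comp_obj,
        Category.assoc, MonoidalLeftAction.actionHomRight_comp]
      rw [← F.functor.map_comp, Functor.LaxLeftLinear.μₗ_associativity, F.functor.map_comp,
        F.functor.map_comp, Functor.LaxLeftLinear.μₗ_associativity_assoc,
        Functor.LaxLeftLinear.μₗ_naturality_right_assoc])
    (fun m => by simp [lineator, ← Functor.map_comp])

lemma comp_lineator (F G : Dual k C M) (c : C) (m : M) : (comp F G).lineator c m =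
    F.lineator c (G.functor.obj m) ≪≫ F.functor.mapIso (G.lineator c m) := rfl

lemma one_lineator (c : C) (m : M) : (one : Dual k C M).lineator c m = Iso.refl (c ⊙ₗ m) := rfl

variable [Preadditive C] [Linear k C] [IsLinearAction k C M]

/-- Natural transformations compatible with the module functor structures. -/
def homSubmodule (F G : Dual k C M) : Submodule k (F.functor ⟶ G.functor) where
  carrier := {η | ∀ (c : C) (m : M),
    (F.lineator c m).hom ≫ η.app (c ⊙ₗ m) = c ⊴ₗ η.app m ≫ (G.lineator c m).hom}
  add_mem' {η θ} hη hθ c m := by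
    rw [NatTrans.app_add, NatTrans.app_add, Preadditive.comp_add, hη c m, hθ c m,
      IsLinearAction.actionHomRight_add k, Preadditive.add_comp]
  zero_mem' c m := by
    have h : c ⊴ₗ (0 : F.functor.obj m ⟶ G.functor.obj m) = 0 := by
      have := IsLinearAction.actionHomRight_smul c (0 : k)
        (0 : F.functor.obj m ⟶ G.functor.obj m)
      simpa using this
    rw [NatTrans.app_zero, NatTrans.app_zero, h, comp_zero, zero_comp]
  smul_mem' r η hη c m := by
    rw [NatTrans.app_smul, NatTrans.app_smul, Linear.comp_smul, hη c m,
      IsLinearAction.actionHomRight_smul, Linear.smul_comp]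

instance : Category (Dual k C M) where
  Hom F G := homSubmodule F G
  id F := ⟨𝟙 F.functor, fun c m => by simp⟩
  comp {F G H} η θ := ⟨η.1 ≫ θ.1, fun c m => by
    have h1 := η.2 c m
    have h2 := θ.2 c m
    rw [NatTrans.comp_app, NatTrans.comp_app, reassoc_of% h1, h2,
      MonoidalLeftAction.actionHomRight_comp, Category.assoc]⟩
  id_comp _ := Subtype.ext (Category.id_comp _)
  comp_id _ := Subtype.ext (Category.comp_id _)
  assoc _ _ _ := Subtype.ext (Category.assoc _ _ _)

/-- The underlying natural transformation of a morphism. -/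
def nat {F G : Dual k C M} (η : F ⟶ G) : F.functor ⟶ G.functor := η.1

/-- Construction of morphisms in the dual category. -/
def mkHom {F G : Dual k C M} (η : F.functor ⟶ G.functor) (h : ∀ (c : C) (m : M),
    (F.lineator c m).hom ≫ η.app (c ⊙ₗ m) = c ⊴ₗ η.app m ≫ (G.lineator c m).hom) : F ⟶ G := ⟨η, h⟩

instance : Preadditive (Dual k C M) where
  homGroup F G := inferInstanceAs (AddCommGroup (homSubmodule F G))
  add_comp _ _ _ _ _ _ := Subtype.ext (Preadditive.add_comp _ _ _ _ _ _)
  comp_add _ _ _ _ _ _ := Subtype.ext (Preadditive.comp_add _ _ _ _ _ _)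

instance : Linear k (Dual k C M) where
  homModule F G := inferInstanceAs (Module k (homSubmodule F G))
  smul_comp _ _ _ _ _ _ := Subtype.ext (Linear.smul_comp _ _ _ _ _ _)
  comp_smul _ _ _ _ _ _ := Subtype.ext (Linear.comp_smul _ _ _ _ _ _)

lemma hom_ext {F G : Dual k C M} {η θ : F ⟶ G} (h : ∀ m, (nat η).app m = (nat θ).app m) :
    η = θ := Subtype.ext (NatTrans.ext (funext h))

@[simp] lemma nat_mkHom {F G : Dual k C M} (η : F.functor ⟶ G.functor) (h) :
    nat (mkHom (F := F) (G := G) η h) = η := rfl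
@[simp] lemma nat_id (F : Dual k C M) : nat (𝟙 F) = 𝟙 F.functor := rfl
@[simp] lemma nat_comp {F G H : Dual k C M} (η : F ⟶ G) (θ : G ⟶ H) :
    nat (η ≫ θ) = nat η ≫ nat θ := rfl
@[simp] lemma nat_zero {F G : Dual k C M} : nat (0 : F ⟶ G) = 0 := rfl
@[simp] lemma nat_add {F G : Dual k C M} (η θ : F ⟶ G) : nat (η + θ) = nat η + nat θ := rfl
@[simp] lemma nat_smul {F G : Dual k C M} (r : k) (η : F ⟶ G) : nat (r • η) = r • nat η := rfl

lemma nat_compat {F G : Dual k C M} (η : F ⟶ G) (c : C) (m : M) :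
    (F.lineator c m).hom ≫ (nat η).app (c ⊙ₗ m) = c ⊴ₗ (nat η).app m ≫ (G.lineator c m).hom := η.2 c m

/-- An isomorphism in the dual category from a natural isomorphism. -/
def mkIso {F G : Dual k C M} (η : F.functor ≅ G.functor) (h : ∀ (c : C) (m : M),
    (F.lineator c m).hom ≫ η.hom.app (c ⊙ₗ m) = c ⊴ₗ η.hom.app m ≫ (G.lineator c m).hom) : F ≅ G where
  hom := mkHom η.hom h
  inv := mkHom η.inv fun c m => by
    rw [← cancel_epi (c ⊴ₗ η.hom.app m), ← reassoc_of% (h c m), Iso.hom_inv_id_app,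
      Category.comp_id, ← Category.assoc, ← MonoidalLeftAction.actionHomRight_comp,
      Iso.hom_inv_id_app, MonoidalLeftAction.actionHomRight_id, Category.id_comp]
  hom_inv_id := Subtype.ext η.hom_inv_id
  inv_hom_id := Subtype.ext η.inv_hom_id

/-- The dual category `C^*_M` with the tensor product `F ⊗ G = F ∘ G`. -/
instance : MonoidalCategoryStruct (Dual k C M) where
  tensorObj := comp
  tensorUnit := one
  whiskerLeft F {G H} η := mkHom (F := comp F G) (G := comp F H)
    (Functor.whiskerRight (nat η) F.functor) fun c m => by
      simp only [comp_lineator, Iso.trans_hom, Functor.mapIso_hom, Category.assoc,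
        Functor.whiskerRight_app]
      rw [← F.functor.map_comp, nat_compat, F.functor.map_comp]
      simp [lineator_hom]
  whiskerRight {F G} η H := mkHom (F := comp F H) (G := comp G H)
    (Functor.whiskerLeft H.functor (nat η)) fun c m => by
      simp only [comp_lineator, Iso.trans_hom, Functor.mapIso_hom, Category.assoc,
        Functor.whiskerLeft_app]
      rw [NatTrans.naturality, reassoc_of% (nat_compat η c (H.functor.obj m))]
  tensorHom {F G F' G'} η θ := mkHom (F := comp F F') (G := comp G G')
    (nat θ ◫ nat η) fun c m => by
      simp only [comp_lineator, Iso.trans_hom, Functor.mapIso_hom, Category.assoc,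
        NatTrans.hcomp_app, MonoidalLeftAction.actionHomRight_comp]
      rw [NatTrans.naturality_assoc, reassoc_of% (nat_compat η c (F'.functor.obj m)), ← G.functor.map_comp, nat_compat,
        G.functor.map_comp]
      simp [lineator_hom]
  associator F G H := mkIso (F := comp (comp F G) H) (G := comp F (comp G H))
    (Functor.associator H.functor G.functor F.functor).symm fun c m => by
      simp [comp_lineator, lineator_hom]
  leftUnitor F := mkIso (F := comp one F) (G := F) F.functor.rightUnitor fun c m => by
    simp [comp_lineator, lineator_hom, one_lineator]
  rightUnitor F := mkIso (F := comp F one) (G := F) F.functor.leftUnitor fun c m => by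
    simp [comp_lineator, lineator_hom, one_lineator]

@[simp] lemma whiskerLeft_app (F : Dual k C M) {G H : Dual k C M} (η : G ⟶ H) (m : M) :
    (nat (F ◁ η)).app m = F.functor.map ((nat η).app m) := rfl
@[simp] lemma whiskerRight_app {F G : Dual k C M} (η : F ⟶ G) (H : Dual k C M) (m : M) :
    (nat (η ▷ H)).app m = (nat η).app (H.functor.obj m) := rfl
@[simp] lemma tensorHom_app {F G F' G' : Dual k C M} (η : F ⟶ G) (θ : F' ⟶ G') (m : M) :
    (nat (η ⊗ₘ θ)).app m =
      (nat η).app (F'.functor.obj m) ≫ G.functor.map ((nat θ).app m) := rfl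
@[simp] lemma associator_hom_app (F G H : Dual k C M) (m : M) :
    (nat (α_ F G H).hom).app m = 𝟙 (F.functor.obj (G.functor.obj (H.functor.obj m))) := rfl
@[simp] lemma leftUnitor_hom_app (F : Dual k C M) (m : M) :
    (nat (λ_ F).hom).app m = 𝟙 (F.functor.obj m) := rfl
@[simp] lemma rightUnitor_hom_app (F : Dual k C M) (m : M) :
    (nat (ρ_ F).hom).app m = 𝟙 (F.functor.obj m) := rfl

instance : MonoidalCategory (Dual k C M) where
  tensorHom_def _ _ := hom_ext fun m => by simp
  id_tensorHom_id F _ := hom_ext fun _ => (Category.id_comp _).trans (F.functor.map_id _)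
  tensorHom_comp_tensorHom _ _ _ _ := hom_ext fun m => by simp
  whiskerLeft_id F _ := hom_ext fun _ => F.functor.map_id _
  id_whiskerRight _ _ := hom_ext fun _ => rfl
  associator_naturality {_ _ _ G _ _} _ _ _ := hom_ext fun _ =>
    (Category.comp_id _).trans ((Category.assoc _ _ _).trans
      ((congrArg _ (G.functor.map_comp _ _).symm).trans (Category.id_comp _).symm))
  leftUnitor_naturality _ := hom_ext fun _ => (Category.comp_id _).trans (Category.id_comp _).symm
  rightUnitor_naturality _ := hom_ext fun _ => (Category.comp_id _).trans (Category.id_comp _).symm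
  pentagon F _ _ _ := hom_ext fun _ => (Category.id_comp _).trans ((Category.id_comp _).trans
    ((F.functor.map_id _).trans (Category.id_comp _).symm))
  triangle F _ := hom_ext fun _ => (Category.id_comp _).trans (F.functor.map_id _)

instance : MonoidalPreadditive (Dual k C M) where
  whiskerLeft_zero := hom_ext fun m => by simp
  zero_whiskerRight := hom_ext fun m => by simp
  whiskerLeft_add _ _ := hom_ext fun m => by simp
  add_whiskerRight _ _ := hom_ext fun m => by simp

instance : MonoidalLinear k (Dual k C M) where
  whiskerLeft_smul _ _ _ _ _ := hom_ext fun m => by simp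
  smul_whiskerRight _ _ _ _ _ := hom_ext fun m => by simp

end Dual

section Action

variable {k : Type u} [Field k] {C : Type u₁} [Category.{v₁} C] [MonoidalCategory C]
    [Preadditive C] [Linear k C]
    {M : Type u₂} [Category.{v₂} M] [Preadditive M] [Linear k M] [MonoidalLeftAction C M]
    [IsLinearAction k C M]

/-- The dual category acts on `M` by evaluation. -/
instance dualAction : MonoidalLeftAction (Dual k C M) M where
  actionObj F m := F.functor.obj m
  actionHomLeft η m := (Dual.nat η).app m
  actionHomRight F _ _ f := F.functor.map f
  actionAssocIso F G m := Iso.refl (F.functor.obj (G.functor.obj m))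
  actionUnitIso m := Iso.refl m
  actionHomRight_id F m := F.functor.map_id m
  id_actionHomLeft F m := rfl
  actionHom_comp η₁ η₂ f₁ f₂ := by simp
  actionAssocIso_hom_naturality {_ _ _ G _ _} _ _ _ :=
    (Category.comp_id _).trans ((Category.assoc _ _ _).trans
      ((congrArg _ (Functor.map_comp _ _ _).symm).trans (Category.id_comp _).symm))
  actionUnitIso_hom_naturality f := (Category.id_comp _).trans (Category.comp_id _).symm
  whiskerLeft_actionHomLeft F _ _ η m :=
    ((Category.id_comp _).trans (Category.comp_id _)).symm
  whiskerRight_actionHomLeft F η m :=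
    ((Category.id_comp _).trans (Category.comp_id _)).symm
  associator_actionHom F G H m := (Category.id_comp _).trans ((Category.id_comp _).trans
    ((F.functor.map_id _).trans (Category.id_comp _).symm))
  leftUnitor_actionHom F m := (Category.id_comp _).symm
  rightUnitor_actionHom F m := ((Category.id_comp _).trans (F.functor.map_id _)).symm

end Action

/-! ### Factorization of actions and the dual functor -/

open Functor.LaxMonoidal Functor.OplaxMonoidal

/-- `FactorsThrough F M` is the datum identifying the action of `C` on `M` with the
action `(c, m) ↦ F c ⊙ m` obtained from the action of `D` on `M` and the tensor functor
`F : C ⥤ D`: a natural isomorphism `c ⊙ m ≅ F c ⊙ m` compatible with the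
associativity and unit isomorphisms. -/
structure FactorsThrough {C : Type u₁} [Category.{v₁} C] [MonoidalCategory C]
    {D : Type u₃} [Category.{v₃} D] [MonoidalCategory D] (F : C ⥤ D) [F.Monoidal]
    (M : Type u₂) [Category.{v₂} M] [MonoidalLeftAction C M] [MonoidalLeftAction D M] where
  iso (c : C) (m : M) : c ⊙ₗ m ≅ F.obj c ⊙ₗ m
  naturality_left {c d : C} (f : c ⟶ d) (m : M) :
    f ⊵ₗ m ≫ (iso d m).hom = (iso c m).hom ≫ F.map f ⊵ₗ m
  naturality_right (c : C) {m n : M} (f : m ⟶ n) :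
    c ⊴ₗ f ≫ (iso c n).hom = (iso c m).hom ≫ F.obj c ⊴ₗ f
  associativity (c d : C) (m : M) :
    (iso (c ⊗ d) m).hom ≫ δ F c d ⊵ₗ m ≫ (αₗ (F.obj c) (F.obj d) m).hom =
      (αₗ c d m).hom ≫ c ⊴ₗ (iso d m).hom ≫ (iso c (F.obj d ⊙ₗ m)).hom
  unitality (m : M) : (iso (𝟙_ C) m).hom ≫ η F ⊵ₗ m ≫ (λₗ[D] m).hom = (λₗ[C] m).hom

namespace FactorsThrough

variable {C : Type u₁} [Category.{v₁} C] [MonoidalCategory C]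
    {D : Type u₃} [Category.{v₃} D] [MonoidalCategory D] {F : C ⥤ D} [F.Monoidal]
    {M : Type u₂} [Category.{v₂} M] [MonoidalLeftAction C M] [MonoidalLeftAction D M]

lemma inv_naturality_left (e : FactorsThrough F M) {c d : C} (f : c ⟶ d) (m : M) :
    (e.iso c m).inv ≫ f ⊵ₗ m = F.map f ⊵ₗ m ≫ (e.iso d m).inv := by
  rw [Iso.inv_comp_eq, ← Category.assoc, ← e.naturality_left, Category.assoc, Iso.hom_inv_id,
    Category.comp_id]

lemma inv_naturality_right (e : FactorsThrough F M) (c : C) {m n : M} (f : m ⟶ n) :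
    (e.iso c m).inv ≫ c ⊴ₗ f = F.obj c ⊴ₗ f ≫ (e.iso c n).inv := by
  rw [Iso.inv_comp_eq, ← Category.assoc, ← e.naturality_right, Category.assoc, Iso.hom_inv_id,
    Category.comp_id]

lemma inv_associativity (e : FactorsThrough F M) (c d : C) (m : M) :
    (e.iso (c ⊗ d) m).inv ≫ (αₗ c d m).hom = δ F c d ⊵ₗ m ≫ (αₗ (F.obj c) (F.obj d) m).hom ≫
      (e.iso c (F.obj d ⊙ₗ m)).inv ≫ c ⊴ₗ (e.iso d m).inv := by
  rw [Iso.inv_comp_eq]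
  have h := e.associativity c d m
  rw [reassoc_of% h, Iso.hom_inv_id_assoc, MonoidalLeftAction.actionHomRight_hom_inv,
    Category.comp_id]

lemma inv_unitality (e : FactorsThrough F M) (m : M) :
    (e.iso (𝟙_ C) m).inv ≫ (λₗ[C] m).hom = η F ⊵ₗ m ≫ (λₗ[D] m).hom := by
  rw [Iso.inv_comp_eq, e.unitality]

end FactorsThrough

/-- A tensor functor is surjective if every object of the target is a direct summand of an object
in the image. -/
def IsSurjective {C : Type u₁} [Category.{v₁} C] {D : Type u₃} [Category.{v₃} D]
    (F : C ⥤ D) : Prop :=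
  ∀ Y : D, ∃ X : C, Nonempty (Retract Y (F.obj X))

section DualFunctor

variable {k : Type u} [Field k]
    {C : Type u₁} [Category.{v₁} C] [MonoidalCategory C]
    {D : Type u₃} [Category.{v₃} D] [MonoidalCategory D]
    {F : C ⥤ D} [F.Monoidal]
    {M : Type u₂} [Category.{v₂} M] [Preadditive M] [Linear k M]
    [MonoidalLeftAction C M] [MonoidalLeftAction D M]

/-- An endofunctor commuting with the action of `D` commutes with the action of `C`: the
isomorphism is `c ⊙ G m ≅ F c ⊙ G m ≅ G (F c ⊙ m) ≅ G (c ⊙ m)`. -/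
abbrev FactorsThrough.dualObj (e : FactorsThrough F M) (G : Dual k D M) : Dual k C M where
  functor := G.functor
  leftLinear := Dual.leftLinearOfIso G.functor
    (fun c m => e.iso c (G.functor.obj m) ≪≫ G.lineator (F.obj c) m ≪≫
      G.functor.mapIso (e.iso c m).symm)
    (fun {c d} f m => by
      simp only [Iso.trans_hom, Functor.mapIso_hom, Iso.symm_hom, Category.assoc,
        Dual.lineator_hom]
      rw [reassoc_of% (e.naturality_left f (G.functor.obj m)), ← G.functor.map_comp,
        inv_naturality_left, G.functor.map_comp, Functor.LaxLeftLinear.μₗ_naturality_left_assoc])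
    (fun c _ _ f => by
      simp only [Iso.trans_hom, Functor.mapIso_hom, Iso.symm_hom, Category.assoc,
        Dual.lineator_hom]
      rw [reassoc_of% (e.naturality_right c (G.functor.map f)), ← G.functor.map_comp,
        inv_naturality_right, G.functor.map_comp, Functor.LaxLeftLinear.μₗ_naturality_right_assoc])
    (fun c d m => by
      simp only [Iso.trans_hom, Functor.mapIso_hom, Iso.symm_hom, Category.assoc,
        Dual.lineator_hom, MonoidalLeftAction.actionHomRight_comp]
      rw [← G.functor.map_comp, inv_associativity, G.functor.map_comp, G.functor.map_comp,
        G.functor.map_comp, ← Functor.LaxLeftLinear.μₗ_naturality_left_assoc,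
        Functor.LaxLeftLinear.μₗ_associativity_assoc,
        reassoc_of% (e.associativity c d (G.functor.obj m)),
        reassoc_of% (e.naturality_right c (G.functor.map (e.iso d m).inv)),
        Functor.LaxLeftLinear.μₗ_naturality_right_assoc, ← G.functor.map_comp,
        ← G.functor.map_comp, inv_naturality_right,
        reassoc_of% (e.naturality_right c (μₗ G.functor (F.obj d) m))])
    (fun m => by
      simp only [Iso.trans_hom, Functor.mapIso_hom, Iso.symm_hom, Category.assoc,
        Dual.lineator_hom]
      rw [← G.functor.map_comp, inv_unitality, G.functor.map_comp,
        ← Functor.LaxLeftLinear.μₗ_naturality_left_assoc, ← Functor.LaxLeftLinear.μₗ_unitality,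
        e.unitality])

lemma FactorsThrough.dualObj_lineator (e : FactorsThrough F M) (G : Dual k D M) (c : C) (m : M) :
    (e.dualObj G).lineator c m = e.iso c (G.functor.obj m) ≪≫ G.lineator (F.obj c) m ≪≫
      G.functor.mapIso (e.iso c m).symm := rfl

variable [Preadditive C] [Linear k C] [Preadditive D] [Linear k D]
    [IsLinearAction k C M] [IsLinearAction k D M]

/-- The dual functor `F^* : D^*_M ⥤ C^*_M`. -/
def FactorsThrough.dualFunctor (e : FactorsThrough F M) : Dual k D M ⥤ Dual k C M where
  obj G := e.dualObj G
  map {G H} η := Dual.mkHom (F := e.dualObj G) (G := e.dualObj H)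
    (Dual.nat (F := G) (G := H) η) fun c m => by
      simp only [dualObj_lineator, Iso.trans_hom, Functor.mapIso_hom, Iso.symm_hom, Category.assoc]
      rw [NatTrans.naturality, reassoc_of% (Dual.nat_compat η (F.obj c) m),
        reassoc_of% (e.naturality_right c ((Dual.nat η).app m))]
  map_id _ := rfl
  map_comp _ _ := rfl

/-- The dual functor `F^*` is a tensor functor; its tensor structure is the identity. -/
instance (e : FactorsThrough F M) : (e.dualFunctor (k := k)).Monoidal :=
  Functor.CoreMonoidal.toMonoidal
    { εIso := Dual.mkIso (F := Dual.one) (G := e.dualObj Dual.one) (Iso.refl (𝟭 M))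
        fun c m => by
          simp [FactorsThrough.dualObj_lineator, Dual.one_lineator]
      μIso G H := Dual.mkIso (F := Dual.comp (e.dualObj G) (e.dualObj H))
        (G := e.dualObj (Dual.comp G H)) (Iso.refl (H.functor ⋙ G.functor)) fun c m => by
          simp [FactorsThrough.dualObj_lineator, Dual.comp_lineator]
      μIso_hom_natural_left _ _ := Dual.hom_ext fun m =>
        (Category.comp_id _).trans (Category.id_comp _).symm
      μIso_hom_natural_right _ _ := Dual.hom_ext fun m =>
        (Category.comp_id _).trans (Category.id_comp _).symm
      associativity G _ _ := Dual.hom_ext fun _ => (Category.id_comp _).trans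
        ((Category.id_comp _).trans ((Category.id_comp _).trans
          ((Category.comp_id _).trans (G.functor.map_id _))).symm)
      left_unitality _ := Dual.hom_ext fun _ =>
        ((Category.id_comp _).trans (Category.id_comp _)).symm
      right_unitality G := Dual.hom_ext fun _ =>
        ((congrArg (_ ≫ ·) (Category.id_comp _)).trans
          ((Category.comp_id _).trans (G.functor.map_id _))).symm }

end DualFunctor

end TensorCat

end

/-! Write `C` for the full subcategory given by `P`. Since `C` acts on `M` by functors commuting
with `Vec_A`, evaluation is a tensor functor `Θ : Vec_A → C^*_M`, and the proof studies its image.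

Schur's lemma. `M` is indecomposable over the rigid category `C`, so every simple object of `M` is a
retract of `c ⊙ L` for any fixed simple `L` (`exists_retract_act`). A morphism in `C^*_M` is
therefore determined by its component at `L`. The functors `Θ (line g)` are invertible, so they send
simples to simples; hence a nonzero morphism between two of them is an isomorphism, and it is unique
up to a scalar (`Dual.isIso_of_ne_zero`, `Dual.eq_smul_of_ne_zero`).

The group and the cocycle. Let `B` be the quotient of `A` that identifies `g` and `h` when `Θ (line
g) ≅ Θ (line h)`. Choose a section `s` and isomorphisms `φ : Θ (line g) ≅ Θ (line (s (π g)))`. The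
resulting multiplication on the objects `Θ (line (s b))` is associative up to scalars, and by the
pentagon these form a 3-cocycle `ω` on `B` (`Reduction.scalar_cocycle`). The failure of `φ` to be
multiplicative is a 2-cochain on `A` whose coboundary trivializes the pullback of `ω`
(`Reduction.defect_assoc`). This cochain is a tensor structure on the push-forward `F : Vec_A →
Vec_B^ω`, and `Θ ≅ F ⋙ S` for a tensor functor `S : Vec_B^ω → C^*_M` (`Reduction.factorIso`). The
action of `Vec_B^ω` on `M` is pulled back along `S`.

Comparison of the duals. Surjectivity of `F` makes `F^*` full, and faithfulness is immediate. Each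
`c` in `C` commutes with the new action because `S` takes values in `C`-module functors, so `C` lies
in the image of `F^*` (`dualObjLiftIso`).

The reverse inclusion is a double centralizer argument. Let `m₀` be the sum of the simples of `M`.
An object `Y` of `(Vec_B^ω)^*_M` has a fibre `Hom(m₀, Y m₀)`, on which an algebra of operators built
from the action of `Vec_B^ω` acts; operator-linear maps of fibres are exactly the morphisms
(`Dual.exists_hom`). Three facts are combined. The fibres are semisimple, by Maschke averaging over
`B` in characteristic zero (`InvertibleFamily.isSemisimple_fiber`). An operator that vanishes on the
fibres of all objects of `C` is zero, by an independence theorem in the style of Dedekind's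
independence of characters (`Dual.annihilators_eq_zero`); this is where the non-isomorphism of the
`S (line b)` enters. Finally, a finitely generated module killed by the annihilator of a semisimple
module of finite dimension is a retract of a power of it (`exists_retract_of_annihilator`). So the
identity of any `Y` factors through simples of `C`, and Gaussian elimination turns this into a
direct sum decomposition (`exists_dec_of_id_eq_sum`). -/

set_option linter.unusedSectionVars false

noncomputable section

namespace TensorCat

/-! ### Lines and homogeneous elements of graded vector spaces -/

section

namespace GrVec

variable {k : Type u} [Field k] {A : Type w} [Group A] [Fintype A] {ω : ThreeCocycle A kˣ}

/-- Homogeneity of an element with respect to two different degrees forces it to vanish. -/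
lemma Homog.eq_zero {V : GrVec k A ω} {g h : A} {v : V.carrier} (hv : V.Homog g v)
    (hw : V.Homog h v) (hgh : g ≠ h) : v = 0 := by
  rw [← hv, hw.proj_of_ne hgh]

open Classical in
/-- The one-dimensional graded vector space concentrated in degree `g`. -/
abbrev line (g : A) : GrVec k A ω where
  carrier := k
  proj x := if x = g then 1 else 0
  isGrading := by
    rw [CompleteOrthogonalIdempotents.iff_ortho_complete]
    refine ⟨fun x y hxy => ?_, by simp⟩
    by_cases hx : x = g
    · have hy : y ≠ g := fun h => hxy (hx.trans h.symm)
      simp [hy]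
    · simp [hx]

lemma homog_line (g : A) (r : k) : (line g : GrVec k A ω).Homog g r := by
  simp only [Homog, if_pos]
  rfl

/-- The morphism from a line given by a homogeneous element. -/
def ofHomog {V : GrVec k A ω} {g : A} {v : V.carrier} (hv : V.Homog g v) : line g ⟶ V :=
  ofLin (LinearMap.toSpanSingleton k _ v) <| degreeZero_of_homog fun h r hr => by
    by_cases hg : h = g
    · subst hg; exact hv.smul r
    · have : r = 0 := by rw [← hr, (homog_line g r).proj_of_ne hg]
      subst this
      simp [Homog]

/-- The morphism to a line given by the restriction of a functional to a homogeneous component. -/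
def coord (V : GrVec k A ω) (g : A) (ξ : V.carrier →ₗ[k] k) : V ⟶ line g :=
  ofLin (ξ ∘ₗ V.proj g) <| degreeZero_of_homog fun h v hv => by
    by_cases hg : h = g
    · subst hg; exact homog_line _ _
    · simp [hv.proj_of_ne (Ne.symm hg), Homog]

lemma lineHom_ext {V : GrVec k A ω} {g : A} {f f' : line g ⟶ V}
    (h : lin f (1 : k) = lin f' (1 : k)) : f = f' :=
  hom_ext (LinearMap.ext_ring h)

lemma ofHomog_comp {V W : GrVec k A ω} {g : A} {v : V.carrier} (hv : V.Homog g v) (f : V ⟶ W) :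
    ofHomog hv ≫ f = ofHomog (hv.map f) :=
  lineHom_ext (by
    change lin f ((1 : k) • v) = (1 : k) • lin f v
    rw [map_smul])

lemma ofHomog_coord_same {V : GrVec k A ω} {g : A} {v : V.carrier} (hv : V.Homog g v)
    (ξ : V.carrier →ₗ[k] k) : ofHomog hv ≫ coord V g ξ = ξ v • 𝟙 _ :=
  lineHom_ext (by
    change ξ (V.proj g ((1 : k) • v)) = ξ v • (1 : k)
    rw [one_smul, hv, smul_eq_mul, mul_one])

lemma ofHomog_coord_of_ne {V : GrVec k A ω} {g h : A} {v : V.carrier} (hv : V.Homog g v)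
    (ξ : V.carrier →ₗ[k] k) (hgh : h ≠ g) : ofHomog hv ≫ coord V h ξ = 0 :=
  lineHom_ext (by
    change ξ (V.proj h ((1 : k) • v)) = 0
    rw [one_smul, hv.proj_of_ne hgh, map_zero])

/-- A basis of the underlying vector space. -/
def basis (V : GrVec k A ω) := Module.finBasis k V.carrier

/-- The chosen basis need not be homogeneous: expanding the degree `g` part of a vector in it and
projecting back to degree `g` recovers that part. This lets additive functors on graded spaces be
controlled by their values on lines. -/
lemma id_eq_sum (V : GrVec k A ω) :
    𝟙 V = ∑ g, ∑ i, coord V g (V.basis.coord i) ≫ ofHomog (V.homog_proj g (V.basis i)) := by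
  refine hom_ext (LinearMap.ext fun v => ?_)
  have key : ∀ (s : Finset A) (t : Finset (Fin (Module.finrank k V.carrier)))
      (f : A → Fin (Module.finrank k V.carrier) → (V ⟶ V)),
      lin (∑ g ∈ s, ∑ i ∈ t, f g i) v = ∑ g ∈ s, ∑ i ∈ t, lin (f g i) v := by
    intro s t f
    let l : (V ⟶ V) →+ V.carrier :=
      ⟨⟨fun f => lin f v, rfl⟩, fun _ _ => rfl⟩
    change l _ = ∑ g ∈ s, ∑ i ∈ t, l _
    simp [map_sum]
  rw [key]
  change v = ∑ g, ∑ i, V.basis.repr (V.proj g v) i • V.proj g (V.basis i)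
  conv_lhs => rw [← V.sum_proj v]
  refine Finset.sum_congr rfl fun g _ => ?_
  have h2 := congrArg (V.proj g) (V.basis.sum_repr (V.proj g v))
  rw [map_sum, V.homog_proj g v] at h2
  simpa only [map_smul] using h2.symm

section Additive

variable {Y : Type u₂} [Category.{v₂} Y] [Preadditive Y]

lemma functor_id_eq_sum (Z : GrVec k A ω ⥤ Y) [Z.Additive] (V : GrVec k A ω) :
    𝟙 (Z.obj V) = ∑ g, ∑ i, Z.map (coord V g (V.basis.coord i)) ≫
      Z.map (ofHomog (V.homog_proj g (V.basis i))) := by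
  rw [← Z.map_id, id_eq_sum]
  simp [Functor.map_sum]

/-- Morphisms out of `Z V` are determined by their restrictions to the homogeneous elements. -/
lemma functor_hom_ext (Z : GrVec k A ω ⥤ Y) [Z.Additive] {V : GrVec k A ω} {y : Y}
    {f f' : Z.obj V ⟶ y}
    (h : ∀ g v (hv : V.Homog g v), Z.map (ofHomog hv) ≫ f = Z.map (ofHomog hv) ≫ f') :
    f = f' := by
  rw [← Category.id_comp f, ← Category.id_comp f', functor_id_eq_sum]
  simp only [Preadditive.sum_comp, Category.assoc, h]

variable [Linear k Y]

/-- The morphism `Z V ⟶ y` defined by a linear family of morphisms on the homogeneous elements. -/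
def desc (Z : GrVec k A ω ⥤ Y) {V : GrVec k A ω} {y : Y}
    (β : ∀ g, V.carrier →ₗ[k] (Z.obj (line g) ⟶ y)) : Z.obj V ⟶ y :=
  ∑ g, ∑ i, Z.map (coord V g (V.basis.coord i)) ≫ β g (V.proj g (V.basis i))

/-- Characterizes `desc` independently of the basis: terms of other degrees vanish, and in degree
`g` linearity of `β g` reassembles the basis expansion of `v`. -/
lemma map_ofHomog_desc (Z : GrVec k A ω ⥤ Y) [Z.Additive] [Z.Linear k] {V : GrVec k A ω} {y : Y}
    (β : ∀ g, V.carrier →ₗ[k] (Z.obj (line g) ⟶ y)) {g : A} {v : V.carrier} (hv : V.Homog g v) :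
    Z.map (ofHomog hv) ≫ desc Z β = β g v := by
  rw [desc, Preadditive.comp_sum, Finset.sum_eq_single g]
  · rw [Preadditive.comp_sum]
    have h : ∀ i, Z.map (ofHomog hv) ≫ Z.map (coord V g (V.basis.coord i)) ≫
        β g (V.proj g (V.basis i)) = β g (V.proj g (V.basis.repr v i • V.basis i)) := by
      intro i
      rw [← Category.assoc, ← Z.map_comp, ofHomog_coord_same, Z.map_smul, Z.map_id,
        Linear.smul_comp, Category.id_comp, map_smul, map_smul]
      rfl
    rw [Finset.sum_congr rfl fun i _ => h i, ← map_sum, ← map_sum, V.basis.sum_repr, hv]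
  · intro h _ hh
    rw [Preadditive.comp_sum]
    refine Finset.sum_eq_zero fun i _ => ?_
    rw [← Category.assoc, ← Z.map_comp, ofHomog_coord_of_ne hv _ hh, Z.map_zero, zero_comp]
  · simp

end Additive

section Monoidal

variable {N : Type u₂} [Category.{v₂} N] [Preadditive N] [MonoidalCategory N]
  [MonoidalPreadditive N] {B : Type v} [Group B] [Fintype B] {ω' : ThreeCocycle B kˣ}
  {B' : Type v₁} [Group B'] [Fintype B'] {ω'' : ThreeCocycle B' kˣ}

/-- Tensoring with a fixed object is additive, so `functor_hom_ext` can be applied in one variable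
at a time. -/
lemma tensor_hom_ext (Z : GrVec k A ω ⥤ N) [Z.Additive] (Z' : GrVec k B ω' ⥤ N) [Z'.Additive]
    {V : GrVec k A ω} {W : GrVec k B ω'} {y : N} {f f' : Z.obj V ⊗ Z'.obj W ⟶ y}
    (h : ∀ g v (hv : V.Homog g v) g' w (hw : W.Homog g' w),
      (Z.map (ofHomog hv) ⊗ₘ Z'.map (ofHomog hw)) ≫ f =
        (Z.map (ofHomog hv) ⊗ₘ Z'.map (ofHomog hw)) ≫ f') : f = f' := by
  refine functor_hom_ext (Z ⋙ tensorRight (Z'.obj W)) fun g v hv => ?_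
  refine functor_hom_ext (Z' ⋙ tensorLeft (Z.obj (line g))) fun g' w hw => ?_
  have := h g v hv g' w hw
  simpa [tensorHom_def', Category.assoc] using this

lemma tensor_hom_ext₃ (Z : GrVec k A ω ⥤ N) [Z.Additive] (Z' : GrVec k B ω' ⥤ N) [Z'.Additive]
    (Z'' : GrVec k B' ω'' ⥤ N) [Z''.Additive]
    {V : GrVec k A ω} {W : GrVec k B ω'} {U : GrVec k B' ω''} {y : N}
    {f f' : (Z.obj V ⊗ Z'.obj W) ⊗ Z''.obj U ⟶ y}
    (h : ∀ g v (hv : V.Homog g v) g' w (hw : W.Homog g' w) g'' u (hu : U.Homog g'' u),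
      ((Z.map (ofHomog hv) ⊗ₘ Z'.map (ofHomog hw)) ⊗ₘ Z''.map (ofHomog hu)) ≫ f =
        ((Z.map (ofHomog hv) ⊗ₘ Z'.map (ofHomog hw)) ⊗ₘ Z''.map (ofHomog hu)) ≫ f') : f = f' := by
  refine functor_hom_ext (Z ⋙ tensorRight (Z'.obj W) ⋙ tensorRight (Z''.obj U)) fun g v hv => ?_
  refine functor_hom_ext (Z' ⋙ tensorLeft (Z.obj (line g)) ⋙ tensorRight (Z''.obj U))
    fun g' w hw => ?_
  refine functor_hom_ext (Z'' ⋙ tensorLeft (Z.obj (line g) ⊗ Z'.obj (line g'))) fun g'' u hu => ?_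
  have := h g v hv g' w hw g'' u hu
  simp only [tensorHom_def', Category.assoc, comp_whiskerRight] at this
  simpa using this

end Monoidal

end GrVec

end

/-! ### Lines under a tensor functor -/

section

open Functor.LaxMonoidal Functor.OplaxMonoidal

namespace GrVec

variable {k : Type u} [Field k] {A : Type w} [Group A] [Fintype A] {ω : ThreeCocycle A kˣ}

lemma Homog.tmul' {V W : GrVec k A ω} {g h : A} {v : V.carrier} {w : W.carrier}
    (hv : V.Homog g v) (hw : W.Homog h w) : (V ⊗ W).Homog (g * h) (v ⊗ₜ[k] w) := hv.tmul hw

/-- The identification of lines of equal degree. -/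
def lineCast {g h : A} (e : g = h) : (line g : GrVec k A ω) ⟶ line h :=
  ofHomog (V := line h) (v := (1 : k)) (by subst e; exact homog_line _ _)

@[simp] lemma lineCast_rfl (g : A) : (lineCast rfl : (line g : GrVec k A ω) ⟶ line g) = 𝟙 _ :=
  lineHom_ext (by
    change (1 : k) • (1 : k) = 1
    simp)

/-- The multiplication of lines. -/
def lineMul {g h l : A} (e : g * h = l) : (line g : GrVec k A ω) ⊗ line h ⟶ line l :=
  ofLin (V := tensor (line g) (line h)) (TensorProduct.lid k k).toLinearMap <| by
    refine degreeZero_tensor (U := line l) fun a v b w hv hw => ?_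
    by_cases ha : a = g
    · by_cases hb : b = h
      · subst ha hb e; exact homog_line _ _
      · rw [Homog.eq_zero hw (homog_line h _) hb]; simp [Homog]
    · rw [Homog.eq_zero hv (homog_line g _) ha]; simp [Homog]

lemma lineMul_tmul {g h l : A} (e : g * h = l) (r r' : k) :
    lin (lineMul (ω := ω) e) (r ⊗ₜ[k] r') = r * r' := rfl

instance {g h l : A} (e : g * h = l) : IsIso (lineMul (k := k) (ω := ω) e) := by
  subst e
  refine ⟨ofHomog (V := line g ⊗ line h) ((homog_line g (1 : k)).tmul' (homog_line h (1 : k))),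
    ?_, ?_⟩
  · refine hom_ext (TensorProduct.ext (LinearMap.ext_ring (LinearMap.ext_ring ?_)))
    change ((1 : k) * 1) • ((1 : k) ⊗ₜ[k] (1 : k)) = (1 : k) ⊗ₜ[k] (1 : k)
    simp
  · refine lineHom_ext ?_
    change lin (lineMul (ω := ω) (rfl : g * h = g * h)) ((1 : k) • ((1 : k) ⊗ₜ[k] (1 : k))) = (1 : k)
    rw [one_smul, lineMul_tmul, one_mul]

lemma ofHomog_tensor {V W : GrVec k A ω} {g h : A} {v : V.carrier} {w : W.carrier}
    (hv : V.Homog g v) (hw : W.Homog h w) :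
    ofHomog hv ⊗ₘ ofHomog hw = lineMul rfl ≫ ofHomog (hv.tmul' hw) := by
  refine hom_ext (TensorProduct.ext (LinearMap.ext_ring (LinearMap.ext_ring ?_)))
  change ((1 : k) • v) ⊗ₜ[k] ((1 : k) • w) = ((1 : k) * 1) • (v ⊗ₜ[k] w)
  simp

/-- The identification of the unit object with the line of degree `1`. -/
def unitIso : (𝟙_ (GrVec k A ω)) ≅ line 1 where
  hom := ofHomog (V := line 1) (g := 1) (homog_line 1 (1 : k))
  inv := ofHomog (V := unit) (g := 1) (homog_unit (1 : k))
  hom_inv_id := lineHom_ext (by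
    change ((1 : k) • (1 : k)) • (1 : k) = 1
    simp)
  inv_hom_id := lineHom_ext (by
    change ((1 : k) • (1 : k)) • (1 : k) = 1
    simp)

/-- Strict associativity is special to the trivial cocycle. The products are variables with
equations rather than literal products, so that both bracketings land in the same line without
transport. -/
lemma lineMul_assoc {g h l gh hl m : A} (e₁ : g * h = gh) (e₂ : h * l = hl) (e₃ : gh * l = m)
    (e₄ : g * hl = m) : (lineMul e₁ ▷ line l) ≫ lineMul e₃ =
      (α_ (line g : Vec k A) (line h) (line l)).hom ≫ (line g ◁ lineMul e₂) ≫ lineMul e₄ := by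
  refine hom_ext (TensorProduct.ext (TensorProduct.ext
    (LinearMap.ext_ring (LinearMap.ext_ring (LinearMap.ext_ring ?_)))))
  have key := assocIso_apply (ω := (1 : ThreeCocycle A kˣ)) (homog_line g (1 : k))
    (homog_line h (1 : k)) (homog_line l (1 : k))
  change ((1 : k) * 1) * 1 = lin (lineMul e₄) (lin (line g ◁ lineMul e₂)
    (lin (assocIso (line g) (line h) (line l)).hom (((1 : k) ⊗ₜ[k] (1 : k)) ⊗ₜ[k] (1 : k))))
  rw [key, map_smul, map_smul]
  change _ = (1 : k) * ((1 : k) * (1 * 1))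
  simp

lemma lineMul_one_left {g : A} : (unitIso.hom ▷ line g) ≫ lineMul (one_mul g) =
    (λ_ (line g : Vec k A)).hom := by
  refine hom_ext (TensorProduct.ext (LinearMap.ext_ring (LinearMap.ext_ring ?_)))
  have h := leftUnitIso_apply (ω := (1 : ThreeCocycle A kˣ)) (homog_line g (1 : k)) 1
  change ((1 : k) • (1 : k)) * (1 : k) = lin (leftUnitIso (line g)).hom ((1 : k) ⊗ₜ[k] (1 : k))
  rw [h]
  change _ = (1 : k) * ((1⁻¹ : kˣ) * (1 : k))
  simp

lemma lineMul_one_right {g : A} : (line g ◁ unitIso.hom) ≫ lineMul (mul_one g) =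
    (ρ_ (line g : Vec k A)).hom := by
  refine hom_ext (TensorProduct.ext (LinearMap.ext_ring (LinearMap.ext_ring ?_)))
  have h := rightUnitIso_apply (ω := (1 : ThreeCocycle A kˣ)) (homog_line g (1 : k)) 1
  change (1 : k) * ((1 : k) • (1 : k)) = lin (rightUnitIso (line g)).hom ((1 : k) ⊗ₜ[k] (1 : k))
  rw [h]
  change _ = (1 : k) * ((1 : kˣ) * (1 : k))
  simp

section Monoidal

variable {N : Type u₂} [Category.{v₂} N] [MonoidalCategory N] (Θ : Vec k A ⥤ N) [Θ.Monoidal]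

/-- The multiplication `Θ (line g) ⊗ Θ (line h) ⟶ Θ (line (g * h))`. -/
def mulHom {g h l : A} (e : g * h = l) :
    Θ.obj (line g) ⊗ Θ.obj (line h) ⟶ Θ.obj (line l) := μ Θ _ _ ≫ Θ.map (lineMul e)

instance {g h l : A} (e : g * h = l) : IsIso (mulHom Θ e) := by
  unfold mulHom; infer_instance

lemma map_ofHomog_tensor_μ {V W : Vec k A} {g h : A} {v : V.carrier} {w : W.carrier}
    (hv : V.Homog g v) (hw : W.Homog h w) :
    (Θ.map (ofHomog hv) ⊗ₘ Θ.map (ofHomog hw)) ≫ μ Θ V W =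
      mulHom Θ rfl ≫ Θ.map (ofHomog (hv.tmul' hw)) := by
  rw [μ_natural, ofHomog_tensor, mulHom, Θ.map_comp, Category.assoc]

/-- The reference point for the later scalars: before passing to the quotient group the
multiplication is associative on the nose. -/
lemma mulHom_assoc {g h l gh hl m : A} (e₁ : g * h = gh) (e₂ : h * l = hl) (e₃ : gh * l = m)
    (e₄ : g * hl = m) : (mulHom Θ e₁ ▷ Θ.obj (line l)) ≫ mulHom Θ e₃ =
      (α_ _ _ _).hom ≫ (Θ.obj (line g) ◁ mulHom Θ e₂) ≫ mulHom Θ e₄ := by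
  simp only [mulHom, comp_whiskerRight, Category.assoc, MonoidalCategory.whiskerLeft_comp,
    μ_natural_left_assoc, μ_natural_right_assoc, ← Θ.map_comp]
  rw [lineMul_assoc e₁ e₂ e₃ e₄, Θ.map_comp, Functor.LaxMonoidal.associativity_assoc]

/-- The unit `𝟙_ N ≅ Θ (line 1)`. -/
def unitHom : 𝟙_ N ⟶ Θ.obj (line 1) := ε Θ ≫ Θ.map unitIso.hom

instance : IsIso (unitHom Θ) := by
  unfold unitHom; infer_instance

lemma mulHom_one_left (g : A) : (unitHom Θ ▷ Θ.obj (line g)) ≫ mulHom Θ (one_mul g) =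
    (λ_ _).hom := by
  simp only [mulHom, unitHom, comp_whiskerRight, Category.assoc, μ_natural_left_assoc,
    ← Θ.map_comp]
  rw [lineMul_one_left, Functor.LaxMonoidal.left_unitality]

lemma mulHom_one_right (g : A) : (Θ.obj (line g) ◁ unitHom Θ) ≫ mulHom Θ (mul_one g) =
    (ρ_ _).hom := by
  simp only [mulHom, unitHom, MonoidalCategory.whiskerLeft_comp, Category.assoc,
    μ_natural_right_assoc, ← Θ.map_comp]
  rw [lineMul_one_right, Functor.LaxMonoidal.right_unitality]

end Monoidal

end GrVec

end

/-! ### The quotient group: multiplication on representatives and its 3-cocycle -/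

section

open GrVec

section Linear

variable {k : Type u} [Field k] {N : Type u₂} [Category.{v₂} N] [Preadditive N] [Linear k N]

/-- All identities between the scalars below are read off from equal multiples of one isomorphism by
this cancellation. -/
lemma smul_cancel_of_isIso {X Y : N} {f : X ⟶ Y} [IsIso f] (hX : 𝟙 X ≠ 0) {c d : k}
    (h : c • f = d • f) : c = d := by
  have h1 : (c - d) • 𝟙 X = 0 := by
    rw [← IsIso.hom_inv_id f, ← Linear.smul_comp, sub_smul, h, sub_self, zero_comp]
  rcases smul_eq_zero.1 h1 with h2 | h2
  · exact sub_eq_zero.1 h2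
  · exact absurd h2 hX

lemma id_ne_zero_of_iso {X Y : N} (e : X ≅ Y) (hX : 𝟙 X ≠ 0) : 𝟙 Y ≠ 0 := fun h => hX <| by
  rw [← e.hom_inv_id, ← Category.id_comp e.inv, h, zero_comp, comp_zero]

end Linear

/-- A surjection of groups `π : A → B`, together with a section and isomorphisms
`Θ (line g) ≅ Θ (line (s b))` for `g` in the fibre over `b`, for a tensor functor `Θ` such that
the spaces of morphisms between the objects `Θ (line g)` are at most one-dimensional. -/
structure Reduction {k : Type u} [Field k] {A : Type w} [Group A] [Fintype A]
    {N : Type u₂} [Category.{v₂} N] [Preadditive N] [Linear k N]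
    (Θ : Vec k A ⥤ N) (B : Type v) [Group B] where
  π : A →* B
  s : B → A
  π_s : ∀ b, π (s b) = b
  s_one : s 1 = 1
  φ : ∀ {g : A} {b : B}, π g = b → (Θ.obj (line g) ≅ Θ.obj (line (s b)))
  φ_s : ∀ b, φ (π_s b) = Iso.refl _
  id_ne_zero : ∀ g, 𝟙 (Θ.obj (line g)) ≠ 0
  eq_smul : ∀ {g h : A} (f f' : Θ.obj (line g) ⟶ Θ.obj (line h)), f ≠ 0 → ∃ c : k, f' = c • f

namespace Reduction

variable {k : Type u} [Field k] {A : Type w} [Group A] [Fintype A]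
    {N : Type u₂} [Category.{v₂} N] [Preadditive N] [Linear k N] {Θ : Vec k A ⥤ N}
    {B : Type v} [Group B] (R : Reduction Θ B)

/-- The object `Θ (line (s b))`. -/
abbrev T (b : B) : N := Θ.obj (line (R.s b))

include R in
-- Hom spaces between the objects `Θ (line g)` are at most one-dimensional, and isomorphisms are
-- nonzero. The source is allowed to be merely isomorphic to some `Θ (line g)`, so that it may be a
-- tensor product.
lemma exists_unit {g h : A} {X : N} (e : X ≅ Θ.obj (line g)) (f f' : X ⟶ Θ.obj (line h))
    [IsIso f] [IsIso f'] : ∃ c : kˣ, f' = (c : k) • f := by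
  have hX : 𝟙 X ≠ 0 := id_ne_zero_of_iso e.symm (R.id_ne_zero g)
  have ne : ∀ (f : X ⟶ Θ.obj (line h)) [IsIso f], e.inv ≫ f ≠ 0 := by
    intro f _ h0
    apply hX
    rw [← e.hom_inv_id, ← Category.comp_id e.inv, ← IsIso.hom_inv_id f, reassoc_of% h0, zero_comp,
      comp_zero]
  obtain ⟨c, hc⟩ := R.eq_smul (e.inv ≫ f) (e.inv ≫ f') (ne f)
  have hc0 : c ≠ 0 := by
    rintro rfl
    exact ne f' (by rw [hc, zero_smul])
  refine ⟨Units.mk0 c hc0, ?_⟩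
  rw [← cancel_epi e.inv, hc, Linear.comp_smul, Units.val_mk0]

lemma φ_hom_eq {g : A} {b : B} (h : π R g = b) (e : g = R.s b) :
    (R.φ h).hom = Θ.map (lineCast e) := by
  subst e
  rw [lineCast_rfl, Θ.map_id]
  exact congrArg Iso.hom (R.φ_s b)

variable [MonoidalCategory N] [Θ.Monoidal]

/-- The multiplication `Θ (line (s a)) ⊗ Θ (line (s b)) ⟶ Θ (line (s (a * b)))`. -/
def mu {a b c : B} (e : a * b = c) :
    Θ.obj (line (R.s a)) ⊗ Θ.obj (line (R.s b)) ⟶ Θ.obj (line (R.s c)) :=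
  mulHom Θ rfl ≫ (R.φ (g := R.s a * R.s b) (by rw [map_mul, R.π_s, R.π_s, e])).hom

instance {a b c : B} (e : a * b = c) : IsIso (R.mu e) := by
  unfold mu; infer_instance

omit [Preadditive N] [Linear k N] in
lemma mulHom_lineCast {g h l l' : A} (e : g * h = l) (e' : l = l') :
    mulHom Θ e ≫ Θ.map (lineCast e') = mulHom Θ (e.trans e') := by
  subst e'; simp

/-- Where the section happens to be multiplicative, the normalization `φ_s` removes every choice.
With `s 1 = 1` this makes `mu` strictly unital. -/
lemma mu_eq_mulHom {a b c : B} (e : a * b = c) (e' : R.s a * R.s b = R.s c) :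
    R.mu e = mulHom Θ e' := by
  rw [mu, φ_hom_eq _ _ e', mulHom_lineCast]

lemma mu_one_left (b : B) : R.mu (one_mul b) = mulHom Θ (by rw [R.s_one, one_mul]) :=
  R.mu_eq_mulHom _ _

lemma mu_one_right (b : B) : R.mu (mul_one b) = mulHom Θ (by rw [R.s_one, mul_one]) :=
  R.mu_eq_mulHom _ _

include R in
lemma exists_scalar (a b c : B) : ∃ x : kˣ,
    (α_ _ _ _).hom ≫ (_ ◁ R.mu (rfl : b * c = _)) ≫ R.mu (mul_assoc a b c).symm =
      (x : k) • ((R.mu (rfl : a * b = _) ▷ _) ≫ R.mu (rfl : a * b * c = _)) :=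
  R.exists_unit (asIso ((R.mu (rfl : a * b = _) ▷ _) ≫ R.mu (rfl : a * b * c = _))) _ _

/-- The associativity defect of the multiplication `mu`. -/
def scalar (a b c : B) : kˣ := (R.exists_scalar a b c).choose

lemma scalar_spec {a b c ab bc abc : B} (e₁ : a * b = ab) (e₂ : b * c = bc) (e₃ : ab * c = abc)
    (e₄ : a * bc = abc) :
    (α_ _ _ _).hom ≫ (_ ◁ R.mu e₂) ≫ R.mu e₄ =
      (R.scalar a b c : k) • ((R.mu e₁ ▷ _) ≫ R.mu e₃) := by
  subst e₁ e₂ e₃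
  exact (R.exists_scalar a b c).choose_spec

variable [MonoidalPreadditive N] [MonoidalLinear k N]

/-- Rebracketing the fourfold product along the two sides of the pentagon multiplies the same
isomorphism by the two sides of the cocycle equation. -/
lemma scalar_cocycle (a b c d : B) :
    R.scalar a b c * R.scalar a (b * c) d * R.scalar b c d =
      R.scalar (a * b) c d * R.scalar a b (c * d) := by
  have hab : a * b = a * b := rfl
  have hbc : b * c = b * c := rfl
  have hcd : c * d = c * d := rfl
  have habc : a * b * c = a * b * c := rfl
  have habc' : a * (b * c) = a * b * c := (mul_assoc _ _ _).symm
  have hbcd : b * c * d = b * c * d := rfl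
  have hbcd' : b * (c * d) = b * c * d := (mul_assoc _ _ _).symm
  have h1 : a * b * c * d = a * b * c * d := rfl
  have h2 : a * b * (c * d) = a * b * c * d := (mul_assoc _ _ _).symm
  have h3 : a * (b * c * d) = a * b * c * d := by simp only [mul_assoc]
  have p1 := R.scalar_spec hab hbc habc habc'
  have p2 := R.scalar_spec habc' hbcd h1 h3
  have p3 := R.scalar_spec hbc hcd hbcd hbcd'
  have q1 := R.scalar_spec habc hcd h1 h2
  have q2 := R.scalar_spec hab hbcd' h2 h3
  -- The side of the pentagon with two associators.
  have e1 : (α_ ((R.T a) ⊗ (R.T b)) (R.T c) (R.T d)).hom ≫ (α_ (R.T a) (R.T b) ((R.T c) ⊗ (R.T d))).hom ≫ ((R.T a) ◁ (R.T b) ◁ R.mu hcd) ≫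
      ((R.T a) ◁ R.mu hbcd') ≫ R.mu h3 =
      ((R.scalar a b (c * d) : k) * (R.scalar (a * b) c d : k)) •
        (((R.mu hab ▷ (R.T c)) ▷ (R.T d)) ≫ (R.mu habc ▷ (R.T d)) ≫ R.mu h1) := by
    rw [← MonoidalCategory.associator_naturality_right_assoc, q2]
    simp only [Linear.comp_smul]
    rw [whisker_exchange_assoc, ← associator_naturality_left_assoc, q1]
    simp only [Linear.comp_smul, smul_smul]
  -- The same morphism along the side with three associators.
  have e2 : (α_ ((R.T a) ⊗ (R.T b)) (R.T c) (R.T d)).hom ≫ (α_ (R.T a) (R.T b) ((R.T c) ⊗ (R.T d))).hom ≫ ((R.T a) ◁ (R.T b) ◁ R.mu hcd) ≫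
      ((R.T a) ◁ R.mu hbcd') ≫ R.mu h3 =
      ((R.scalar b c d : k) * (R.scalar a (b * c) d : k) * (R.scalar a b c : k)) •
        (((R.mu hab ▷ (R.T c)) ▷ (R.T d)) ≫ (R.mu habc ▷ (R.T d)) ≫ R.mu h1) := by
    rw [← pentagon_assoc, ← MonoidalCategory.whiskerLeft_comp_assoc,
      ← MonoidalCategory.whiskerLeft_comp_assoc, Category.assoc, p3]
    simp only [MonoidalLinear.whiskerLeft_smul, Linear.smul_comp, Linear.comp_smul,
      MonoidalCategory.whiskerLeft_comp, Category.assoc]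
    rw [← associator_naturality_middle_assoc, p2]
    simp only [Linear.comp_smul, smul_smul]
    rw [← comp_whiskerRight_assoc, ← comp_whiskerRight_assoc, Category.assoc, p1]
    simp only [MonoidalLinear.smul_whiskerRight, Linear.smul_comp, smul_smul, comp_whiskerRight,
      Category.assoc]
  have hne : 𝟙 ((((R.T a) ⊗ (R.T b)) ⊗ (R.T c)) ⊗ (R.T d)) ≠ 0 :=
    id_ne_zero_of_iso (asIso (((R.mu hab ▷ (R.T c)) ▷ (R.T d)) ≫ (R.mu habc ▷ (R.T d)) ≫ R.mu h1)).symm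
      (R.id_ne_zero _)
  have := smul_cancel_of_isIso hne (e2.symm.trans e1)
  ext
  push_cast
  rw [mul_comm, mul_comm ((R.scalar (a * b) c d : kˣ) : k), ← this]
  ring

/-- The cocycle attached to a reduction. -/
def cocycle : ThreeCocycle B kˣ := ⟨R.scalar, R.scalar_cocycle⟩

end Reduction

end

/-! ### Push-forward of gradings and morphisms from linear maps graded over the quotient -/

section

open Functor.LaxMonoidal Functor.OplaxMonoidal

namespace GrVec

variable {k : Type u} [Field k] {A : Type w} [Group A] [Fintype A] {ω : ThreeCocycle A kˣ}
  {B : Type v} [Group B] [Fintype B] {ω' : ThreeCocycle B kˣ}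

lemma homog_zero (V : GrVec k A ω) (g : A) : V.Homog g 0 := map_zero _

open Classical in
/-- The grading obtained from a map of the index sets. -/
abbrev pushObj (f : A → B) (V : GrVec k A ω) : GrVec k B ω' where
  carrier := V.carrier
  proj b := ∑ g, if f g = b then V.proj g else 0
  isGrading := by
    rw [CompleteOrthogonalIdempotents.iff_ortho_complete]
    constructor
    · intro x y hxy
      simp only [Finset.sum_mul_sum]
      refine Finset.sum_eq_zero fun g _ => Finset.sum_eq_zero fun h _ => ?_
      split_ifs with hg hh
      · exact V.isGrading.ortho (by rintro rfl; exact hxy (hg.symm.trans hh))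
      all_goals simp
    · rw [Finset.sum_comm, ← V.isGrading.complete]
      exact Finset.sum_congr rfl fun g _ => by simp

lemma Homog.push {V : GrVec k A ω} {g : A} {v : V.carrier} (hv : V.Homog g v) (f : A → B) :
    (pushObj f V : GrVec k B ω').Homog (f g) v := by
  classical
  simp only [Homog, LinearMap.sum_apply]
  rw [Finset.sum_eq_single g]
  · rw [if_pos rfl, hv]
  · intro h _ hh
    split_ifs
    · exact hv.proj_of_ne hh
    · rfl
  · simp

lemma degreeZero_push {f : A → B} {V : GrVec k A ω} {W : GrVec k B ω'}
    {l : V.carrier →ₗ[k] W.carrier} (h : ∀ g v, V.Homog g v → W.Homog (f g) (l v)) (b : B)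
    (v : V.carrier) : l ((pushObj f V : GrVec k B ω').proj b v) = W.proj b (l v) := by
  classical
  suffices l ∘ₗ (pushObj f V : GrVec k B ω').proj b = W.proj b ∘ₗ l from
    LinearMap.congr_fun this v
  refine lin_ext (V := V) fun g v hv => ?_
  change l ((pushObj f V : GrVec k B ω').proj b v) = W.proj b (l v)
  by_cases hb : f g = b
  · subst hb; rw [hv.push f, h _ _ hv]
  · rw [(hv.push f).proj_of_ne (Ne.symm hb), (h _ _ hv).proj_of_ne (Ne.symm hb), map_zero]

/-- Push-forward of gradings along a map of the index sets. -/
abbrev push (ω' : ThreeCocycle B kˣ) (f : A → B) : GrVec k A ω ⥤ GrVec k B ω' where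
  obj := pushObj f
  map {V W} l := ofLin (V := pushObj f V) (W := pushObj f W) (lin (V := V) (W := W) l) <|
    degreeZero_push (V := V) (W := pushObj f W) fun _ _ hv => (hv.map l).push f
  map_id _ := rfl
  map_comp _ _ := rfl

instance (f : A → B) : (push (k := k) (ω := ω) ω' f).Additive := ⟨rfl⟩
instance (f : A → B) : (push (k := k) (ω := ω) ω' f).Linear k := ⟨fun _ _ => rfl⟩

/-- The push-forward of a line is a line. -/
def pushLine (f : A → B) (g : A) :
    (line (f g) : GrVec k B ω') ≅ (push ω' f).obj (line g : GrVec k A ω) where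
  hom := ofHomog (V := pushObj f (line g)) ((homog_line g (1 : k)).push f)
  inv := ofLin (V := pushObj f (line g)) (W := line (f g)) (LinearMap.id (R := k) (M := k)) <|
    degreeZero_push (V := line g) (W := line (f g)) fun h r hr => by
      by_cases hg : h = g
      · subst hg; exact homog_line _ _
      · rw [Homog.eq_zero hr (homog_line g _) hg]; exact homog_zero _ _
  hom_inv_id := lineHom_ext (by
    change (1 : k) • (1 : k) = 1
    simp)
  inv_hom_id := hom_ext (LinearMap.ext_ring (by
    change (1 : k) • (1 : k) = 1
    simp))

lemma pushLine_hom_map (f : A → B) {V : GrVec k A ω} {g : A} {v : V.carrier} (hv : V.Homog g v) :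
    (pushLine (ω' := ω') f g).hom ≫ (push ω' f).map (ofHomog hv) =
      ofHomog (V := pushObj f V) (hv.push f) :=
  lineHom_ext (by
    change ((1 : k) • (1 : k)) • v = (1 : k) • v
    rw [one_smul])

/-- Pushing forward along a section and back. -/
def pushPushIso {π : A → B} {s : B → A} (h : ∀ b, π (s b) = b) (V : GrVec k B ω') :
    (push ω' π).obj ((push ω s).obj V) ≅ V where
  hom := ofLin (V := pushObj π (pushObj s V)) (W := V) LinearMap.id fun b v => by
    classical
    change (pushObj π (pushObj (ω' := ω) s V) : GrVec k B ω').proj b v = _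
    suffices (pushObj π (pushObj (ω' := ω) s V) : GrVec k B ω').proj b = V.proj b from
      LinearMap.congr_fun this v
    refine lin_ext (V := V) fun c w hw => ?_
    have h2 := (hw.push (ω' := ω) s).push (ω' := ω') π
    rw [h] at h2
    by_cases hb : b = c
    · subst hb; rw [h2, hw]
    · rw [hw.proj_of_ne hb, h2.proj_of_ne hb]
  inv := ofLin (V := V) (W := pushObj π (pushObj s V)) LinearMap.id <|
    degreeZero_of_homog (W := pushObj π (pushObj s V)) fun b v hv => by
      have h2 := (hv.push (ω' := ω) s).push (ω' := ω') π
      rwa [h] at h2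
  hom_inv_id := rfl
  inv_hom_id := rfl

lemma isSurjective_push {π : A → B} {s : B → A} (h : ∀ b, π (s b) = b) :
    IsSurjective (push (k := k) (ω := ω) ω' π) := fun V =>
  ⟨(push ω s).obj V, ⟨⟨(pushPushIso h V).inv, (pushPushIso h V).hom, (pushPushIso h V).inv_hom_id⟩⟩⟩

/-- The morphism from a line given by a homogeneous component, as a linear map. -/
def ofHomogLin (V : GrVec k A ω) (g : A) : V.carrier →ₗ[k] (line g ⟶ V) where
  toFun v := ofHomog (V.homog_proj g v)
  map_add' v w := lineHom_ext (by
    change (1 : k) • V.proj g (v + w) = (1 : k) • V.proj g v + (1 : k) • V.proj g w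
    rw [map_add, smul_add])
  map_smul' c v := lineHom_ext (by
    change (1 : k) • V.proj g (c • v) = c • (1 : k) • V.proj g v
    rw [map_smul, one_smul, one_smul])

lemma ofHomog_congr {V : GrVec k A ω} {g : A} {v v' : V.carrier} (hv : V.Homog g v)
    (hv' : V.Homog g v') (h : v = v') : ofHomog hv = ofHomog hv' := by
  subst h; rfl

lemma ofHomog_smul {V : GrVec k A ω} {g : A} {v : V.carrier} (hv : V.Homog g v) (c : k) :
    ofHomog (hv.smul c) = c • ofHomog hv :=
  lineHom_ext (by
    change (1 : k) • c • v = c • (1 : k) • v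
    rw [one_smul, one_smul])

lemma ofHomogLin_of_homog {V : GrVec k A ω} {g : A} {v : V.carrier} (hv : V.Homog g v) :
    ofHomogLin V g v = ofHomog hv := ofHomog_congr (V.homog_proj g v) hv hv

lemma ofHomog_coord_eq_zero {V : GrVec k A ω} {g h : A} {v : V.carrier} (hv : V.Homog g v)
    (ξ : V.carrier →ₗ[k] k) (h0 : ξ v = 0) : ofHomog hv ≫ coord V h ξ = 0 := by
  by_cases hh : h = g
  · subst hh; rw [ofHomog_coord_same, h0, zero_smul]
  · exact ofHomog_coord_of_ne hv ξ hh

lemma sum_repr_proj (V : GrVec k A ω) (g : A) (v : V.carrier) :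
    ∑ i, V.basis.coord i v • V.proj g (V.basis i) = V.proj g v := by
  have h2 := congrArg (V.proj g) (V.basis.sum_repr v)
  rw [map_sum] at h2
  simpa only [map_smul, Module.Basis.coord_apply] using h2

end GrVec

namespace Reduction

open GrVec

variable {k : Type u} [Field k] {A : Type w} [Group A] [Fintype A]
    {N : Type u₂} [Category.{v₂} N] [Preadditive N] [Linear k N] {Θ : Vec k A ⥤ N}
    {B : Type v} [Group B] [Fintype B] (R : Reduction Θ B) {ω : ThreeCocycle B kˣ}

/-- The morphism `Θ X ⟶ Θ (push s Y)` attached to a linear map `X → Y` which is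
compatible with the gradings via `π : A → B`. -/
def ext {X : Vec k A} {Y : GrVec k B ω} [Θ.Additive] [Θ.Linear k]
    (f : X.carrier →ₗ[k] Y.carrier) : Θ.obj X ⟶ Θ.obj ((push 1 R.s).obj Y) :=
  desc Θ fun g => Linear.leftComp k _ (R.φ (rfl : R.π g = _)).hom ∘ₗ Θ.mapLinearMap k ∘ₗ
    ofHomogLin ((push 1 R.s).obj Y) (R.s (R.π g)) ∘ₗ f

/-- Compatibility of a linear map with the gradings via `π : A → B`. -/
abbrev Graded {X : Vec k A} {Y : GrVec k B ω} (f : X.carrier →ₗ[k] Y.carrier) : Prop :=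
  ∀ g x, X.Homog g x → Y.Homog (R.π g) (f x)

variable [Θ.Additive] [Θ.Linear k]

variable {R} in
-- A map graded only over `B` moves degree `g` to degree `s (π g)`, so it is not a morphism of
-- `Vec_A`; after applying `Θ` the isomorphism `φ` bridges the two degrees. This formula determines
-- `ext f`.
lemma Graded.map_ofHomog_ext {X : Vec k A} {Y : GrVec k B ω} {f : X.carrier →ₗ[k] Y.carrier}
    (hf : R.Graded f) {g : A} {b : B} (e : R.π g = b) {x : X.carrier} (hx : X.Homog g x) :
    Θ.map (ofHomog hx) ≫ R.ext f =
      (R.φ e).hom ≫ Θ.map (ofHomog (V := pushObj R.s Y)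
        (Homog.push (e ▸ hf g x hx : Y.Homog b (f x)) R.s)) := by
  subst e
  rw [ext, map_ofHomog_desc]
  change (R.φ rfl).hom ≫ Θ.map (ofHomogLin ((push 1 R.s).obj Y) (R.s (R.π g)) (f x)) = _
  have h : ((push 1 R.s).obj Y).Homog (R.s (R.π g)) (f x) :=
    Homog.push (hf g x hx : Y.Homog (R.π g) (f x)) R.s
  rw [ofHomogLin_of_homog h]

lemma ext_comp {X : Vec k A} {Y Y' : GrVec k B ω} {f : X.carrier →ₗ[k] Y.carrier}
    (hf : R.Graded f) (h : Y ⟶ Y') :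
    R.ext f ≫ Θ.map ((push 1 R.s).map h) = R.ext (lin h ∘ₗ f) := by
  have hf' : R.Graded (lin h ∘ₗ f) := fun g x hx => (hf g x hx).map h
  refine functor_hom_ext Θ fun g x hx => ?_
  rw [hf'.map_ofHomog_ext rfl hx, reassoc_of% (hf.map_ofHomog_ext rfl hx), ← Θ.map_comp,
    ofHomog_comp]
  rfl

lemma comp_ext {X X' : Vec k A} {Y : GrVec k B ω} {f : X.carrier →ₗ[k] Y.carrier}
    (hf : R.Graded f) (h : X' ⟶ X) :
    Θ.map h ≫ R.ext f = R.ext (f ∘ₗ lin h) := by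
  have hf' : R.Graded (f ∘ₗ lin h) := fun g x hx => hf g _ (hx.map h)
  refine functor_hom_ext Θ fun g x hx => ?_
  rw [hf'.map_ofHomog_ext rfl hx, ← Category.assoc, ← Θ.map_comp, ofHomog_comp,
    hf.map_ofHomog_ext rfl]

/-- The inverse of `ext f`. -/
def extInv {X : Vec k A} {Y : GrVec k B ω} (f : X.carrier ≃ₗ[k] Y.carrier) :
    Θ.obj ((push 1 R.s).obj Y) ⟶ Θ.obj X :=
  ∑ g, ∑ i, Θ.map (coord ((push 1 R.s).obj Y) (R.s (R.π g))
    (X.basis.coord i ∘ₗ X.proj g ∘ₗ f.symm.toLinearMap)) ≫ (R.φ (rfl : R.π g = _)).inv ≫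
      Θ.map (ofHomog (X.homog_proj g (X.basis i)))

lemma map_ofHomog_extInv {X : Vec k A} {Y : GrVec k B ω} (f : X.carrier ≃ₗ[k] Y.carrier) {g : A}
    {x : X.carrier} (hx : X.Homog g x) (hfx : Y.Homog (R.π g) (f x)) :
    Θ.map (ofHomog (V := pushObj R.s Y) (hfx.push R.s)) ≫ R.extInv f =
      (R.φ rfl).inv ≫ Θ.map (ofHomog hx) := by
  have hfx' : ((push 1 R.s).obj Y).Homog (R.s (R.π g)) (f x) := hfx.push R.s
  change Θ.map (ofHomog hfx') ≫ _ = _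
  rw [extInv, Preadditive.comp_sum, Finset.sum_eq_single g]
  · rw [Preadditive.comp_sum]
    have h1 : ∀ i, Θ.map (ofHomog hfx') ≫ Θ.map (coord ((push 1 R.s).obj Y) (R.s (R.π g))
        (X.basis.coord i ∘ₗ X.proj g ∘ₗ f.symm.toLinearMap)) ≫ (R.φ (rfl : R.π g = _)).inv ≫
          Θ.map (ofHomog (X.homog_proj g (X.basis i))) =
        (R.φ rfl).inv ≫ Θ.map (X.basis.coord i x • ofHomog (X.homog_proj g (X.basis i))) := by
      intro i
      rw [← Category.assoc, ← Θ.map_comp, ofHomog_coord_same, Θ.map_smul, Θ.map_id,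
        Linear.smul_comp, Category.id_comp, Θ.map_smul, Linear.comp_smul]
      simp only [LinearMap.comp_apply, LinearEquiv.coe_coe]
      erw [LinearEquiv.symm_apply_apply]
      rw [hx]
    rw [Finset.sum_congr rfl fun i _ => h1 i, ← Preadditive.comp_sum, ← Θ.map_sum]
    congr 2
    rw [← ofHomogLin_of_homog hx, ← X.basis.sum_repr x, map_sum]
    refine Finset.sum_congr rfl fun i _ => ?_
    rw [map_smul, X.basis.sum_repr x]
    rfl
  · intro h _ hh
    rw [Preadditive.comp_sum]
    refine Finset.sum_eq_zero fun i _ => ?_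
    rw [← Category.assoc, ← Θ.map_comp, ofHomog_coord_eq_zero hfx', Θ.map_zero, zero_comp]
    simp only [LinearMap.comp_apply, LinearEquiv.coe_coe]
    erw [LinearEquiv.symm_apply_apply]
    rw [hx.proj_of_ne hh, map_zero]
  · simp

/-- The isomorphisms `φ` cancel in both composites. The composite starting with `extInv` is then `Θ`
of an honest endomorphism of `push s Y`, which linear algebra identifies with the identity. -/
lemma isIso_ext {X : Vec k A} {Y : GrVec k B ω} {f : X.carrier ≃ₗ[k] Y.carrier}
    (hf : R.Graded f.toLinearMap) : IsIso (R.ext f.toLinearMap) := by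
  refine ⟨R.extInv f, ?_, ?_⟩
  · refine functor_hom_ext Θ fun g x hx => ?_
    rw [reassoc_of% (hf.map_ofHomog_ext rfl hx)]
    erw [R.map_ofHomog_extInv f hx (hf g x hx)]
    rw [Iso.hom_inv_id_assoc, Category.comp_id]
  · have h1 : R.extInv f ≫ R.ext f.toLinearMap = Θ.map (∑ g, ∑ i,
        coord ((push 1 R.s).obj Y) (R.s (R.π g))
          (X.basis.coord i ∘ₗ X.proj g ∘ₗ f.symm.toLinearMap) ≫
        ofHomog (V := pushObj R.s Y) ((hf g _ (X.homog_proj g (X.basis i))).push R.s)) := by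
      simp only [extInv, Preadditive.sum_comp, Θ.map_sum, Category.assoc, Θ.map_comp]
      refine Finset.sum_congr rfl fun g _ => Finset.sum_congr rfl fun i _ => ?_
      rw [hf.map_ofHomog_ext rfl, Iso.inv_hom_id_assoc]
    rw [h1, ← Θ.map_id]
    congr 1
    refine hom_ext (LinearMap.ext fun y => ?_)
    obtain ⟨x, rfl⟩ := f.surjective y
    let ev : (((push 1 R.s).obj Y : Vec k A) ⟶ (push 1 R.s).obj Y) →+ Y.carrier :=
      ⟨⟨fun l => lin l (f x), rfl⟩, fun _ _ => rfl⟩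
    change ev _ = f x
    rw [map_sum]
    simp only [map_sum]
    change ∑ g, ∑ i, X.basis.coord i (X.proj g (f.symm
      ((pushObj R.s Y : Vec k A).proj (R.s (R.π g)) (f x)))) • f (X.proj g (X.basis i)) = f x
    -- Projecting `f x` to degree `s (π g)` keeps all components of `x` in the fibre of `π` through
    -- `g`; the outer projection then isolates degree `g`.
    have h2 : ∀ g, X.proj g (f.symm ((pushObj R.s Y : Vec k A).proj (R.s (R.π g)) (f x))) =
        X.proj g x := by
      intro g
      suffices X.proj g ∘ₗ f.symm.toLinearMap ∘ₗ
          (pushObj R.s Y : Vec k A).proj (R.s (R.π g)) ∘ₗ f.toLinearMap = X.proj g from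
        LinearMap.congr_fun this x
      refine lin_ext fun h z hz => ?_
      have hfz := (hf h z hz).push (ω' := (1 : ThreeCocycle A kˣ)) R.s
      change X.proj g (f.symm ((pushObj R.s Y : Vec k A).proj (R.s (R.π g)) (f z))) = _
      by_cases hs : R.s (R.π g) = R.s (R.π h)
      · rw [hs]
        erw [hfz]
        exact congrArg _ (f.symm_apply_apply z)
      · erw [hfz.proj_of_ne hs]
        rw [map_zero, map_zero, hz.proj_of_ne]
        rintro rfl; exact hs rfl
    simp only [h2, ← map_smul, ← map_sum]
    rw [← X.sum_proj x]
    congr 1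
    refine Finset.sum_congr rfl fun g _ => ?_
    rw [X.sum_proj x]
    have := X.sum_repr_proj g (X.proj g x)
    rw [X.homog_proj g x] at this
    rw [map_sum]
    simpa only [map_smul] using this

end Reduction

end

/-! ### Tensor structures on push-forward functors -/

section

open Functor.LaxMonoidal Functor.OplaxMonoidal

namespace GrVec

variable {k : Type u} [Field k] {A : Type w} [Group A] [Fintype A] {ω : ThreeCocycle A kˣ}
  {B : Type v} [Group B] [Fintype B] {ω' : ThreeCocycle B kˣ}

lemma tensorProj_push (π : A →* B) (X Y : GrVec k A ω) (b : B) :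
    tensorProj (pushObj π X : GrVec k B ω') (pushObj π Y) b =
      (pushObj π (tensor X Y) : GrVec k B ω').proj b := by
  refine lin_ext₂ (V := X) (W := Y) fun g x h y hx hy => ?_
  classical
  rw [tensorProj_tmul (hx.push π) (hy.push π), ← map_mul]
  have h2 := (hx.tmul hy).push (ω' := ω') π
  split_ifs with hb
  · rw [hb, h2]
  · rw [h2.proj_of_ne hb]

lemma tensorProj_push_section {π : A →* B} {s : B → A} (h : ∀ b, π (s b) = b)
    (V W : GrVec k B ω') (b : B) :
    (pushObj π (tensor (pushObj s V : GrVec k A ω) (pushObj s W)) : GrVec k B ω').proj b =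
      tensorProj V W b := by
  refine lin_ext₂ (V := V) (W := W) fun c v d w hv hw => ?_
  classical
  rw [tensorProj_tmul hv hw]
  have h2 := ((hv.push (ω' := ω) s).tmul (hw.push (ω' := ω) s)).push (ω' := ω') π
  rw [map_mul, h, h] at h2
  split_ifs with hb
  · rw [hb, h2]
  · rw [h2.proj_of_ne hb]

/-- The operator on `V ⊗ W` acting by `c g h` on the component of degree `(g, h)`. -/
def twist (c : A → A → kˣ) (V W : GrVec k A ω) :
    V.carrier ⊗[k] W.carrier →ₗ[k] V.carrier ⊗[k] W.carrier :=
  ∑ g, ∑ h, (c g h : k) • TensorProduct.map (V.proj g) (W.proj h)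

lemma twist_tmul (c : A → A → kˣ) {V W : GrVec k A ω} {g h : A} {v : V.carrier} {w : W.carrier}
    (hv : V.Homog g v) (hw : W.Homog h w) : twist c V W (v ⊗ₜ w) = (c g h : k) • (v ⊗ₜ w) := by
  simp only [twist, LinearMap.sum_apply, LinearMap.smul_apply, TensorProduct.map_tmul]
  rw [Finset.sum_eq_single g, Finset.sum_eq_single h, hv, hw]
  · intro e _ he; simp [hw.proj_of_ne he]
  · simp
  · intro e _ he; simp [hv.proj_of_ne he]
  · simp

/-- The twisted tensor structure of the push-forward functor. -/
def pushμ (c : A → A → kˣ) (π : A →* B) (X Y : GrVec k A ω) :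
    (push ω' π).obj X ⊗ (push ω' π).obj Y ≅ (push ω' π).obj (X ⊗ Y) where
  hom := ofLin (V := tensor (pushObj π X) (pushObj π Y)) (W := pushObj π (tensor X Y))
    (twist c X Y) fun b z => by
      change twist c X Y (tensorProj (pushObj π X : GrVec k B ω') (pushObj π Y) b z) = _
      rw [tensorProj_push]
      refine degreeZero_push (V := tensor X Y) (W := pushObj π (tensor X Y)) ?_ b z
      intro g v hv
      refine Homog.push (V := tensor X Y) ?_ π
      have := degreeZero_tensor (U := tensor X Y) (f := twist c X Y)
        (fun g v g' v' hv hv' => by rw [twist_tmul c hv hv']; exact (hv.tmul hv').smul _) g v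
      change tensorProj X Y g _ = _
      rw [← this]
      exact congrArg _ hv
  inv := ofLin (V := pushObj π (tensor X Y)) (W := tensor (pushObj π X) (pushObj π Y))
    (twist (fun g h => (c g h)⁻¹) X Y) fun b z => by
      change _ = tensorProj (pushObj π X : GrVec k B ω') (pushObj π Y) b _
      rw [tensorProj_push]
      refine degreeZero_push (V := tensor X Y) (W := pushObj π (tensor X Y)) ?_ b z
      intro g v hv
      refine Homog.push (V := tensor X Y) ?_ π
      have := degreeZero_tensor (U := tensor X Y) (f := twist (fun g h => (c g h)⁻¹) X Y)
        (fun g v g' v' hv hv' => by rw [twist_tmul _ hv hv']; exact (hv.tmul hv').smul _) g v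
      change tensorProj X Y g _ = _
      rw [← this]
      exact congrArg _ hv
  hom_inv_id := hom_ext (lin_ext₂ (V := X) (W := Y) fun g v h w hv hw => by
    change twist (fun g h => (c g h)⁻¹) X Y (twist c X Y (v ⊗ₜ w)) = v ⊗ₜ w
    rw [twist_tmul _ hv hw, map_smul, twist_tmul _ hv hw, smul_smul, Units.mul_inv, one_smul])
  inv_hom_id := hom_ext (lin_ext₂ (V := X) (W := Y) fun g v h w hv hw => by
    change twist c X Y (twist (fun g h => (c g h)⁻¹) X Y (v ⊗ₜ w)) = v ⊗ₜ w
    rw [twist_tmul _ hv hw, map_smul, twist_tmul _ hv hw, smul_smul, Units.inv_mul, one_smul])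

lemma pushμ_apply (c : A → A → kˣ) (π : A →* B) {X Y : GrVec k A ω} {g h : A} {x : X.carrier}
    {y : Y.carrier} (hx : X.Homog g x) (hy : Y.Homog h y) :
    lin (pushμ (ω' := ω') c π X Y).hom (x ⊗ₜ[k] y) = (c g h : k) • (x ⊗ₜ[k] y) :=
  twist_tmul c hx hy

/-- The unit constraint of the push-forward functor. -/
def pushε (π : A →* B) : 𝟙_ (GrVec k B ω') ≅ (push ω' π).obj (𝟙_ (GrVec k A ω)) where
  hom := ofHomog (V := pushObj π unit) (g := 1) (v := (1 : k)) <| by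
    have := (homog_unit (A := A) (ω := ω) (1 : k)).push (ω' := ω') π
    rwa [map_one] at this
  inv := ofLin (V := pushObj π unit) (W := unit) (LinearMap.id (R := k) (M := k)) <|
    degreeZero_push (V := unit) (W := unit) fun h r hr => by
      by_cases hg : h = 1
      · subst hg; rw [map_one]; exact homog_unit _
      · rw [Homog.eq_zero hr (homog_unit _) hg]; exact homog_zero _ _
  hom_inv_id := lineHom_ext (g := 1) (by
    change (1 : k) • (1 : k) = 1
    simp)
  inv_hom_id := hom_ext (LinearMap.ext_ring (by
    change (1 : k) • (1 : k) = 1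
    simp))

/-- A monoidal structure on the push-forward functor. -/
@[reducible]
def pushMonoidal (π : A →* B) (c : A → A → kˣ)
    (h : ∀ g h l, c g h * c (g * h) l * ω.toFun g h l =
      ω'.toFun (π g) (π h) (π l) * c h l * c g (h * l))
    (hl : ∀ g, (ω'.toFun 1 1 (π g))⁻¹ = c 1 g * (ω.toFun 1 1 g)⁻¹)
    (hr : ∀ g, ω'.toFun (π g) 1 1 = c g 1 * ω.toFun g 1 1) :
    (push (k := k) (ω := ω) ω' π).Monoidal :=
  Functor.CoreMonoidal.toMonoidal
    { εIso := pushε π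
      μIso := pushμ c π
      μIso_hom_natural_left {X X'} f Y := hom_ext (lin_ext₂ (V := X) (W := Y)
        fun g v h w hv hw => by
          change lin (pushμ c π X' Y).hom (lin f v ⊗ₜ w) =
            TensorProduct.map (lin f) LinearMap.id (lin (pushμ c π X Y).hom (v ⊗ₜ w))
          rw [pushμ_apply c π hv hw, pushμ_apply c π (hv.map f) hw, map_smul]
          rfl)
      μIso_hom_natural_right {Y Y'} X f := hom_ext (lin_ext₂ (V := X) (W := Y)
        fun g v h w hv hw => by
          change lin (pushμ c π X Y').hom (v ⊗ₜ lin f w) =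
            TensorProduct.map LinearMap.id (lin f) (lin (pushμ c π X Y).hom (v ⊗ₜ w))
          rw [pushμ_apply c π hv hw, pushμ_apply c π hv (hw.map f), map_smul]
          rfl)
      associativity X Y Z := hom_ext (lin_ext₃ (V := X) (W := Y) (X := Z)
        fun g x g' y l z hx hy hz => by
          change lin (assocIso X Y Z).hom (lin (pushμ c π (tensor X Y) Z).hom
              (lin (pushμ (ω' := ω') c π X Y).hom (x ⊗ₜ y) ⊗ₜ z)) =
            lin (pushμ c π X (tensor Y Z)).hom
              (TensorProduct.map LinearMap.id (lin (pushμ c π Y Z).hom)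
                (lin (assocIso (pushObj π X : GrVec k B ω') (pushObj π Y) (pushObj π Z)).hom
                  ((x ⊗ₜ y) ⊗ₜ z)))
          rw [pushμ_apply c π hx hy, ← TensorProduct.smul_tmul', map_smul,
            pushμ_apply c π (hx.tmul hy) hz, map_smul, map_smul, assocIso_apply hx hy hz,
            assocIso_apply (hx.push π) (hy.push π) (hz.push π), map_smul, map_smul]
          change _ = _ • lin (pushμ c π X (tensor Y Z)).hom
            (x ⊗ₜ (lin (pushμ (ω' := ω') c π Y Z).hom (y ⊗ₜ z)))
          rw [pushμ_apply c π hy hz, TensorProduct.tmul_smul, map_smul,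
            pushμ_apply c π hx (hy.tmul hz), smul_smul, smul_smul, smul_smul, smul_smul]
          congr 1
          exact_mod_cast h g g' l)
      left_unitality X := hom_ext (TensorProduct.ext (LinearMap.ext_ring (lin_ext (V := X)
        fun g x hx => by
          change lin (leftUnitIso (pushObj π X : GrVec k B ω')).hom ((1 : k) ⊗ₜ x) =
            lin (leftUnitIso X).hom (lin (pushμ (ω' := ω') c π unit X).hom
              (((1 : k) • (1 : k)) ⊗ₜ x))
          rw [leftUnitIso_apply (hx.push π), one_smul, one_smul, pushμ_apply c π (homog_unit 1) hx,
            map_smul, leftUnitIso_apply hx, one_smul, smul_smul, hl]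
          rfl)))
      right_unitality X := hom_ext (TensorProduct.ext (lin_ext (V := X)
        fun g x hx => LinearMap.ext_ring (by
          change lin (rightUnitIso (pushObj π X : GrVec k B ω')).hom (x ⊗ₜ (1 : k)) =
            lin (rightUnitIso X).hom (lin (pushμ (ω' := ω') c π X unit).hom
              (x ⊗ₜ ((1 : k) • (1 : k))))
          rw [rightUnitIso_apply (hx.push π), one_smul, one_smul,
            pushμ_apply c π hx (homog_unit 1), map_smul, rightUnitIso_apply hx, one_smul,
            smul_smul, hr]
          rfl))) }

end GrVec

end

/-! ### Normalization, the multiplicativity defect, and the tensor constraint of `S` -/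

section

open Functor.LaxMonoidal Functor.OplaxMonoidal

namespace Reduction

open GrVec

variable {k : Type u} [Field k] {A : Type w} [Group A] [Fintype A]
    {N : Type u₂} [Category.{v₂} N] [Preadditive N] [Linear k N] {Θ : Vec k A ⥤ N}
    {B : Type v} [Group B] (R : Reduction Θ B)
    [MonoidalCategory N] [Θ.Monoidal]

include R in
lemma eq_one_of_smul {g h : A} {X : N} (e : X ≅ Θ.obj (line g)) (f : X ⟶ Θ.obj (line h))
    [IsIso f] {c : kˣ} (hc : f = (c : k) • f) : c = 1 := by
  have hX : 𝟙 X ≠ 0 := id_ne_zero_of_iso e.symm (R.id_ne_zero g)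
  have : (1 : k) • f = (c : k) • f := by rw [one_smul]; exact hc
  exact Units.ext (smul_cancel_of_isIso hX this).symm

/-- Since `s 1 = 1`, every multiplication involved is an unmodified `mulHom`, which is associative.
The unit constraints of `Vec_B^ω` only involve `ω` at `(1, 1, b)` and `(b, 1, 1)`, so these two
normalizations are all that is needed. -/
lemma scalar_one_one (b : B) : R.scalar 1 1 b = 1 := by
  have h := R.scalar_spec (one_mul 1) (one_mul b) (one_mul b) (one_mul b)
  have e1 : R.s 1 * R.s 1 = R.s 1 := by rw [R.s_one, one_mul]
  have e2 : R.s 1 * R.s b = R.s b := by rw [R.s_one, one_mul]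
  rw [R.mu_one_left, R.mu_one_left, ← mulHom_assoc Θ e1 e2 e2 e2] at h
  exact R.eq_one_of_smul (asIso ((mulHom Θ e1 ▷ _) ≫ mulHom Θ e2)) _ h

lemma scalar_one_one' (b : B) : R.scalar b 1 1 = 1 := by
  have h := R.scalar_spec (mul_one b) (mul_one 1) (mul_one b) (mul_one b)
  have e1 : R.s 1 * R.s 1 = R.s 1 := by rw [R.s_one, mul_one]
  have e2 : R.s b * R.s 1 = R.s b := by rw [R.s_one, mul_one]
  rw [R.mu_one_right, R.mu_one_right, ← mulHom_assoc Θ e2 e1 e2 e2] at h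
  exact R.eq_one_of_smul (asIso ((mulHom Θ e2 ▷ _) ≫ mulHom Θ e2)) _ h

instance (R : Reduction Θ B) {g : A} {b : B} (e : R.π g = b) : IsIso (R.φ e).hom := inferInstance

include R in
lemma exists_defect (g h : A) : ∃ x : kˣ,
    mulHom Θ (rfl : g * h = _) ≫ (R.φ (map_mul R.π g h)).hom =
      (x : k) • (((R.φ (rfl : R.π g = _)).hom ⊗ₘ (R.φ (rfl : R.π h = _)).hom) ≫ R.mu rfl) :=
  R.exists_unit (asIso (((R.φ (rfl : R.π g = _)).hom ⊗ₘ (R.φ (rfl : R.π h = _)).hom) ≫ R.mu rfl))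
    _ _

/-- The multiplicativity defect of the isomorphisms `φ`. -/
def defect (g h : A) : kˣ := (R.exists_defect g h).choose

lemma defect_spec {g h gh : A} {a b ab : B} (e : g * h = gh) (ea : R.π g = a) (eb : R.π h = b)
    (eab : R.π gh = ab) (e' : a * b = ab) :
    mulHom Θ e ≫ (R.φ eab).hom =
      (R.defect g h : k) • (((R.φ ea).hom ⊗ₘ (R.φ eb).hom) ≫ R.mu e') := by
  subst e ea eb e'
  exact (R.exists_defect g h).choose_spec

lemma defect_spec_assoc {g h gh : A} {a b ab : B} (e : g * h = gh) (ea : R.π g = a)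
    (eb : R.π h = b) (eab : R.π gh = ab) (e' : a * b = ab) {Z : N} (f : _ ⟶ Z) :
    mulHom Θ e ≫ (R.φ eab).hom ≫ f =
      (R.defect g h : k) • (((R.φ ea).hom ⊗ₘ (R.φ eb).hom) ≫ R.mu e' ≫ f) := by
  rw [← Category.assoc, R.defect_spec e ea eb eab e', Linear.smul_comp, Category.assoc]

/-- The unit `𝟙_ N ≅ Θ (line (s 1))`. -/
def unitS : 𝟙_ N ⟶ R.T 1 := unitHom Θ ≫ Θ.map (lineCast R.s_one.symm)

instance {g h : A} (e : g = h) : IsIso (lineCast (k := k) (ω := (1 : ThreeCocycle A kˣ)) e) := by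
  subst e; rw [lineCast_rfl]; infer_instance

instance : IsIso R.unitS := by
  unfold unitS; infer_instance

lemma unit_mulHom {h g : A} (e : 1 = h) (e' : h * g = g) :
    ((unitHom Θ ≫ Θ.map (lineCast e)) ▷ Θ.obj (line g)) ≫ mulHom Θ e' = (λ_ _).hom := by
  subst e
  rw [lineCast_rfl, Θ.map_id, Category.comp_id, mulHom_one_left]

lemma unit_mulHom' {h g : A} (e : 1 = h) (e' : g * h = g) :
    (Θ.obj (line g) ◁ (unitHom Θ ≫ Θ.map (lineCast e))) ≫ mulHom Θ e' = (ρ_ _).hom := by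
  subst e
  rw [lineCast_rfl, Θ.map_id, Category.comp_id, mulHom_one_right]

lemma unitS_mu (b : B) : (R.unitS ▷ R.T b) ≫ R.mu (one_mul b) = (λ_ _).hom := by
  rw [R.mu_one_left, unitS, unit_mulHom]

lemma unitS_mu' (b : B) : (R.T b ◁ R.unitS) ≫ R.mu (mul_one b) = (ρ_ _).hom := by
  rw [R.mu_one_right, unitS, unit_mulHom']

lemma unitHom_φ (e : R.π 1 = 1) : unitHom Θ ≫ (R.φ e).hom = R.unitS := by
  rw [φ_hom_eq R e R.s_one.symm, unitS]

/-- Insert the unit in the first factor: the normalized `φ` at `1` is compatible with units, so both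
sides become the same left unitor followed by `φ`. -/
lemma defect_one_left (g : A) : R.defect 1 g = 1 := by
  have h := R.defect_spec (one_mul g) (map_one R.π) (rfl : R.π g = _) rfl (one_mul _)
  have h2 := congrArg (fun x => (unitHom Θ ▷ Θ.obj (line g)) ≫ x) h
  simp only [Linear.comp_smul, MonoidalCategory.tensorHom_def, Category.assoc] at h2
  rw [← comp_whiskerRight_assoc, unitHom_φ, ← whisker_exchange_assoc, unitS_mu,
    ← Category.assoc, mulHom_one_left, leftUnitor_naturality] at h2
  exact R.eq_one_of_smul (λ_ _) _ h2

lemma defect_one_right (g : A) : R.defect g 1 = 1 := by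
  have h := R.defect_spec (mul_one g) (rfl : R.π g = _) (map_one R.π) rfl (mul_one _)
  have h2 := congrArg (fun x => (Θ.obj (line g) ◁ unitHom Θ) ≫ x) h
  simp only [Linear.comp_smul, tensorHom_def', Category.assoc] at h2
  rw [← MonoidalCategory.whiskerLeft_comp_assoc, unitHom_φ, whisker_exchange_assoc, unitS_mu',
    ← Category.assoc, mulHom_one_right, rightUnitor_naturality] at h2
  exact R.eq_one_of_smul (ρ_ _) _ h2

variable [MonoidalPreadditive N] [MonoidalLinear k N]

/-- Says that the pullback of `ω` along `π` is the coboundary of `defect`, which is exactly the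
coherence needed for a tensor structure on the push-forward. It follows by moving `φ` past a triple
product in both bracketings: on `A` these agree, on `B` they differ by `scalar`. -/
lemma defect_assoc (g h l : A) :
    R.defect g h * R.defect (g * h) l =
      R.scalar (R.π g) (R.π h) (R.π l) * R.defect h l * R.defect g (h * l) := by
  have egh : g * h = g * h := rfl
  have ehl : h * l = h * l := rfl
  have eghl : g * h * l = g * h * l := rfl
  have eghl' : g * (h * l) = g * h * l := (mul_assoc _ _ _).symm
  have e1 := mulHom_assoc Θ egh ehl eghl eghl'
  have c1 : R.π g * R.π h = R.π (g * h) := (map_mul _ _ _).symm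
  have c2 : R.π (g * h) * R.π l = R.π (g * h * l) := (map_mul _ _ _).symm
  have c3 : R.π h * R.π l = R.π (h * l) := (map_mul _ _ _).symm
  have c4 : R.π g * R.π (h * l) = R.π (g * h * l) := by simp only [map_mul, mul_assoc]
  have d1 := R.defect_spec eghl rfl rfl rfl c2
  have d2 := R.defect_spec egh rfl rfl rfl c1
  have d3 := R.defect_spec eghl' rfl rfl rfl c4
  have d4 := R.defect_spec ehl rfl rfl rfl c3
  have ea := R.scalar_spec c1 c3 c2 c4
  have f1 : (mulHom Θ egh ▷ Θ.obj (line l)) ≫ mulHom Θ eghl ≫ (R.φ rfl).hom =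
      ((R.defect (g * h) l : k) * (R.defect g h : k)) •
        ((((R.φ rfl).hom ⊗ₘ (R.φ rfl).hom) ⊗ₘ (R.φ rfl).hom) ≫ (R.mu c1 ▷ _) ≫ R.mu c2) := by
    rw [d1, Linear.comp_smul, MonoidalCategory.tensorHom_def, Category.assoc, ← comp_whiskerRight_assoc, d2]
    simp only [MonoidalLinear.smul_whiskerRight, Linear.smul_comp, smul_smul, comp_whiskerRight,
      Category.assoc, MonoidalCategory.tensorHom_def, whisker_exchange_assoc]
  have f2 : (mulHom Θ egh ▷ Θ.obj (line l)) ≫ mulHom Θ eghl ≫ (R.φ rfl).hom =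
      ((R.defect g (h * l) : k) * (R.defect h l : k) *
        (R.scalar (R.π g) (R.π h) (R.π l) : k)) •
        ((((R.φ rfl).hom ⊗ₘ (R.φ rfl).hom) ⊗ₘ (R.φ rfl).hom) ≫ (R.mu c1 ▷ _) ≫ R.mu c2) := by
    rw [← Category.assoc, e1, Category.assoc, Category.assoc, d3, Linear.comp_smul,
      Linear.comp_smul, tensorHom_def', Category.assoc, ← MonoidalCategory.whiskerLeft_comp_assoc,
      d4]
    simp only [MonoidalLinear.whiskerLeft_smul, Linear.smul_comp, Linear.comp_smul, smul_smul,
      MonoidalCategory.whiskerLeft_comp, Category.assoc]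
    rw [whisker_exchange_assoc, ← tensorHom_def'_assoc, ← associator_naturality_assoc, ea]
    simp only [Linear.comp_smul, smul_smul]
  have hne : 𝟙 ((Θ.obj (line g) ⊗ Θ.obj (line h)) ⊗ Θ.obj (line l)) ≠ 0 :=
    id_ne_zero_of_iso (asIso ((((R.φ rfl).hom ⊗ₘ (R.φ rfl).hom) ⊗ₘ (R.φ rfl).hom) ≫
      (R.mu c1 ▷ _) ≫ R.mu c2)).symm (R.id_ne_zero _)
  have := smul_cancel_of_isIso hne (f1.symm.trans f2)
  ext
  push_cast
  rw [mul_comm, this]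
  ring

variable [Fintype B]

/-- The push-forward functor `Vec_A ⥤ Vec_B^ω`. -/
abbrev F : Vec k A ⥤ GrVec k B R.cocycle := push R.cocycle R.π

@[reducible]
def monoidalF : R.F.Monoidal :=
  pushMonoidal R.π R.defect
    (fun g h l => (mul_one _).trans (R.defect_assoc g h l))
    (fun g => by
      change (R.scalar 1 1 _)⁻¹ = _ * (1 : kˣ)⁻¹
      rw [R.scalar_one_one, R.defect_one_left, one_mul])
    (fun g => by
      change R.scalar _ 1 1 = _ * (1 : kˣ)
      rw [R.scalar_one_one', R.defect_one_right, mul_one])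

/-- The functor `Vec_B^ω ⥤ N` factoring `Θ`. -/
abbrev S : GrVec k B R.cocycle ⥤ N := push 1 R.s ⋙ Θ

variable [Θ.Additive] [Θ.Linear k]

instance : R.S.Additive := inferInstance
instance : R.S.Linear k := inferInstance

/-- The morphism `T b ⟶ S V` given by a homogeneous element. -/
abbrev elt {V : GrVec k B R.cocycle} {b : B} {v : V.carrier} (hv : V.Homog b v) :
    R.T b ⟶ R.S.obj V :=
  Θ.map (ofHomog (V := pushObj R.s V) (hv.push R.s))

lemma pushLine_S {V : GrVec k B R.cocycle} {b : B} {v : V.carrier} (hv : V.Homog b v) :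
    Θ.map (pushLine R.s b).hom ≫ R.S.map (ofHomog hv) = R.elt hv := by
  rw [Functor.comp_map, ← Θ.map_comp, pushLine_hom_map]

lemma elt_map {V W : GrVec k B R.cocycle} {b : B} {v : V.carrier} (hv : V.Homog b v) (f : V ⟶ W) :
    R.elt hv ≫ R.S.map f = R.elt (hv.map f) := by
  rw [← pushLine_S, Category.assoc, ← R.S.map_comp, ofHomog_comp, pushLine_S]

lemma S_tensor_hom_ext {V W : GrVec k B R.cocycle} {y : N} {f f' : R.S.obj V ⊗ R.S.obj W ⟶ y}
    (h : ∀ b v (hv : V.Homog b v) c w (hw : W.Homog c w),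
      (R.elt hv ⊗ₘ R.elt hw) ≫ f = (R.elt hv ⊗ₘ R.elt hw) ≫ f') : f = f' := by
  refine tensor_hom_ext R.S R.S fun b v hv c w hw => ?_
  rw [← cancel_epi (Θ.map (pushLine R.s b).hom ⊗ₘ Θ.map (pushLine R.s c).hom),
    ← Category.assoc, ← Category.assoc, tensorHom_comp_tensorHom, pushLine_S, pushLine_S,
    h b v hv c w hw]

lemma S_tensor_hom_ext₃ {V W U : GrVec k B R.cocycle} {y : N}
    {f f' : (R.S.obj V ⊗ R.S.obj W) ⊗ R.S.obj U ⟶ y}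
    (h : ∀ b v (hv : V.Homog b v) c w (hw : W.Homog c w) d u (hu : U.Homog d u),
      ((R.elt hv ⊗ₘ R.elt hw) ⊗ₘ R.elt hu) ≫ f =
        ((R.elt hv ⊗ₘ R.elt hw) ⊗ₘ R.elt hu) ≫ f') : f = f' := by
  refine tensor_hom_ext₃ R.S R.S R.S fun b v hv c w hw d u hu => ?_
  rw [← cancel_epi ((Θ.map (pushLine R.s b).hom ⊗ₘ Θ.map (pushLine R.s c).hom) ⊗ₘ
    Θ.map (pushLine R.s d).hom), ← Category.assoc, ← Category.assoc, tensorHom_comp_tensorHom,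
    tensorHom_comp_tensorHom, pushLine_S, pushLine_S, pushLine_S, h b v hv c w hw d u hu]

/-- The section is not multiplicative, so `push s` is not monoidal by itself. But `π (s b * s c) = b
* c`, so the identity of `V ⊗ W` is still graded over `B` and `ext` applies to it. -/
lemma graded_id (V W : GrVec k B R.cocycle) :
    R.Graded (X := (push 1 R.s).obj V ⊗ (push 1 R.s).obj W) (Y := V ⊗ W)
      (LinearMap.id (M := V.carrier ⊗[k] W.carrier)) := fun g x hx => by
  have h := Homog.push (ω' := R.cocycle)
    (V := tensor ((push 1 R.s).obj V) ((push 1 R.s).obj W)) hx R.π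
  have h2 := LinearMap.congr_fun
    (tensorProj_push_section (ω := (1 : ThreeCocycle A kˣ)) R.π_s V W (R.π g)) x
  change tensorProj V W _ _ = _
  rw [LinearMap.id_apply, ← h2]
  exact h

/-- The tensor structure of `S`. -/
def Sμ (V W : GrVec k B R.cocycle) : R.S.obj V ⊗ R.S.obj W ⟶ R.S.obj (V ⊗ W) :=
  μ Θ ((push 1 R.s).obj V) ((push 1 R.s).obj W) ≫
    R.ext (X := (push 1 R.s).obj V ⊗ (push 1 R.s).obj W) (Y := V ⊗ W)
      (LinearMap.id (M := V.carrier ⊗[k] W.carrier))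

instance (V W : GrVec k B R.cocycle) : IsIso (R.Sμ V W) := by
  have : IsIso (R.ext (X := (push 1 R.s).obj V ⊗ (push 1 R.s).obj W) (Y := V ⊗ W)
      (LinearMap.id (M := V.carrier ⊗[k] W.carrier))) :=
    R.isIso_ext (X := (push 1 R.s).obj V ⊗ (push 1 R.s).obj W) (Y := V ⊗ W)
      (f := LinearEquiv.refl k (V.carrier ⊗[k] W.carrier)) (R.graded_id V W)
  unfold Sμ
  infer_instance

/-- On homogeneous elements the tensor constraint of `S` is the multiplication `mu`; all coherence
of `S` reduces to properties of `mu` through this formula. -/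
lemma elt_Sμ {V W : GrVec k B R.cocycle} {b c d : B} {v : V.carrier} {w : W.carrier}
    (hv : V.Homog b v) (hw : W.Homog c w) (e : b * c = d) :
    (R.elt hv ⊗ₘ R.elt hw) ≫ R.Sμ V W =
      R.mu e ≫ R.elt (V := V ⊗ W) (e ▸ hv.tmul' hw) := by
  subst e
  have e' : R.π (R.s b * R.s c) = b * c := by rw [map_mul, R.π_s, R.π_s]
  rw [Sμ, ← Category.assoc, map_ofHomog_tensor_μ, Category.assoc,
    Graded.map_ofHomog_ext (R.graded_id V W) e', mu, Category.assoc]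

lemma elt_congr {V : GrVec k B R.cocycle} {b : B} {v v' : V.carrier} (hv : V.Homog b v)
    (hv' : V.Homog b v') (h : v = v') : R.elt hv = R.elt hv' := by
  subst h; rfl

lemma elt_smul {V : GrVec k B R.cocycle} {b : B} {v : V.carrier} (hv : V.Homog b v) (c : k) :
    R.elt (hv.smul c) = c • R.elt hv := by
  rw [← pushLine_S, ← pushLine_S, ofHomog_smul, R.S.map_smul, Linear.comp_smul]

/-- The unit structure of `S`. -/
def Sε : 𝟙_ N ⟶ R.S.obj (𝟙_ _) :=
  R.unitS ≫ R.elt (V := 𝟙_ (GrVec k B R.cocycle)) (homog_unit (1 : k))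

instance : IsIso R.Sε := by
  unfold Sε
  have : IsIso (R.elt (V := 𝟙_ (GrVec k B R.cocycle)) (homog_unit (1 : k))) := by
    rw [← pushLine_S]
    have : ofHomog (V := 𝟙_ (GrVec k B R.cocycle)) (homog_unit (1 : k)) = unitIso.inv := rfl
    rw [this]
    infer_instance
  infer_instance

end Reduction

end

/-! ### The tensor functor `S` and the factorization of `Θ` -/

section

open Functor.LaxMonoidal Functor.OplaxMonoidal

namespace Reduction

open GrVec

variable {k : Type u} [Field k] {A : Type w} [Group A] [Fintype A]
    {N : Type u₂} [Category.{v₂} N] [Preadditive N] [Linear k N] {Θ : Vec k A ⥤ N}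
    {B : Type v} [Group B] (R : Reduction Θ B)
    [MonoidalCategory N] [Θ.Monoidal] [MonoidalPreadditive N] [MonoidalLinear k N] [Fintype B]
    [Θ.Additive] [Θ.Linear k]

lemma assoc_of {W X Y Z : N} {f : W ⟶ X} {g : X ⟶ Y} {h : W ⟶ Y} (e : f ≫ g = h) (z : Y ⟶ Z) :
    f ≫ g ≫ z = h ≫ z := by rw [← e, Category.assoc]

lemma Sμ_natural {V V' W W' : GrVec k B R.cocycle} (f : V ⟶ V') (g : W ⟶ W') :
    (R.S.map f ⊗ₘ R.S.map g) ≫ R.Sμ V' W' = R.Sμ V W ≫ R.S.map (f ⊗ₘ g) := by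
  refine R.S_tensor_hom_ext fun b v hv c w hw => ?_
  rw [← Category.assoc, tensorHom_comp_tensorHom, elt_map, elt_map, R.elt_Sμ _ _ rfl,
    assoc_of (R.elt_Sμ hv hw rfl), Category.assoc, elt_map]
  rfl

/-- `S` is a tensor functor. -/
@[reducible]
def monoidalS : R.S.Monoidal :=
  Functor.CoreMonoidal.toMonoidal
    { εIso := asIso R.Sε
      μIso V W := asIso (R.Sμ V W)
      μIso_hom_natural_left f W := by
        have := R.Sμ_natural f (𝟙 W)
        rwa [R.S.map_id, tensorHom_id, tensorHom_id] at this
      μIso_hom_natural_right V f := by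
        have := R.Sμ_natural (𝟙 V) f
        rwa [R.S.map_id, id_tensorHom, id_tensorHom] at this
      associativity V W U := by
        refine R.S_tensor_hom_ext₃ fun b v hv c w hw d u hu => ?_
        simp only [asIso_hom]
        have e1 : ((R.elt hv ⊗ₘ R.elt hw) ⊗ₘ R.elt hu) ≫ (R.Sμ V W ▷ R.S.obj U) =
            (R.mu rfl ▷ R.T d) ≫ (R.elt (V := V ⊗ W) (hv.tmul' hw) ⊗ₘ R.elt hu) := by
          rw [← tensorHom_id, tensorHom_comp_tensorHom, R.elt_Sμ hv hw rfl, Category.comp_id,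
            ← tensorHom_id, tensorHom_comp_tensorHom, Category.id_comp]
        have e2 : (R.elt hv ⊗ₘ (R.elt hw ⊗ₘ R.elt hu)) ≫ (R.S.obj V ◁ R.Sμ W U) =
            (R.T b ◁ R.mu rfl) ≫ (R.elt hv ⊗ₘ R.elt (V := W ⊗ U) (hw.tmul' hu)) := by
          rw [← id_tensorHom, tensorHom_comp_tensorHom, R.elt_Sμ hw hu rfl, Category.comp_id,
            ← id_tensorHom, tensorHom_comp_tensorHom, Category.id_comp]
        have e3 : b * (c * d) = b * c * d := (mul_assoc _ _ _).symm
        -- Rebracketing `mu` produces `scalar b c d`, and the associator of `Vec_B^ω` acts on `(v ⊗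
        -- w) ⊗ u` by the same scalar, because the cocycle was defined that way.
        rw [assoc_of e1, Category.assoc, assoc_of (R.elt_Sμ (V := V ⊗ W) (hv.tmul' hw) hu rfl),
          Category.assoc (R.mu _), elt_map,
          MonoidalCategory.associator_naturality_assoc, assoc_of e2, Category.assoc (R.T b ◁ _),
          R.elt_Sμ (W := W ⊗ U) hv (hw.tmul' hu) e3, ← Category.assoc, ← Category.assoc,
          ← Category.assoc _ (R.mu e3), Category.assoc (α_ _ _ _).hom, R.scalar_spec rfl rfl rfl e3, Linear.smul_comp,
          ← Linear.comp_smul]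
        congr 1
        rw [← elt_smul]
        exact R.elt_congr _ _ (assocIso_apply hv hw hu)
      left_unitality V := by
        simp only [asIso_hom]
        refine functor_hom_ext (R.S ⋙ tensorLeft (𝟙_ N)) fun b v hv => ?_
        rw [← cancel_epi (𝟙_ N ◁ Θ.map (pushLine R.s b).hom)]
        have e0 : 𝟙_ N ◁ Θ.map (pushLine R.s b).hom ≫
            (R.S ⋙ tensorLeft (𝟙_ N)).map (ofHomog hv) = 𝟙_ N ◁ R.elt hv := by
          rw [← pushLine_S]; simp
        rw [assoc_of e0, assoc_of e0]
        have e1 : (𝟙_ N ◁ R.elt hv) ≫ (R.Sε ▷ R.S.obj V) =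
            (R.unitS ▷ R.T b) ≫ (R.elt (V := 𝟙_ (GrVec k B R.cocycle)) (homog_unit (1 : k)) ⊗ₘ
              R.elt hv) := by
          rw [Sε, whisker_exchange, comp_whiskerRight, MonoidalCategory.tensorHom_def,
            Category.assoc]
        rw [assoc_of e1, Category.assoc, assoc_of (R.elt_Sμ (V := 𝟙_ (GrVec k B R.cocycle))
            (homog_unit (1 : k)) hv (one_mul b)), Category.assoc, assoc_of (R.unitS_mu b), elt_map,
          leftUnitor_naturality]
        congr 1
        refine R.elt_congr _ _ ?_
        have h := leftUnitIso_apply (ω := R.cocycle) hv 1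
        rw [one_smul] at h
        refine Eq.trans ?_ h.symm
        change v = ((R.scalar 1 1 b)⁻¹ : kˣ).1 • v
        rw [R.scalar_one_one, inv_one, Units.val_one, one_smul]
      right_unitality V := by
        simp only [asIso_hom]
        refine functor_hom_ext (R.S ⋙ tensorRight (𝟙_ N)) fun b v hv => ?_
        rw [← cancel_epi (Θ.map (pushLine R.s b).hom ▷ 𝟙_ N)]
        have e0 : Θ.map (pushLine R.s b).hom ▷ 𝟙_ N ≫
            (R.S ⋙ tensorRight (𝟙_ N)).map (ofHomog hv) = R.elt hv ▷ 𝟙_ N := by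
          rw [← pushLine_S]; simp
        rw [assoc_of e0, assoc_of e0]
        have e1 : (R.elt hv ▷ 𝟙_ N) ≫ (R.S.obj V ◁ R.Sε) =
            (R.T b ◁ R.unitS) ≫ (R.elt hv ⊗ₘ
              R.elt (V := 𝟙_ (GrVec k B R.cocycle)) (homog_unit (1 : k))) := by
          rw [Sε, ← whisker_exchange, MonoidalCategory.whiskerLeft_comp,
            MonoidalCategory.tensorHom_def', Category.assoc]
        rw [assoc_of e1, Category.assoc, assoc_of (R.elt_Sμ (W := 𝟙_ (GrVec k B R.cocycle)) hv
            (homog_unit (1 : k)) (mul_one b)), Category.assoc, assoc_of (R.unitS_mu' b), elt_map,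
          rightUnitor_naturality]
        congr 1
        refine R.elt_congr _ _ ?_
        have h := rightUnitIso_apply (ω := R.cocycle) hv 1
        rw [one_smul] at h
        refine Eq.trans ?_ h.symm
        change v = (R.scalar b 1 1 : k) • v
        rw [R.scalar_one_one', Units.val_one, one_smul] }

lemma graded_F (X : Vec k A) :
    R.Graded (X := X) (Y := R.F.obj X) (LinearMap.id (M := X.carrier)) :=
  fun _ _ hx => hx.push R.π

/-- The natural isomorphism `Θ ≅ F ⋙ S`. -/
def factorIso : Θ ≅ R.F ⋙ R.S :=
  NatIso.ofComponents (fun X =>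
    have : IsIso (R.ext (X := X) (Y := R.F.obj X) (LinearMap.id (M := X.carrier))) :=
      R.isIso_ext (X := X) (Y := R.F.obj X) (f := LinearEquiv.refl k X.carrier) (R.graded_F X)
    asIso (R.ext (X := X) (Y := R.F.obj X) (LinearMap.id (M := X.carrier)))) <| by
    intro X Y f
    exact (R.comp_ext (R.graded_F Y) f).trans (R.ext_comp (R.graded_F X) (R.F.map f)).symm

lemma map_ofHomog_factorIso {X : Vec k A} {g : A} {b : B} (e : R.π g = b) {x : X.carrier}
    (hx : X.Homog g x) : Θ.map (ofHomog hx) ≫ R.factorIso.hom.app X =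
      (R.φ e).hom ≫ R.elt (V := R.F.obj X) (b := b) (v := x) (e ▸ hx.push R.π) :=
  Graded.map_ofHomog_ext (R.graded_F X) e hx

/-- On degrees `g` and `h` the two sides differ by the failure of `φ` to be multiplicative, namely
`defect g h`, which is precisely the twist in the tensor structure of `F`. -/
lemma factorIso_μ (X Y : Vec k A) :
    (R.factorIso.hom.app X ⊗ₘ R.factorIso.hom.app Y) ≫ R.Sμ (R.F.obj X) (R.F.obj Y) ≫
      R.S.map (pushμ R.defect R.π X Y).hom = μ Θ X Y ≫ R.factorIso.hom.app (X ⊗ Y) := by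
  refine tensor_hom_ext Θ Θ fun g x hx h y hy => ?_
  have e : R.π g * R.π h = R.π (g * h) := (map_mul _ _ _).symm
  rw [← Category.assoc, tensorHom_comp_tensorHom, R.map_ofHomog_factorIso rfl hx,
    R.map_ofHomog_factorIso rfl hy, ← tensorHom_comp_tensorHom, Category.assoc,
    assoc_of (R.elt_Sμ (V := R.F.obj X) (W := R.F.obj Y) (hx.push R.π) (hy.push R.π) e),
    Category.assoc (R.mu e), elt_map, ← Category.assoc (_ ⊗ₘ _) (μ Θ X Y), map_ofHomog_tensor_μ, Category.assoc,
    R.map_ofHomog_factorIso rfl, R.defect_spec_assoc rfl rfl rfl rfl e, ← Linear.comp_smul,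
    ← Linear.comp_smul, ← elt_smul]
  congr 2
  exact R.elt_congr _ _ (pushμ_apply R.defect R.π hx hy)

lemma factorIso_ε :
    ε Θ ≫ R.factorIso.hom.app (𝟙_ _) = R.Sε ≫ R.S.map (pushε R.π).hom := by
  have h : ε Θ = unitHom Θ ≫ Θ.map (ofHomog (V := 𝟙_ (Vec k A)) (homog_unit (1 : k))) := by
    rw [unitHom, Category.assoc, ← Θ.map_comp]
    have : unitIso.hom ≫ ofHomog (V := 𝟙_ (Vec k A)) (homog_unit (1 : k)) = 𝟙 _ :=
      unitIso.hom_inv_id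
    rw [this, Θ.map_id, Category.comp_id]
  rw [h, Category.assoc, R.map_ofHomog_factorIso (map_one R.π), ← Category.assoc, unitHom_φ, Sε,
    Category.assoc, elt_map]
  congr 1
  refine R.elt_congr _ _ ?_
  change (1 : k) = (1 : k) • (1 : k)
  simp

end Reduction

end

/-! ### Simple objects and bricks -/

section

open Functor.LaxLeftLinear Functor.OplaxLeftLinear

/-- Simple objects of a finite semisimple category together with a decomposition of each object. -/
structure Simples (k : Type u) [Field k] (M : Type u₂) [Category.{v₂} M] [Preadditive M]
    [Linear k M] where
  ι : Type
  [fintype : Fintype ι]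
  L : ι → M
  id_ne_zero : ∀ i, 𝟙 (L i) ≠ 0
  eq_smul : ∀ i (f : L i ⟶ L i), ∃ c : k, f = c • 𝟙 _
  eq_zero : ∀ {i j} (_ : i ≠ j) (f : L i ⟶ L j), f = 0
  exists_dec : ∀ X : M, ∃ (m : ℕ) (t : Fin m → ι) (p : ∀ a, X ⟶ L (t a)) (q : ∀ a, L (t a) ⟶ X),
    (∑ a, p a ≫ q a = 𝟙 X) ∧ (∀ a, q a ≫ p a = 𝟙 _) ∧ ∀ a b, a ≠ b → q a ≫ p b = 0

attribute [instance] Simples.fintype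

section

variable {k : Type u} [Field k] {M : Type u₂} [Category.{v₂} M] [Preadditive M] [Linear k M]

lemma eq_smul_of_rank_eq_one {V : Type*} [AddCommGroup V] [Module k V] (h : Module.rank k V = 1)
    {x : V} (hx : x ≠ 0) (y : V) : ∃ c : k, y = c • x := by
  have h' : Module.finrank k V = 1 := by simp [Module.finrank, h]
  obtain ⟨c, hc⟩ := exists_smul_eq_of_finrank_eq_one h' hx y
  exact ⟨c, hc.symm⟩

lemma IsFiniteSemisimple.nonempty_simples (hM : IsFiniteSemisimple k M) :
    Nonempty (Simples k M) := by
  have := hM.hasFiniteBiproducts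
  obtain ⟨n, L, hL, hdec⟩ := hM.exists_simples
  have hid : ∀ i, 𝟙 (L i) ≠ 0 := fun i hi => by
    have h1 := hL i i
    rw [if_pos rfl] at h1
    have : Subsingleton (L i ⟶ L i) := ⟨fun f g => by
      rw [← Category.id_comp f, ← Category.id_comp g, hi, zero_comp, zero_comp]⟩
    rw [rank_subsingleton'] at h1
    exact zero_ne_one h1
  refine ⟨{ ι := Fin n, L := L, id_ne_zero := hid, eq_smul := fun i f => ?_,
            eq_zero := fun {i j} hij f => ?_, exists_dec := fun X => ?_ }⟩
  · exact eq_smul_of_rank_eq_one (by rw [hL, if_pos rfl]) (hid i) f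
  · have := hL i j
    rw [if_neg hij, rank_zero_iff] at this
    exact Subsingleton.elim _ _
  · obtain ⟨m, t, ⟨e⟩⟩ := hdec X
    refine ⟨m, t, fun a => e.hom ≫ biproduct.π _ a, fun a => biproduct.ι (fun j => L (t j)) a ≫ e.inv,
      ?_, fun a => ?_, fun a b hab => ?_⟩
    · simp only [Category.assoc]
      rw [← Preadditive.comp_sum]
      simp only [← Category.assoc]
      rw [← Preadditive.sum_comp, biproduct.total]
      simp
    · simp
    · simp [biproduct.ι_π_ne _ hab]

namespace Simples

variable (sm : Simples k M)

include sm in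
/-- Morphism spaces are finite dimensional. -/
lemma finite_hom (X Y : M) : Module.Finite k (X ⟶ Y) := by
  classical
  obtain ⟨m, t, p, q, h, -⟩ := sm.exists_dec X
  obtain ⟨m', t', p', q', h', -⟩ := sm.exists_dec Y
  have hL : ∀ i j, Module.Finite k (sm.L i ⟶ sm.L j) := fun i j => by
    by_cases hij : i = j
    · subst hij
      refine ⟨⟨{𝟙 _}, ?_⟩⟩
      rw [eq_top_iff]
      rintro f -
      obtain ⟨c, rfl⟩ := sm.eq_smul i f
      exact Submodule.smul_mem _ _ (Submodule.subset_span (by simp))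
    · have : Subsingleton (sm.L i ⟶ sm.L j) :=
        ⟨fun f g => by rw [sm.eq_zero hij f, sm.eq_zero hij g]⟩
      infer_instance
  let T : (X ⟶ Y) →ₗ[k] (∀ (a : Fin m) (b : Fin m'), sm.L (t a) ⟶ sm.L (t' b)) :=
    { toFun := fun f a b => q a ≫ f ≫ p' b
      map_add' := fun f g => by ext; simp
      map_smul' := fun c f => by ext; simp }
  refine Module.Finite.of_injective T fun f g hfg => ?_
  rw [← Category.id_comp f, ← Category.comp_id f, ← Category.id_comp g, ← Category.comp_id g,
    ← h, ← h']
  simp only [Preadditive.sum_comp, Preadditive.comp_sum, Category.assoc]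
  refine Finset.sum_congr rfl fun b _ => Finset.sum_congr rfl fun a _ => ?_
  have := congrFun (congrFun hfg a) b
  change q a ≫ f ≫ p' b = q a ≫ g ≫ p' b at this
  rw [reassoc_of% this]

lemma hom_ext {X Y : M} {f g : X ⟶ Y} (h : ∀ i (x : sm.L i ⟶ X), x ≫ f = x ≫ g) : f = g := by
  obtain ⟨m, t, p, q, hpq, -⟩ := sm.exists_dec X
  rw [← Category.id_comp f, ← Category.id_comp g, ← hpq]
  simp only [Preadditive.sum_comp, Category.assoc, h]

lemma eq_zero_of_forall {X Y : M} {f : X ⟶ Y} (h : ∀ i (x : sm.L i ⟶ X), x ≫ f = 0) : f = 0 :=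
  sm.hom_ext fun i x => by rw [h, comp_zero]

/-- Some component of `f` in a decomposition of `X` is nonzero; it must go to a copy of `L i`, where
it is an invertible scalar. -/
lemma exists_retraction {i : sm.ι} {X : M} {f : sm.L i ⟶ X} (hf : f ≠ 0) :
    ∃ g : X ⟶ sm.L i, f ≫ g = 𝟙 _ := by
  obtain ⟨m, t, p, q, hpq, -⟩ := sm.exists_dec X
  have : ∃ a, f ≫ p a ≠ 0 := by
    by_contra! h
    apply hf
    rw [← Category.comp_id f, ← hpq, Preadditive.comp_sum]
    exact Finset.sum_eq_zero fun a _ => by rw [← Category.assoc, h, zero_comp]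
  obtain ⟨a, ha⟩ := this
  have hi : i = t a := by
    by_contra hne
    exact ha (sm.eq_zero hne _)
  -- The component is replaced by an arbitrary morphism so that its target `L (t a)` can be
  -- rewritten to `L i`.
  generalize hx : p a = x at ha
  clear hx
  revert x
  rw [← hi]
  intro x ha
  obtain ⟨c, hc⟩ := sm.eq_smul i (f ≫ x)
  have hc0 : c ≠ 0 := by rintro rfl; exact ha (by rw [hc, zero_smul])
  exact ⟨c⁻¹ • x, by rw [Linear.comp_smul, hc, smul_smul, inv_mul_cancel₀ hc0, one_smul]⟩

/-- An object with only scalar endomorphisms. -/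
def _root_.TensorCat.IsBrick (k : Type u) [Field k] {M : Type u₂} [Category.{v₂} M]
    [Preadditive M] [Linear k M] (X : M) : Prop :=
  𝟙 X ≠ 0 ∧ ∀ f : X ⟶ X, ∃ c : k, f = c • 𝟙 X

lemma isBrick (i : sm.ι) : IsBrick k (sm.L i) := ⟨sm.id_ne_zero i, sm.eq_smul i⟩

/-- A nonzero morphism from some `L i` splits; the resulting idempotent of `X` is a scalar,
necessarily `1`. Thus bricks are the simple objects, in a form that is visibly preserved by
equivalences. -/
lemma _root_.TensorCat.IsBrick.nonempty_iso {X : M} (hX : IsBrick k X) :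
    ∃ i, Nonempty (sm.L i ≅ X) := by
  have : ∃ i, ∃ x : sm.L i ⟶ X, x ≠ 0 := by
    by_contra! h
    exact hX.1 (sm.eq_zero_of_forall fun i x => by rw [h i x, zero_comp])
  obtain ⟨i, x, hx⟩ := this
  obtain ⟨y, hy⟩ := sm.exists_retraction hx
  obtain ⟨c, hc⟩ := hX.2 (y ≫ x)
  have h1 : x = c • x := by
    calc x = (x ≫ y) ≫ x := by rw [hy, Category.id_comp]
      _ = c • x := by rw [Category.assoc, hc, Linear.comp_smul, Category.comp_id]
  have h2 : c = 1 := by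
    have : (1 - c) • x = 0 := by rw [sub_smul, one_smul, ← h1, sub_self]
    rcases smul_eq_zero.1 this with h | h
    · exact (sub_eq_zero.1 h).symm
    · exact absurd h hx
  exact ⟨i, ⟨⟨x, y, hy, by rw [hc, h2, one_smul]⟩⟩⟩

include sm in
lemma _root_.TensorCat.IsBrick.isIso {X Y : M} (hX : IsBrick k X) (hY : IsBrick k Y)
    {f : X ⟶ Y} (hf : f ≠ 0) : IsIso f := by
  obtain ⟨i, ⟨e⟩⟩ := hX.nonempty_iso sm
  obtain ⟨j, ⟨e'⟩⟩ := hY.nonempty_iso sm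
  have h0 : e.hom ≫ f ≫ e'.inv ≠ 0 := fun h => hf (by
    have := congrArg (fun z => e.inv ≫ z ≫ e'.hom) h
    simpa using this)
  have hij : i = j := by
    by_contra hne
    exact h0 (sm.eq_zero hne _)
  subst hij
  obtain ⟨c, hc⟩ := sm.eq_smul i (e.hom ≫ f ≫ e'.inv)
  have hc0 : c ≠ 0 := by rintro rfl; exact h0 (by rw [hc, zero_smul])
  have hf' : f = c • (e.inv ≫ e'.hom) := by
    have := congrArg (fun z => e.inv ≫ z ≫ e'.hom) hc
    simpa using this
  refine ⟨c⁻¹ • (e'.inv ≫ e.hom), ?_, ?_⟩ <;> rw [hf'] <;>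
    simp [Linear.smul_comp, Linear.comp_smul, smul_smul, hc0]

end Simples

end

/-! ### Indecomposability -/

section

variable {k : Type u} [Field k] {M : Type u₂} [Category.{v₂} M] [Preadditive M] [Linear k M]
  {C : Type u₁} [Category.{v₁} C] [MonoidalCategory C] [Preadditive C] [Linear k C]
  [MonoidalLeftAction C M] [IsLinearAction k C M]

/-- The action of an object as a functor. -/
abbrev actFunctor (c : C) : M ⥤ M where
  obj m := c ⊙ₗ m
  map f := c ⊴ₗ f
  map_id _ := MonoidalLeftAction.actionHomRight_id _ _
  map_comp _ _ := MonoidalLeftAction.actionHomRight_comp _ _ _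

variable (k) in
include k in
lemma actFunctor_additive (c : C) : (actFunctor (M := M) c).Additive where
  map_add := IsLinearAction.actionHomRight_add k _ _ _

variable (k) in
lemma actFunctor_linear (c : C) : (actFunctor (M := M) c).Linear k where
  map_smul f r := IsLinearAction.actionHomRight_smul c r f

variable (k) in
include k in
lemma act_zero (c : C) (m n : M) : c ⊴ₗ (0 : m ⟶ n) = 0 :=
  haveI := actFunctor_additive (M := M) k c
  (actFunctor (M := M) c).map_zero m n

variable (k) in
include k in
lemma act_sum (c : C) {m n : M} {ι : Type*} (s : Finset ι) (f : ι → (m ⟶ n)) :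
    c ⊴ₗ (∑ i ∈ s, f i) = ∑ i ∈ s, c ⊴ₗ f i :=
  haveI := actFunctor_additive (M := M) k c
  (actFunctor (M := M) c).map_sum f s

open MonoidalLeftAction in
-- One half of the adjunction between the actions of dual objects, obtained by moving `f` past the
-- coevaluation and applying a zig-zag identity.
lemma transpose_transpose {c d : C} [ExactPairing c d] {m n : M} (f : m ⟶ c ⊙ₗ n) :
    (λₗ[C] m).inv ≫ (η_ c d) ⊵ₗ m ≫ (αₗ c d m).hom ≫
      c ⊴ₗ (d ⊴ₗ f ≫ (αₗ d c n).inv ≫ (ε_ c d) ⊵ₗ n ≫ (λₗ[C] n).hom) = f := by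
  have a1 : (αₗ c d m).hom ≫ c ⊴ₗ d ⊴ₗ f = (c ⊗ d) ⊴ₗ f ≫ (αₗ c d _).hom := by simp
  have a2 : (η_ c d) ⊵ₗ m ≫ (c ⊗ d) ⊴ₗ f = (𝟙_ C) ⊴ₗ f ≫ (η_ c d) ⊵ₗ (c ⊙ₗ n) :=
    (action_exchange _ _).symm
  have a4 : (αₗ (c ⊗ d) c n).hom ≫ (αₗ c d (c ⊙ₗ n)).hom ≫ c ⊴ₗ (αₗ d c n).inv =
      (α_ c d c).hom ⊵ₗ n ≫ (αₗ c (d ⊗ c) n).hom := by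
    rw [← associator_actionHom_assoc, actionHomRight_hom_inv, Category.comp_id]
  have a5 : (αₗ c (d ⊗ c) n).hom ≫ c ⊴ₗ ((ε_ c d) ⊵ₗ n) =
      (c ◁ ε_ c d) ⊵ₗ n ≫ (αₗ c (𝟙_ C) n).hom := by simp
  have a6 : (αₗ (𝟙_ C) c n).hom ≫ (η_ c d) ⊵ₗ (c ⊙ₗ n) =
      (η_ c d ▷ c) ⊵ₗ n ≫ (αₗ (c ⊗ d) c n).hom := by simp
  have a3 : (η_ c d) ⊵ₗ (c ⊙ₗ n) ≫ (αₗ c d _).hom ≫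
      c ⊴ₗ ((αₗ d c n).inv ≫ (ε_ c d) ⊵ₗ n ≫ (λₗ[C] n).hom) = (λₗ[C] (c ⊙ₗ n)).hom := by
    rw [← cancel_epi (αₗ (𝟙_ C) c n).hom, reassoc_of% a6, actionHomRight_comp, reassoc_of% a4,
      actionHomRight_comp, reassoc_of% a5, ← rightUnitor_actionHom, ← leftUnitor_actionHom,
      ← comp_actionHomLeft, ← comp_actionHomLeft, ← comp_actionHomLeft,
      ExactPairing.evaluation_coevaluation_assoc]
    simp only [Iso.inv_hom_id, Category.comp_id]
  rw [actionHomRight_comp, reassoc_of% a1, reassoc_of% a2, a3, ← actionUnitIso_hom_naturality,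
    Iso.inv_hom_id_assoc]

variable (k) in
include k in
/-- Transposition along a duality. -/
lemma transpose_ne_zero {c d : C} [ExactPairing c d] {m n : M} {f : m ⟶ c ⊙ₗ n} (hf : f ≠ 0) :
    ∃ g : d ⊙ₗ m ⟶ n, g ≠ 0 := by
  let g : d ⊙ₗ m ⟶ n := d ⊴ₗ f ≫ (αₗ d c n).inv ≫ (ε_ c d) ⊵ₗ n ≫ (λₗ[C] n).hom
  refine ⟨g, fun hg => hf ?_⟩
  rw [← transpose_transpose (d := d) f, show d ⊴ₗ f ≫ (αₗ d c n).inv ≫ (ε_ c d) ⊵ₗ n ≫ (λₗ[C] n).hom = 0 from hg,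
    act_zero k, comp_zero, comp_zero, comp_zero]

/-- Over an indecomposable module category, each simple object is a retract of an object
obtained from a given one by acting. -/
lemma exists_retract_act (sm : Simples k M) [HasFiniteBiproducts M]
    (hdual : ∀ c : C, Nonempty (HasRightDual c)) (hind : IsIndecomposable C M) (i j : sm.ι) :
    ∃ (c : C) (f : sm.L j ⟶ c ⊙ₗ sm.L i) (g : c ⊙ₗ sm.L i ⟶ sm.L j), f ≫ g = 𝟙 _ := by
  -- The simples reachable from `L i` by acting. Reachability is transitive, and the claim is that
  -- everything is reachable.
  let S : sm.ι → Prop := fun j => ∃ (c : C) (f : sm.L j ⟶ c ⊙ₗ sm.L i), f ≠ 0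
  suffices h : ∀ j, S j by
    obtain ⟨c, f, hf⟩ := h j
    obtain ⟨g, hg⟩ := sm.exists_retraction hf
    exact ⟨c, f, g, hg⟩
  have hS : ∀ (j l : sm.ι) (c : C) (f : sm.L l ⟶ c ⊙ₗ sm.L j), S j → f ≠ 0 → S l := by
    rintro j l c f ⟨c', f', hf'⟩ hf
    obtain ⟨g', hg'⟩ := sm.exists_retraction hf'
    refine ⟨c ⊗ c', f ≫ c ⊴ₗ f' ≫ (αₗ c c' _).inv, fun h => hf ?_⟩
    have h2 := congrArg (fun z => z ≫ (αₗ c c' _).hom ≫ c ⊴ₗ g') h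
    simp only [Category.assoc, Iso.inv_hom_id_assoc, zero_comp] at h2
    rwa [← MonoidalLeftAction.actionHomRight_comp, hg', MonoidalLeftAction.actionHomRight_id,
      Category.comp_id] at h2
  -- `P` and `Q` consist of the objects all of whose simple constituents are reachable, respectively
  -- unreachable; together they split `M`.
  let P : ObjectProperty M := fun m => ∀ j, ¬ S j → ∀ f : sm.L j ⟶ m, f = 0
  let Q : ObjectProperty M := fun m => ∀ j, S j → ∀ f : sm.L j ⟶ m, f = 0
  have hSi : S i := ⟨𝟙_ C, (λₗ[C] _).inv, fun h => sm.id_ne_zero i (by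
    rw [← (λₗ[C] (sm.L i)).inv_hom_id, h, zero_comp])⟩
  have key := hind.eq_zero_or_eq_zero P Q
    ⟨fun {X Y} e hX j hj f => by
      rw [← cancel_mono e.inv, zero_comp]; exact hX j hj _⟩
    ⟨fun {X Y} e hX j hj f => by
      rw [← cancel_mono e.inv, zero_comp]; exact hX j hj _⟩
    (fun c m hm j hj f => by
      by_contra hf
      obtain ⟨n, t, p, q, hpq, hqp, -⟩ := sm.exists_dec m
      apply hf
      rw [← Category.comp_id f, ← MonoidalLeftAction.actionHomRight_id, ← hpq, act_sum k,
        Preadditive.comp_sum]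
      refine Finset.sum_eq_zero fun a _ => ?_
      rw [MonoidalLeftAction.actionHomRight_comp, ← Category.assoc]
      by_contra hne
      have hne' : f ≫ c ⊴ₗ p a ≠ 0 := fun h => hne (by rw [h, zero_comp])
      refine hj (hS _ _ c _ ?_ hne')
      by_contra hta
      refine sm.id_ne_zero (t a) ?_
      rw [← hqp a, hm _ hta (q a), zero_comp])
    -- Stability of `Q` is where rigidity enters: a nonzero `L j ⟶ c ⊙ m` transposes to a nonzero
    -- `cᘁ ⊙ L j ⟶ m`. For reachable `j` its source has only reachable constituents, none of which
    -- map to `m`.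
    (fun c m hm j hj f => by
      by_contra hf
      obtain ⟨_⟩ := hdual c
      obtain ⟨g, hg⟩ := transpose_ne_zero k (c := c) (d := cᘁ) hf
      apply hg
      refine sm.eq_zero_of_forall fun l x => ?_
      by_contra hx
      have hx' : x ≠ 0 := fun h => hx (by rw [h, zero_comp])
      exact hx (hm l (hS _ _ _ x hj hx') _))
    (fun m n hm hn => ⟨fun f => sm.eq_zero_of_forall fun l x => by
        by_cases hl : S l
        · exact hn l hl _
        · rw [hm l hl x, zero_comp], fun f => sm.eq_zero_of_forall fun l x => by
        by_cases hl : S l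
        · rw [hn l hl x, zero_comp]
        · exact hm l hl _⟩)
    (fun x => by
      classical
      obtain ⟨n, t, p, q, hpq, hqp, hqp'⟩ := sm.exists_dec x
      have hdisj : ∀ (a : {a // S (t a)}) (b : {a // ¬ S (t a)}), a.1 ≠ b.1 :=
        fun a b h => b.2 (h ▸ a.2)
      let b : BinaryBicone (⨁ fun a : {a // S (t a)} => sm.L (t a))
          (⨁ fun a : {a // ¬ S (t a)} => sm.L (t a)) :=
        { pt := x
          fst := biproduct.lift fun a => p a
          snd := biproduct.lift fun a => p a
          inl := biproduct.desc fun a => q a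
          inr := biproduct.desc fun a => q a
          inl_fst := by
            ext b a
            by_cases hab : b = a
            · subst hab; simp [hqp]
            · have : a.1 ≠ b.1 := fun h => hab (Subtype.ext h.symm)
              simp [hqp' _ _ this, biproduct.ι_π_ne _ (Ne.symm hab)]
          inl_snd := by
            ext b a
            simp [hqp' _ _ (hdisj a b)]
          inr_fst := by
            ext b a
            simp [hqp' _ _ (hdisj b a).symm]
          inr_snd := by
            ext b a
            by_cases hab : b = a
            · subst hab; simp [hqp]
            · have : a.1 ≠ b.1 := fun h => hab (Subtype.ext h.symm)
              simp [hqp' _ _ this, biproduct.ι_π_ne _ (Ne.symm hab)] }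
      refine ⟨_, _, b, ?_, ?_, ⟨isBinaryBilimitOfTotal b ?_⟩, ⟨Iso.refl _⟩⟩
      · intro j hj f
        ext a
        rw [zero_comp]
        exact sm.eq_zero (i := j) (j := t a) (fun h => hj (h ▸ a.2)) _
      · intro j hj f
        ext a
        rw [zero_comp]
        exact sm.eq_zero (i := j) (j := t a) (fun h => a.2 (h ▸ hj)) _
      · change biproduct.lift (fun a : {a // S (t a)} => p a) ≫ biproduct.desc (fun a => q a) +
          biproduct.lift (fun a : {a // ¬ S (t a)} => p a) ≫ biproduct.desc (fun a => q a) = 𝟙 x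
        rw [biproduct.lift_desc, biproduct.lift_desc, ← hpq]
        exact Fintype.sum_subtype_add_sum_subtype (fun a => S (t a)) fun a => p a ≫ q a)
  -- `L i` itself lies in `P`, so `P` is not zero; and an unreachable simple would be a nonzero
  -- object of `Q`.
  rcases key with h | h
  · refine absurd ((h (sm.L i) fun j hj f => ?_).eq_of_src _ _) (sm.id_ne_zero i)
    exact sm.eq_zero (i := j) (j := i) (fun hji => hj (hji ▸ hSi)) f
  · intro j
    by_contra hj
    refine absurd ((h (sm.L j) fun l hl f => ?_).eq_of_src _ _) (sm.id_ne_zero j)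
    exact sm.eq_zero (i := l) (j := j) (fun hlj => hj (hlj ▸ hl)) f

end

end

section

open Functor.LaxLeftLinear Functor.OplaxLeftLinear

/-! ### Schur's lemma in the dual category -/

section

variable {k : Type u} [Field k] {M : Type u₂} [Category.{v₂} M] [Preadditive M] [Linear k M]
  {C : Type u₁} [Category.{v₁} C] [MonoidalCategory C] [Preadditive C] [Linear k C]
  [MonoidalLeftAction C M] [IsLinearAction k C M]

namespace Dual

lemma app_act (F G : Dual k C M) (η : F ⟶ G) (c : C) (m : M) :
    (nat η).app (c ⊙ₗ m) = (F.lineator c m).inv ≫ c ⊴ₗ (nat η).app m ≫ (G.lineator c m).hom := by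
  rw [Iso.eq_inv_comp, nat_compat]

variable (sm : Simples k M)
  (hret : ∀ i j : sm.ι, ∃ (c : C) (f : sm.L j ⟶ c ⊙ₗ sm.L i) (g : c ⊙ₗ sm.L i ⟶ sm.L j), f ≫ g = 𝟙 _)

lemma isIso_of_app {F G : Dual k C M} (η : F ⟶ G) (h : ∀ m, IsIso ((nat η).app m)) : IsIso η := by
  have : IsIso (nat η) := NatIso.isIso_of_isIso_app _
  exact (mkIso (F := F) (G := G) (asIso (nat η)) (nat_compat η)).isIso_hom

lemma app_retract {F G : Dual k C M} (η : F ⟶ G) {m n : M} {f : m ⟶ n} {g : n ⟶ m}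
    (h : f ≫ g = 𝟙 m) : (nat η).app m = F.functor.map f ≫ (nat η).app n ≫ G.functor.map g := by
  rw [← NatTrans.naturality, ← F.functor.map_comp_assoc, h, F.functor.map_id, Category.id_comp]

lemma app_dec {F G : Dual k C M} (η : F ⟶ G) {m : M} {l : ℕ} {n : Fin l → M} {p : ∀ a, m ⟶ n a}
    {q : ∀ a, n a ⟶ m} (h : ∑ a, p a ≫ q a = 𝟙 m) :
    (nat η).app m = ∑ a, F.functor.map (p a) ≫ (nat η).app (n a) ≫ G.functor.map (q a) := by
  simp only [← NatTrans.naturality]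
  simp only [← F.functor.map_comp_assoc]
  rw [← Preadditive.sum_comp, ← F.functor.map_sum, h, F.functor.map_id, Category.id_comp]

include hret in
-- Compatibility with the action determines the component at `c ⊙ L i` from the one at `L i`, and
-- each simple is a retract of such an object.
lemma eq_zero_of_app {F G : Dual k C M} {η : F ⟶ G} {i : sm.ι}
    (h : (nat η).app (sm.L i) = 0) : η = 0 := by
  have h1 : ∀ j, (nat η).app (sm.L j) = 0 := fun j => by
    obtain ⟨c, f, g, hfg⟩ := hret i j
    rw [app_retract η hfg, app_act, h, act_zero k]
    simp
  refine hom_ext fun m => ?_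
  obtain ⟨l, t, p, q, hpq, -⟩ := sm.exists_dec m
  rw [app_dec η hpq]
  simp [h1]

/-- The underlying functor preserves bricks. -/
def PreservesBricks (F : Dual k C M) : Prop := ∀ X : M, IsBrick k X → IsBrick k (F.functor.obj X)

variable {F G : Dual k C M} (hF : F.PreservesBricks) (hG : G.PreservesBricks)

include hret hF hG in
-- A nonzero morphism has nonzero components at all simples; these are morphisms between bricks,
-- hence invertible. Inverses at general objects are assembled from a decomposition.
lemma isIso_of_ne_zero {η : F ⟶ G} (hη : η ≠ 0) : IsIso η := by
  have h1 : ∀ j, IsIso ((nat η).app (sm.L j)) := fun j =>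
    (hF _ (sm.isBrick j)).isIso sm (hG _ (sm.isBrick j)) fun h => hη (eq_zero_of_app sm hret h)
  refine isIso_of_app η fun m => ?_
  obtain ⟨l, t, p, q, hpq, -⟩ := sm.exists_dec m
  refine ⟨∑ a, G.functor.map (p a) ≫ inv ((nat η).app (sm.L (t a))) ≫ F.functor.map (q a), ?_, ?_⟩
  · rw [Preadditive.comp_sum]
    simp only [← NatTrans.naturality_assoc, IsIso.hom_inv_id_assoc]
    simp only [← F.functor.map_comp]
    rw [← F.functor.map_sum, hpq, F.functor.map_id]
  · rw [Preadditive.sum_comp]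
    simp only [Category.assoc, NatTrans.naturality, IsIso.inv_hom_id_assoc]
    simp only [← G.functor.map_comp]
    rw [← G.functor.map_sum, hpq, G.functor.map_id]

include hret hF hG in
-- The components at one simple are proportional, and the difference `θ - c • η`, which vanishes
-- there, vanishes everywhere.
lemma eq_smul_of_ne_zero (i : sm.ι) {η : F ⟶ G} (hη : η ≠ 0) (θ : F ⟶ G) : ∃ c : k, θ = c • η := by
  have h0 : (nat η).app (sm.L i) ≠ 0 := fun h => hη (eq_zero_of_app sm hret h)
  have hiso := (hF _ (sm.isBrick i)).isIso sm (hG _ (sm.isBrick i)) h0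
  obtain ⟨c, hc⟩ := (hG _ (sm.isBrick i)).2 (inv ((nat η).app (sm.L i)) ≫ (nat θ).app (sm.L i))
  refine ⟨c, sub_eq_zero.1 (eq_zero_of_app (η := θ - c • η) sm hret (i := i) ?_)⟩
  rw [IsIso.inv_comp_eq, Linear.comp_smul, Category.comp_id] at hc
  change (nat θ).app (sm.L i) - c • (nat η).app (sm.L i) = 0
  rw [hc, sub_self]

lemma id_ne_zero (i : sm.ι) (hF : F.PreservesBricks) : 𝟙 F ≠ 0 := fun h =>
  (hF _ (sm.isBrick i)).1 (congrArg (fun η : F ⟶ F => (nat η).app (sm.L i)) h)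

end Dual

end

/-! ### The double dual -/

section

variable {k : Type u} [Field k] {M : Type u₂} [Category.{v₂} M] [Preadditive M] [Linear k M]
  {D : Type u₁} [Category.{v₁} D] [MonoidalCategory D] [Preadditive D] [Linear k D]
  [MonoidalLeftAction D M] [IsLinearAction k D M]
  (P : ObjectProperty (Dual k D M)) [P.IsMonoidal]

instance : IsLinearAction k P.FullSubcategory M where
  actionHomRight_add c _ _ f g := c.obj.functor.map_add
  actionHomRight_smul c _ _ r f := c.obj.functor.map_smul r f
  actionHomLeft_add f g m := rfl
  actionHomLeft_smul r f m := rfl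

/-- The action of an object of `D` as an object of the double dual. -/
abbrev evalObj (d : D) : Dual k P.FullSubcategory M where
  functor := actFunctor d
  additive := actFunctor_additive k d
  linear := actFunctor_linear k d
  -- That `c` commutes with `d` and that `d` commutes with `c` is one datum read in two directions.
  leftLinear := Dual.leftLinearOfIso _ (fun c m => (c.obj.lineator d m).symm)
    (fun {c c'} f m => by
      rw [Iso.symm_hom, Iso.symm_hom, Iso.comp_inv_eq, Category.assoc, Iso.eq_inv_comp]
      exact Dual.nat_compat f.hom d m)
    (fun c m n f => by
      rw [Iso.symm_hom, Iso.symm_hom, Iso.comp_inv_eq, Category.assoc, Iso.eq_inv_comp]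
      exact (Functor.LaxLeftLinear.μₗ_naturality_right c.obj.functor d f).symm)
    (fun c c' m => by
      change (Dual.lineator (Dual.comp c.obj c'.obj) d m).inv ≫ d ⊴ₗ 𝟙 _ = 𝟙 _ ≫
        c.obj.functor.map (c'.obj.lineator d m).inv ≫ (c.obj.lineator d _).inv
      rw [Dual.comp_lineator, MonoidalLeftAction.actionHomRight_id, Category.comp_id,
        Category.id_comp]
      rfl)
    (fun m => by
      change 𝟙 _ = 𝟙 _ ≫ d ⊴ₗ 𝟙 m
      rw [MonoidalLeftAction.actionHomRight_id, Category.comp_id]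
      )

lemma evalObj_lineator (d : D) (c : P.FullSubcategory) (m : M) :
    (evalObj P d).lineator c m = (c.obj.lineator d m).symm := rfl

/-- The functor `D ⥤ (D^*_M)^*_M`, followed by restriction to the subcategory. -/
def eval : D ⥤ Dual k P.FullSubcategory M where
  obj d := evalObj P d
  map {d d'} f := Dual.mkHom (F := evalObj P d) (G := evalObj P d')
    { app := fun m => f ⊵ₗ m
      naturality := fun _ _ g => MonoidalLeftAction.action_exchange f g } fun c m => by
      rw [evalObj_lineator, evalObj_lineator, Iso.symm_hom, Iso.symm_hom, Iso.inv_comp_eq,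
        ← Category.assoc, Iso.eq_comp_inv]
      exact Functor.LaxLeftLinear.μₗ_naturality_left c.obj.functor f m
  map_id d := Dual.hom_ext fun m => MonoidalLeftAction.id_actionHomLeft d m
  map_comp f g := Dual.hom_ext fun m => MonoidalLeftAction.comp_actionHomLeft f g m

instance : (eval (k := k) P).Additive where
  map_add := Dual.hom_ext fun m => IsLinearAction.actionHomLeft_add k _ _ m

instance : (eval (k := k) P).Linear k where
  map_smul f r := Dual.hom_ext fun m => IsLinearAction.actionHomLeft_smul r f m

/-- The unit isomorphism of `eval`. -/
def evalUnit : 𝟙_ (Dual k P.FullSubcategory M) ≅ (eval P).obj (𝟙_ D) :=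
  Dual.mkIso (F := Dual.one) (G := evalObj P (𝟙_ D))
    (NatIso.ofComponents (fun m => (λₗ[D] m).symm) fun f =>
      (MonoidalLeftAction.actionUnitIso_inv_naturality f).symm) fun c m => by
    rw [Dual.one_lineator, evalObj_lineator]
    change 𝟙 _ ≫ (λₗ[D] (c.obj.functor.obj m)).inv = c.obj.functor.map (λₗ[D] m).inv ≫ _
    rw [Category.id_comp, Iso.symm_hom, Iso.eq_comp_inv, Iso.inv_comp_eq]
    have := Functor.LaxLeftLinear.μₗ_unitality (C := D) c.obj.functor m
    rw [this, Category.assoc, ← c.obj.functor.map_comp, Iso.hom_inv_id, c.obj.functor.map_id,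
      Category.comp_id]
    rfl

/-- The tensor isomorphism of `eval`. -/
def evalTensor (d d' : D) : (eval (k := k) P).obj d ⊗ (eval P).obj d' ≅ (eval P).obj (d ⊗ d') :=
  Dual.mkIso (F := Dual.comp (evalObj P d) (evalObj P d')) (G := evalObj P (d ⊗ d'))
    (NatIso.ofComponents (fun m => (αₗ d d' m).symm) fun f => by
      change d ⊴ₗ d' ⊴ₗ f ≫ (αₗ d d' _).inv = (αₗ d d' _).inv ≫ (d ⊗ d') ⊴ₗ f
      simp) fun c m => by
    rw [Dual.comp_lineator, evalObj_lineator, evalObj_lineator, evalObj_lineator]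
    change ((c.obj.lineator d (d' ⊙ₗ m)).inv ≫ d ⊴ₗ (c.obj.lineator d' m).inv) ≫
      (αₗ d d' _).inv = c.obj.functor.map (αₗ d d' m).inv ≫ (c.obj.lineator (d ⊗ d') m).inv
    have := Functor.LaxLeftLinear.μₗ_associativity (C := D) c.obj.functor d d' m
    rw [← cancel_epi (d ⊴ₗ (c.obj.lineator d' m).hom ≫ (c.obj.lineator d (d' ⊙ₗ m)).hom),
      ← cancel_epi (αₗ d d' (c.obj.functor.obj m)).hom]
    simp only [Category.assoc, Iso.hom_inv_id_assoc, MonoidalLeftAction.actionHomRight_hom_inv_assoc,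
      Iso.hom_inv_id]
    change _ = (αₗ d d' (c.obj.functor.obj m)).hom ≫ d ⊴ₗ μₗ c.obj.functor d' m ≫
      μₗ c.obj.functor d (d' ⊙ₗ m) ≫ _
    rw [← reassoc_of% this, ← c.obj.functor.map_comp_assoc, Iso.hom_inv_id, c.obj.functor.map_id,
      Category.id_comp]
    exact (c.obj.lineator (d ⊗ d') m).hom_inv_id.symm

/-- `eval` is a tensor functor. -/
instance evalMonoidal : (eval (k := k) P).Monoidal :=
  Functor.CoreMonoidal.toMonoidal
    { εIso := evalUnit P
      μIso d d' := evalTensor P d d'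
      μIso_hom_natural_left f d := Dual.hom_ext fun m => by
        change f ⊵ₗ (d ⊙ₗ m) ≫ (αₗ _ d m).inv = (αₗ _ d m).inv ≫ (f ▷ d) ⊵ₗ m
        simp
      μIso_hom_natural_right d f := Dual.hom_ext fun m => by
        change d ⊴ₗ (f ⊵ₗ m) ≫ (αₗ d _ m).inv = (αₗ d _ m).inv ≫ (d ◁ f) ⊵ₗ m
        simp
      associativity d d' d'' := Dual.hom_ext fun m => by
        change (αₗ d d' (d'' ⊙ₗ m)).inv ≫ (αₗ (d ⊗ d') d'' m).inv ≫ (α_ d d' d'').hom ⊵ₗ m =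
          𝟙 _ ≫ d ⊴ₗ (αₗ d' d'' m).inv ≫ (αₗ d (d' ⊗ d'') m).inv
        rw [Category.id_comp, Iso.inv_comp_eq, Iso.inv_comp_eq, ← reassoc_of%
          (MonoidalLeftAction.associator_actionHom d d' d'' m),
          MonoidalLeftAction.actionHomRight_hom_inv_assoc, Iso.hom_inv_id, Category.comp_id]
      left_unitality d := Dual.hom_ext fun m => by
        change 𝟙 _ = (λₗ[D] (d ⊙ₗ m)).inv ≫ (αₗ (𝟙_ D) d m).inv ≫ (λ_ d).hom ⊵ₗ m
        rw [MonoidalLeftAction.leftUnitor_actionHom, Iso.inv_hom_id_assoc, Iso.inv_hom_id]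
      right_unitality d := Dual.hom_ext fun m => by
        change 𝟙 _ = d ⊴ₗ (λₗ[D] m).inv ≫ (αₗ d (𝟙_ D) m).inv ≫ (ρ_ d).hom ⊵ₗ m
        rw [MonoidalLeftAction.rightUnitor_actionHom, Iso.inv_hom_id_assoc,
          MonoidalLeftAction.actionHomRight_inv_hom] }

end

end

section

open Functor.LaxMonoidal Functor.OplaxMonoidal

/-! ### The group of isomorphism classes of the objects `Θ (line g)` -/

section

open GrVec

variable {k : Type u} [Field k] {A : Type w} [Group A] [Fintype A]
    {N : Type u₂} [Category.{v₂} N] [Preadditive N] [Linear k N] (Θ : Vec k A ⥤ N)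
    [MonoidalCategory N] [Θ.Monoidal]

/-- The congruence on `A` identifying elements with isomorphic images. -/
def lineCon : Con A where
  r g h := Nonempty (Θ.obj (line g) ≅ Θ.obj (line h))
  iseqv := ⟨fun _ => ⟨Iso.refl _⟩, fun ⟨e⟩ => ⟨e.symm⟩, fun ⟨e⟩ ⟨e'⟩ => ⟨e ≪≫ e'⟩⟩
  mul' := fun {g h g' h'} ⟨e⟩ ⟨e'⟩ =>
    ⟨(asIso (mulHom Θ (rfl : g * g' = _))).symm ≪≫ (e ⊗ᵢ e') ≪≫
      asIso (mulHom Θ (rfl : h * h' = _))⟩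

instance : Fintype (lineCon Θ).Quotient :=
  haveI := Classical.decRel (lineCon Θ).r
  Quotient.fintype (lineCon Θ).toSetoid

lemma exists_section : ∃ s : (lineCon Θ).Quotient → A, (∀ b, (s b : (lineCon Θ).Quotient) = b) ∧
    s 1 = 1 := by
  classical
  choose s hs using fun b : (lineCon Θ).Quotient => Con.mk'_surjective (c := lineCon Θ) b
  refine ⟨fun b => if b = 1 then 1 else s b, fun b => ?_, if_pos rfl⟩
  by_cases hb : b = 1
  · subst hb; simp
  · simp only [hb, if_false]
    exact hs b

/-- The additional clause, that different classes have non-isomorphic representatives, is not part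
of `Reduction` but is what the independence theorem needs later. -/
lemma exists_reduction (h1 : ∀ g, 𝟙 (Θ.obj (line g)) ≠ 0)
    (h2 : ∀ {g h : A} (f f' : Θ.obj (line g) ⟶ Θ.obj (line h)), f ≠ 0 → ∃ c : k, f' = c • f) :
    ∃ R : Reduction Θ (lineCon Θ).Quotient, ∀ b b', Nonempty (R.T b ≅ R.T b') → b = b' := by
  classical
  obtain ⟨s, hs, hs1⟩ := exists_section Θ
  have hiso : ∀ {g : A} {b : (lineCon Θ).Quotient}, (g : (lineCon Θ).Quotient) = b →
      Nonempty (Θ.obj (line g) ≅ Θ.obj (line (s b))) := fun {g b} e =>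
    ((lineCon Θ).eq.1 (e.trans (hs b).symm) :)
  refine ⟨{
    π := (lineCon Θ).mk'
    s := s
    π_s := hs
    s_one := hs1
    -- The case distinction forces `φ` to be the identity on representatives, so that all scalars
    -- are normalized at the unit.
    φ := fun {g b} e => if h : g = s b then eqToIso (by rw [h]) else (hiso e).some
    φ_s := fun b => by simp
    id_ne_zero := h1
    eq_smul := h2 }, fun b b' e => ?_⟩
  rw [← hs b, ← hs b']
  exact (lineCon Θ).eq.2 e

end

/-! ### Pulling back the evaluation action -/

section

variable {k : Type u} [Field k] {M : Type u₂} [Category.{v₂} M] [Preadditive M] [Linear k M]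
  {C : Type u₁} [Category.{v₁} C] [MonoidalCategory C] [Preadditive C] [Linear k C]
  [MonoidalLeftAction C M] [IsLinearAction k C M]

/-- Components of an isomorphism in the dual category. -/
abbrev Dual.appIso {F G : Dual k C M} (e : F ≅ G) (m : M) : F.functor.obj m ≅ G.functor.obj m where
  hom := (nat e.hom).app m
  inv := (nat e.inv).app m
  hom_inv_id := congrArg (fun η : F ⟶ F => (nat η).app m) e.hom_inv_id
  inv_hom_id := congrArg (fun η : G ⟶ G => (nat η).app m) e.inv_hom_id

variable {D : Type u₃} [Category.{v₃} D] [MonoidalCategory D] [Preadditive D] [Linear k D]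
  (S : D ⥤ Dual k C M) [S.Monoidal]

lemma Dual.congr_app {F G : Dual k C M} {η θ : F ⟶ G} (h : η = θ) (m : M) :
    (nat η).app m = (nat θ).app m := by rw [h]

/-- The action `(d, m) ↦ S d m` given by a tensor functor to the dual category. -/
@[reducible]
def pullAction : MonoidalLeftAction D M where
  actionObj d m := (S.obj d).functor.obj m
  actionHomLeft f m := (Dual.nat (S.map f)).app m
  actionHomRight d _ _ f := (S.obj d).functor.map f
  actionAssocIso d d' m := (Dual.appIso (Functor.Monoidal.μIso S d d') m).symm
  actionUnitIso m := (Dual.appIso (Functor.Monoidal.εIso S) m).symm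
  actionHomRight_id d m := (S.obj d).functor.map_id m
  id_actionHomLeft d m := by rw [S.map_id]; rfl
  actionHom_comp f₁ f₂ g₁ g₂ := by
    simp
  actionAssocIso_hom_naturality {d₁ d₂ d₃ d₄ m m'} f g h := by
    have h1 := Dual.congr_app (Functor.OplaxMonoidal.δ_natural S f g) m
    rw [Dual.nat_comp, Dual.nat_comp, NatTrans.comp_app, NatTrans.comp_app, Dual.tensorHom_app] at h1
    change ((Dual.nat (S.map (f ⊗ₘ g))).app m ≫ (S.obj (d₂ ⊗ d₄)).functor.map h) ≫
      (Dual.nat (δ S d₂ d₄)).app m' = (Dual.nat (δ S d₁ d₃)).app m ≫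
        (Dual.nat (S.map f)).app ((S.obj d₃).functor.obj m) ≫ (S.obj d₂).functor.map
          ((Dual.nat (S.map g)).app m ≫ (S.obj d₄).functor.map h)
    rw [Category.assoc, NatTrans.naturality, ← Category.assoc]
    erw [← h1]
    simp only [Category.assoc, Functor.map_comp]
    rfl
  actionUnitIso_hom_naturality f := ((Dual.nat (η S)).naturality f).symm
  whiskerLeft_actionHomLeft d d' d'' f m := by
    have h1 := Dual.congr_app (Functor.Monoidal.map_whiskerLeft S d f) m
    exact h1
  whiskerRight_actionHomLeft d f m := by
    have h1 := Dual.congr_app (Functor.Monoidal.map_whiskerRight S f d) m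
    exact h1
  associator_actionHom d d' d'' m := by
    have h1 := Dual.congr_app (Functor.OplaxMonoidal.associativity S d d' d'') m
    change (Dual.nat (δ S _ _)).app m ≫ (Dual.nat (δ S _ _)).app _ ≫ 𝟙 _ =
      (Dual.nat (S.map _)).app m ≫ _ at h1
    rw [Category.comp_id] at h1
    exact h1.symm
  leftUnitor_actionHom d m := by
    have h1 := Dual.congr_app (Functor.Monoidal.map_leftUnitor S d) m
    change _ = (Dual.nat (δ S _ _)).app m ≫ (Dual.nat (η S)).app _ ≫ 𝟙 _ at h1
    rw [Category.comp_id] at h1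
    exact h1
  rightUnitor_actionHom d m := by
    have h1 := Dual.congr_app (Functor.Monoidal.map_rightUnitor S d) m
    change _ = (Dual.nat (δ S _ _)).app m ≫ (S.obj d).functor.map ((Dual.nat (η S)).app _) ≫ 𝟙 _ at h1
    rw [Category.comp_id] at h1
    exact h1

lemma pullAction_linear [S.Additive] [S.Linear k] :
    letI := pullAction S
    IsLinearAction k D M :=
  letI := pullAction S
  { actionHomRight_add d _ _ _ _ := (S.obj d).functor.map_add
    actionHomRight_smul d _ _ r f := (S.obj d).functor.map_smul r f
    actionHomLeft_add f g m := by
      change (Dual.nat (S.map (f + g))).app m = _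
      rw [S.map_add]; rfl
    actionHomLeft_smul r f m := by
      change (Dual.nat (S.map (r • f))).app m = _
      rw [S.map_smul]; rfl }

end

end

section

open Functor.LaxMonoidal Functor.OplaxMonoidal

section

variable {k : Type u} [Field k] {M : Type u₂} [Category.{v₂} M] [Preadditive M] [Linear k M]
  {V : Type u₁} [Category.{v₁} V] [MonoidalCategory V] [Preadditive V] [Linear k V]
  [MonoidalLeftAction V M] [IsLinearAction k V M]
  {D : Type u₃} [Category.{v₃} D] [MonoidalCategory D] [Preadditive D] [Linear k D]

/-! ### Full faithfulness of the dual functor -/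

section

variable {F : V ⥤ D} [F.Monoidal] [MonoidalLeftAction D M] [IsLinearAction k D M]
  (e : FactorsThrough F M)

lemma Dual.lineator_naturality_left (G : Dual k D M) {d d' : D} (f : d ⟶ d') (m : M) :
    f ⊵ₗ G.functor.obj m ≫ (G.lineator d' m).hom =
      (G.lineator d m).hom ≫ G.functor.map (f ⊵ₗ m) :=
  Functor.LaxLeftLinear.μₗ_naturality_left G.functor f m

lemma Dual.lineator_naturality_right (G : Dual k D M) (d : D) {m n : M} (f : m ⟶ n) :
    d ⊴ₗ G.functor.map f ≫ (G.lineator d n).hom =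
      (G.lineator d m).hom ≫ G.functor.map (d ⊴ₗ f) :=
  Functor.LaxLeftLinear.μₗ_naturality_right G.functor d f

lemma faithful_dualFunctor : (e.dualFunctor (k := k)).Faithful where
  map_injective {G H _ _} h := Dual.hom_ext fun m =>
    congrArg (fun x : e.dualObj G ⟶ e.dualObj H => (Dual.nat x).app m) h

/-- The identifications `X ⊙ m ≅ F X ⊙ m` occurring on both sides are isomorphisms and cancel. -/
lemma compat_of_dualObj {G H : Dual k D M} (η : e.dualObj G ⟶ e.dualObj H) (X : V) (m : M) :
    (G.lineator (F.obj X) m).hom ≫ (Dual.nat η).app (F.obj X ⊙ₗ m) =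
      F.obj X ⊴ₗ (Dual.nat η).app m ≫ (H.lineator (F.obj X) m).hom := by
  have h := Dual.nat_compat η X m
  rw [e.dualObj_lineator, e.dualObj_lineator] at h
  simp only [Iso.trans_hom, Functor.mapIso_hom, Iso.symm_hom, Category.assoc] at h
  rw [NatTrans.naturality, reassoc_of% (e.naturality_right X ((Dual.nat η).app m)),
    cancel_epi] at h
  simp only [← Category.assoc] at h
  exact (cancel_mono _).1 h

/-- Compatibility with the objects `F X` is given. It passes to retracts by naturality of the
lineators in the acting object, and surjectivity makes every `d` such a retract. -/
lemma full_dualFunctor (hF : IsSurjective F) : (e.dualFunctor (k := k)).Full where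
  map_surjective {G H} η := by
    let θ : G.functor ⟶ H.functor := Dual.nat (F := e.dualObj G) (G := e.dualObj H) η
    refine ⟨Dual.mkHom (F := G) (G := H) θ fun d m => ?_, rfl⟩
    obtain ⟨X, ⟨r⟩⟩ := hF d
    have h1 : r.i ⊵ₗ m ≫ r.r ⊵ₗ m = 𝟙 (d ⊙ₗ m) := by
      rw [← MonoidalLeftAction.comp_actionHomLeft, r.retract, MonoidalLeftAction.id_actionHomLeft]
    have h2 : θ.app (d ⊙ₗ m) = G.functor.map (r.i ⊵ₗ m) ≫
        θ.app (F.obj X ⊙ₗ m) ≫ H.functor.map (r.r ⊵ₗ m) := by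
      rw [← NatTrans.naturality, ← G.functor.map_comp_assoc, h1, G.functor.map_id,
        Category.id_comp]
    have h3 : (G.lineator (F.obj X) m).hom ≫ θ.app (F.obj X ⊙ₗ m) =
        F.obj X ⊴ₗ θ.app m ≫ (H.lineator (F.obj X) m).hom := compat_of_dualObj e η X m
    rw [h2, ← reassoc_of% (G.lineator_naturality_left r.i m), reassoc_of% h3,
      ← H.lineator_naturality_left, MonoidalLeftAction.action_exchange_assoc,
      ← MonoidalLeftAction.comp_actionHomLeft_assoc, r.retract,
      MonoidalLeftAction.id_actionHomLeft, Category.id_comp]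

end

/-! ### Objects commuting with a pulled back action -/

section

variable {C : Type w} [Category.{v} C] [MonoidalCategory C] [Preadditive C] [Linear k C]
  [MonoidalLeftAction C M] [IsLinearAction k C M] (S : D ⥤ Dual k C M) [S.Monoidal]

/-- The action of an object `c` commutes with the pulled back action. -/
@[reducible]
def liftObj (c : C) :
    letI := pullAction S
    Dual k D M :=
  letI := pullAction S
  { functor := actFunctor c
    additive := actFunctor_additive k c
    linear := actFunctor_linear k c
    -- `S d` is a `C`-module functor by construction; its structure, read backwards, says that `c`
    -- commutes with `d`.
    leftLinear := Dual.leftLinearOfIso _ (fun d m => ((S.obj d).lineator c m).symm)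
      (fun {d d'} f m => by
        rw [Iso.symm_hom, Iso.symm_hom, Iso.comp_inv_eq, Category.assoc, Iso.eq_inv_comp]
        exact Dual.nat_compat (S.map f) c m)
      (fun d m n f => by
        rw [Iso.symm_hom, Iso.symm_hom, Iso.comp_inv_eq, Category.assoc, Iso.eq_inv_comp]
        exact (Dual.lineator_naturality_right (S.obj d) c f).symm)
      (fun d d' m => by
        have h := Dual.nat_compat (δ S d d') c m
        rw [Iso.symm_hom, Iso.inv_comp_eq]
        change c ⊴ₗ (Dual.nat (δ S d d')).app m = _ ≫ (Dual.nat (δ S d d')).app _ ≫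
          (S.obj d).functor.map ((S.obj d').lineator c m).inv ≫
            ((S.obj d).lineator c _).inv
        rw [reassoc_of% h]
        change _ = _ ≫ ((S.obj d).lineator c _ ≪≫ (S.obj d).functor.mapIso
          ((S.obj d').lineator c m)).hom ≫ ((S.obj d).lineator c _ ≪≫ (S.obj d).functor.mapIso
          ((S.obj d').lineator c m)).inv
        rw [Iso.hom_inv_id]
        exact (Category.comp_id _).symm)
      (fun m => by
        have h := Dual.nat_compat (η S) c m
        rw [Iso.symm_hom, Iso.eq_inv_comp]
        exact h.trans (Category.comp_id _)) }

lemma liftObj_lineator (c : C) (d : D) (m : M) :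
    letI := pullAction S
    (liftObj S c).lineator d m = ((S.obj d).lineator c m).symm := rfl

end

/-! ### The factorization -/

section

variable (P : ObjectProperty (Dual k V M)) [P.IsMonoidal] {F : V ⥤ D} [F.Monoidal]
  (S : D ⥤ Dual k P.FullSubcategory M) [S.Monoidal] (Ψ : eval P ≅ F ⋙ S)
  (hμ : ∀ X Y, (Ψ.hom.app X ⊗ₘ Ψ.hom.app Y) ≫ μ S (F.obj X) (F.obj Y) ≫ S.map (μ F X Y) =
    μ (eval P) X Y ≫ Ψ.hom.app (X ⊗ Y))
  (hε : ε (eval P) ≫ Ψ.hom.app (𝟙_ V) = ε S ≫ S.map (ε F))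

include hμ in
-- The monoidality of `Ψ` rewritten for the inverse constraints, which are the ones appearing in the
-- associativity isomorphism of an action.
lemma hom_app_δ (X Y : V) : Ψ.hom.app (X ⊗ Y) ≫ S.map (δ F X Y) ≫ δ S (F.obj X) (F.obj Y) =
    δ (eval P) X Y ≫ (Ψ.hom.app X ⊗ₘ Ψ.hom.app Y) := by
  rw [← cancel_epi (μ (eval P) X Y), ← reassoc_of% hμ, Functor.Monoidal.μ_δ_assoc,
    ← S.map_comp_assoc, Functor.Monoidal.μ_δ, S.map_id, Category.id_comp, Functor.Monoidal.μ_δ,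
    Category.comp_id]

include hε in
lemma hom_app_η : Ψ.hom.app (𝟙_ V) ≫ S.map (η F) ≫ η S = η (eval P) := by
  rw [← cancel_epi (ε (eval P)), reassoc_of% hε, ← S.map_comp_assoc, Functor.Monoidal.ε_η,
    S.map_id, Category.id_comp, Functor.Monoidal.ε_η, Functor.Monoidal.ε_η]

include hμ hε in
/-- The action of `V` factors through a tensor functor `F` if the evaluation functor does. -/
@[reducible]
def factorsOfIso :
    letI := pullAction S
    FactorsThrough F M :=
  letI := pullAction S
  { iso := fun X m => Dual.appIso (Ψ.app X) m
    naturality_left := fun f m => Dual.congr_app (Ψ.hom.naturality f) m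
    naturality_right := fun X _ _ f => (Dual.nat (Ψ.hom.app X)).naturality f
    associativity := fun X Y m => by
      have h := Dual.congr_app (hom_app_δ P S Ψ hμ X Y) m
      exact h.trans (congrArg ((αₗ X Y m).hom ≫ ·)
        ((Dual.nat (Ψ.hom.app X)).naturality _).symm)
    unitality := fun m => Dual.congr_app (hom_app_η P S Ψ hε) m }

lemma eq_hom_of_inv_comp_eq {w x y z : M} (l : w ≅ x) (L : y ≅ z) {f : w ⟶ z} {g : x ⟶ y}
    {g' : y ⟶ x} (h : l.inv ≫ f = g ≫ L.hom) (hg : g ≫ g' = 𝟙 x) : f ≫ L.inv ≫ g' = l.hom := by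
  rw [← cancel_epi l.inv, reassoc_of% h, Iso.hom_inv_id_assoc, hg, Iso.inv_hom_id]

/-- Restricting the lift of an object along `F` gives back the object. -/
def dualObjLiftIso (c : P.FullSubcategory) :
    letI := pullAction S
    (factorsOfIso P S Ψ hμ hε).dualObj (liftObj S c) ≅ c.obj :=
  letI := pullAction S
  Dual.mkIso (F := (factorsOfIso P S Ψ hμ hε).dualObj (liftObj S c)) (G := c.obj)
    (Iso.refl c.obj.functor) fun X m => by
    -- `Ψ X` is a morphism of `C`-module functors. Read as a statement about `c`, this says that
    -- transporting the lifted structure along `Ψ` returns the original `V`-module structure of `c`.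
    have h := Dual.nat_compat (Ψ.hom.app X) c m
    change (c.obj.lineator X m).inv ≫ (Dual.nat (Ψ.hom.app X)).app (c.obj.functor.obj m) =
      c.obj.functor.map ((Dual.nat (Ψ.hom.app X)).app m) ≫
        ((S.obj (F.obj X)).lineator c m).hom at h
    have key : (Dual.nat (Ψ.hom.app X)).app (c.obj.functor.obj m) ≫
        ((S.obj (F.obj X)).lineator c m).inv ≫
          c.obj.functor.map ((Dual.nat (Ψ.inv.app X)).app m) = (c.obj.lineator X m).hom := by
      refine eq_hom_of_inv_comp_eq (c.obj.lineator X m) ((S.obj (F.obj X)).lineator c m) h ?_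
      exact (c.obj.functor.map_comp _ _).symm.trans
        ((congrArg c.obj.functor.map (Dual.appIso (Ψ.app X) m).hom_inv_id).trans
          (c.obj.functor.map_id _))
    refine (Category.comp_id _).trans (key.trans ?_)
    exact ((congrArg (· ≫ (c.obj.lineator X m).hom)
      (MonoidalLeftAction.actionHomRight_id X (c.obj.functor.obj m))).trans (Category.id_comp _)).symm

end

end

end

section

/-! ### Retracts of powers of faithful semisimple modules -/

section

variable {R : Type*} [Ring R] {W V : Type*} [AddCommGroup W] [Module R W] [AddCommGroup V]
  [Module R V] [IsSemisimpleModule R W]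

/-- If `W` is semisimple, and `V` is finitely generated and annihilated by the annihilator of a
finite family in `W`, then `V` is a retract of a power of `W`. -/
lemma exists_retract_of_annihilator {d e : ℕ} (w : Fin d → W) (v : Fin e → V)
    (hv : ∀ x : V, ∃ r : Fin e → R, x = ∑ i, r i • v i)
    (h : ∀ r : R, (∀ i, r • w i = 0) → ∀ x : V, r • x = 0) :
    ∃ (i : V →ₗ[R] (Fin e → Fin d → W)) (p : (Fin e → Fin d → W) →ₗ[R] V),
      p ∘ₗ i = LinearMap.id := by
  let f : (Fin e → R) →ₗ[R] V :=
    { toFun := fun r => ∑ i, r i • v i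
      map_add' := fun r s => by simp [add_smul, Finset.sum_add_distrib]
      map_smul' := fun c r => by simp [mul_smul, Finset.smul_sum] }
  let g : (Fin e → R) →ₗ[R] (Fin e → Fin d → W) :=
    { toFun := fun r i j => r i • w j
      map_add' := fun r s => by ext; simp [add_smul]
      map_smul' := fun c r => by ext; simp [mul_smul] }
  -- `f` presents `V`, and `g` evaluates coefficients on the family in `W`. The annihilator
  -- condition makes `f` factor through the range of `g`, a submodule of a semisimple module; such a
  -- range is a retract of the power, and surjections from it split.
  have hfg : LinearMap.ker g ≤ LinearMap.ker f := fun r hr => by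
    rw [LinearMap.mem_ker] at hr ⊢
    change ∑ i, r i • v i = 0
    exact Finset.sum_eq_zero fun i _ => h _ (fun j => congrFun (congrFun hr i) j) _
  let f' : LinearMap.range g →ₗ[R] V :=
    ((LinearMap.ker g).liftQ f hfg) ∘ₗ g.quotKerEquivRange.symm.toLinearMap
  have hf' : Function.Surjective f' := fun x => by
    obtain ⟨r, rfl⟩ := hv x
    refine ⟨g.quotKerEquivRange (Submodule.Quotient.mk r), ?_⟩
    simp only [f', LinearMap.comp_apply, LinearEquiv.coe_coe, LinearEquiv.symm_apply_apply]
    rfl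
  obtain ⟨s, hs⟩ := IsSemisimpleModule.lifting_property f' hf' LinearMap.id
  obtain ⟨q, hq⟩ := IsSemisimpleModule.extension_property (LinearMap.range g).subtype
    (Submodule.subtype_injective _) LinearMap.id
  refine ⟨(LinearMap.range g).subtype ∘ₗ s, f' ∘ₗ q, ?_⟩
  rw [LinearMap.comp_assoc, ← LinearMap.comp_assoc s, hq, LinearMap.id_comp, hs]

end

/-! ### Decomposing an object whose identity factors through simple objects -/

/-- Gaussian elimination: if the matrix `β a ≫ α b` is not the identity, some `α a₀` is a
combination of the others and can be eliminated. Induct on the number of terms; no splitting of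
idempotents in the ambient category is required. -/
lemma exists_dec_of_id_eq_sum {E : Type u₁} [Category.{v₁} E] [Preadditive E] {ι : Type*}
    {X : ι → E} (hX : ∀ i j (f : X i ⟶ X j), f ≠ 0 → IsIso f) {G : E} {I : Type*} [DecidableEq I]
    (t : I → ι) (α : ∀ a, G ⟶ X (t a)) (s : Finset I) :
    ∀ (β : ∀ a, X (t a) ⟶ G), ∑ a ∈ s, α a ≫ β a = 𝟙 G →
    ∃ (s' : Finset I) (β' : ∀ a, X (t a) ⟶ G), ∑ a ∈ s', α a ≫ β' a = 𝟙 G ∧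
      (∀ a ∈ s', β' a ≫ α a = 𝟙 _) ∧ ∀ a ∈ s', ∀ b ∈ s', a ≠ b → β' a ≫ α b = 0 := by
  induction s using Finset.strongInduction with
  | H s ih =>
    intro β h
    -- The difference between the matrix `β a ≫ α b` and the identity matrix. Each of its columns is
    -- a linear relation among the `α a`, because the given sum is the identity.
    let d : ∀ a b : I, X (t a) ⟶ X (t b) := fun a b =>
      β a ≫ α b - if hab : a = b then eqToHom (by rw [hab]) else 0
    by_cases hd : ∀ a ∈ s, ∀ b ∈ s, d a b = 0
    · refine ⟨s, β, h, fun a ha => ?_, fun a ha b hb hab => ?_⟩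
      · have := hd a ha a ha
        simpa [d, sub_eq_zero] using this
      · have := hd a ha b hb
        simpa [d, hab] using this
    · push Not at hd
      obtain ⟨a₀, ha₀, b, hb, hne⟩ := hd
      have := hX _ _ _ hne
      have hsum : ∑ a ∈ s, α a ≫ d a b = 0 := by
        simp only [d, Preadditive.comp_sub, Finset.sum_sub_distrib]
        rw [Finset.sum_eq_single_of_mem b hb (f := fun a => α a ≫ if hab : a = b then
          eqToHom (by rw [hab]) else 0)]
        · simp only [← Category.assoc]
          rw [← Preadditive.sum_comp, h]
          simp
        · intro a _ hab
          simp [hab]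
      rw [← Finset.add_sum_erase _ _ ha₀] at hsum h
      have h0 : α a₀ = - ∑ a ∈ s.erase a₀, α a ≫ d a b ≫ inv (d a₀ b) := by
        rw [← cancel_mono (d a₀ b), Preadditive.neg_comp, Preadditive.sum_comp]
        simp only [Category.assoc, IsIso.inv_hom_id, Category.comp_id]
        exact eq_neg_of_add_eq_zero_left hsum
      -- Substituting the expression for `α a₀` into the decomposition of the identity changes the
      -- remaining `β a` in this way.
      refine ih _ (Finset.erase_ssubset ha₀) (fun a => β a - d a b ≫ inv (d a₀ b) ≫ β a₀) ?_
      rw [← h]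
      conv_rhs => rw [h0]
      simp only [Preadditive.comp_sub, Finset.sum_sub_distrib, Preadditive.neg_comp,
        Preadditive.sum_comp, Category.assoc]
      abel

/-- An object of a category whose identity factors through objects of a finite semisimple full
subcategory is isomorphic to an object of that subcategory. -/
lemma isoClosure_of_id_eq_sum {k : Type u} [Field k] {E : Type u₁} [Category.{v₁} E]
    [Preadditive E] [Linear k E] (P : ObjectProperty E) (sm : Simples k P.FullSubcategory)
    [HasFiniteBiproducts P.FullSubcategory] {G : E} {I : Type} [Fintype I]
    (t : I → sm.ι) (α : ∀ a, G ⟶ (sm.L (t a)).obj) (β : ∀ a, (sm.L (t a)).obj ⟶ G)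
    (h : ∑ a, α a ≫ β a = 𝟙 G) : P.isoClosure G := by
  classical
  have hX : ∀ i j (f : (sm.L i).obj ⟶ (sm.L j).obj), f ≠ 0 → IsIso f := fun i j f hf => by
    have h0 : P.homMk f ≠ 0 := fun h => hf (congrArg (fun x => x.hom) h)
    have := (sm.isBrick i).isIso sm (sm.isBrick j) h0
    exact inferInstanceAs (IsIso (P.ι.map (P.homMk f)))
  obtain ⟨s, β, h1, h2, h3⟩ := exists_dec_of_id_eq_sum hX t α Finset.univ β h
  let Y : s → P.FullSubcategory := fun a => sm.L (t a)
  refine ⟨(⨁ Y).obj, (⨁ Y).property, ⟨⟨∑ a : s, α a ≫ (biproduct.ι Y a).hom,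
    ∑ a : s, (biproduct.π Y a).hom ≫ β a, ?_, ?_⟩⟩⟩
  · simp only [Preadditive.sum_comp, Preadditive.comp_sum, Category.assoc]
    rw [← h1, ← Finset.sum_coe_sort s (fun a => α a ≫ β a)]
    refine Finset.sum_congr rfl fun a _ => ?_
    rw [Finset.sum_eq_single a]
    · have : (biproduct.ι Y a).hom ≫ (biproduct.π Y a).hom = 𝟙 _ :=
        congrArg (fun x => x.hom) (biproduct.ι_π_self Y a)
      rw [reassoc_of% this]
    · intro b _ hb
      have : (biproduct.ι Y b).hom ≫ (biproduct.π Y a).hom = 0 :=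
        congrArg (fun x => x.hom) (biproduct.ι_π_ne Y hb)
      rw [reassoc_of% this, zero_comp, comp_zero]
    · simp
  · have ht : ∑ a : s, (biproduct.π Y a).hom ≫ (biproduct.ι Y a).hom = 𝟙 _ := by
      have := congrArg (fun x => P.ι.map x) (biproduct.total (f := Y))
      rwa [Functor.map_sum] at this
    simp only [Preadditive.sum_comp, Preadditive.comp_sum, Category.assoc]
    rw [← ht]
    refine Finset.sum_congr rfl fun a _ => ?_
    rw [Finset.sum_eq_single a]
    · rw [reassoc_of% (h2 a a.2)]
    · intro b _ hb
      rw [reassoc_of% (h3 b b.2 a a.2 (fun h => hb (Subtype.ext h))), zero_comp, comp_zero]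
    · simp

end

section

/-! ### Generators -/

section

variable {M : Type u₂} [Category.{v₂} M] [Preadditive M]

/-- The identity of each object is a finite sum of morphisms factoring through `m₀`. -/
def IsGen (m₀ : M) : Prop :=
  ∀ m : M, ∃ (l : ℕ) (u : Fin l → (m ⟶ m₀)) (v : Fin l → (m₀ ⟶ m)), ∑ a, u a ≫ v a = 𝟙 m

lemma Simples.isGen {k : Type u} [Field k] [Linear k M] (sm : Simples k M)
    [HasFiniteBiproducts M] : IsGen (⨁ sm.L) := fun m => by
  classical
  obtain ⟨l, t, p, q, h, -⟩ := sm.exists_dec m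
  exact ⟨l, fun a => p a ≫ biproduct.ι sm.L (t a), fun a => biproduct.π sm.L (t a) ≫ q a, by simpa⟩

namespace IsGen

variable {m₀ : M} (hm : IsGen m₀)
include hm

lemma hom_ext {X Z : M} {f g : X ⟶ Z} (h : ∀ x : m₀ ⟶ X, x ≫ f = x ≫ g) : f = g := by
  obtain ⟨l, u, v, huv⟩ := hm X
  rw [← Category.id_comp f, ← Category.id_comp g, ← huv, Preadditive.sum_comp,
    Preadditive.sum_comp]
  simp only [Category.assoc, h]

lemma map_hom_ext (T : M ⥤ M) [T.Additive] {m Z : M} {f g : T.obj m ⟶ Z}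
    (h : ∀ x : m₀ ⟶ m, T.map x ≫ f = T.map x ≫ g) : f = g := by
  obtain ⟨l, u, v, huv⟩ := hm m
  rw [← Category.id_comp f, ← Category.id_comp g, ← T.map_id, ← huv, T.map_sum,
    Preadditive.sum_comp, Preadditive.sum_comp]
  simp only [T.map_comp, Category.assoc, h]

lemma natTrans_ext {Y Y' : M ⥤ M} [Y.Additive] {η θ : Y ⟶ Y'} (h : η.app m₀ = θ.app m₀) :
    η = θ := by
  ext m
  refine hm.map_hom_ext Y fun x => ?_
  rw [NatTrans.naturality, NatTrans.naturality, h]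

/-- Additive functors are controlled by a generator: the component at `m` is forced to be `∑ Y u ≫
η₀ ≫ Y' v`, and commutation with endomorphisms of `m₀` gives naturality. -/
lemma exists_natTrans {Y Y' : M ⥤ M} [Y.Additive] [Y'.Additive] (η₀ : Y.obj m₀ ⟶ Y'.obj m₀)
    (h : ∀ q : m₀ ⟶ m₀, Y.map q ≫ η₀ = η₀ ≫ Y'.map q) : ∃ η : Y ⟶ Y', η.app m₀ = η₀ := by
  choose l u v huv using hm
  refine ⟨{ app := fun m => ∑ a, Y.map (u m a) ≫ η₀ ≫ Y'.map (v m a)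
            naturality := fun m n f => ?_ }, ?_⟩
  · have h1 : ∀ a b, Y.map (v m a) ≫ Y.map f ≫ Y.map (u n b) ≫ η₀ =
        η₀ ≫ Y'.map (v m a) ≫ Y'.map f ≫ Y'.map (u n b) := fun a b => by
      simp only [← Y.map_comp_assoc, ← Y'.map_comp]
      exact h _
    calc Y.map f ≫ ∑ b, Y.map (u n b) ≫ η₀ ≫ Y'.map (v n b)
        = (∑ a, Y.map (u m a) ≫ Y.map (v m a)) ≫
            Y.map f ≫ ∑ b, Y.map (u n b) ≫ η₀ ≫ Y'.map (v n b) := by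
          simp only [← Y.map_comp, ← Y.map_sum, huv, Y.map_id, Category.id_comp]
      _ = (∑ a, Y.map (u m a) ≫ η₀ ≫ Y'.map (v m a)) ≫ Y'.map f ≫
            ∑ b, Y'.map (u n b) ≫ Y'.map (v n b) := by
          simp only [Preadditive.sum_comp, Preadditive.comp_sum, Category.assoc]
          refine Finset.sum_congr rfl fun b _ => Finset.sum_congr rfl fun a _ => ?_
          have := h1 a b
          simp only [← Category.assoc] at this ⊢
          simp only [Category.assoc] at this ⊢
          rw [reassoc_of% this]
      _ = _ := by
          simp only [← Y'.map_comp, ← Y'.map_sum, huv]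
          rw [Category.comp_id]
  · change ∑ a, Y.map (u m₀ a) ≫ η₀ ≫ Y'.map (v m₀ a) = η₀
    simp only [reassoc_of% h]
    simp only [← Y'.map_comp]
    rw [← Preadditive.comp_sum, ← Y'.map_sum, huv, Y'.map_id, Category.comp_id]

/-- Compatibility with precomposition makes `τ` postcomposition with a single morphism `η₀`, by
expanding the identity of `Y m₀` through `m₀`; compatibility with `Y q` makes `η₀` commute with
endomorphisms. -/
lemma exists_natTrans_of_addHom {Y Y' : M ⥤ M} [Y.Additive] [Y'.Additive]
    (τ : (m₀ ⟶ Y.obj m₀) →+ (m₀ ⟶ Y'.obj m₀)) (hp : ∀ (p : m₀ ⟶ m₀) x, τ (p ≫ x) = p ≫ τ x)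
    (hq : ∀ (q : m₀ ⟶ m₀) x, τ (x ≫ Y.map q) = τ x ≫ Y'.map q) :
    ∃ η : Y ⟶ Y', ∀ x, x ≫ η.app m₀ = τ x := by
  obtain ⟨l, s, t, hst⟩ := hm (Y.obj m₀)
  let η₀ : Y.obj m₀ ⟶ Y'.obj m₀ := ∑ a, s a ≫ τ (t a)
  have hη₀ : ∀ x, x ≫ η₀ = τ x := fun x => by
    simp only [η₀, Preadditive.comp_sum]
    simp only [← Category.assoc, ← hp, ← map_sum]
    simp only [Category.assoc]
    rw [← Preadditive.comp_sum, hst, Category.comp_id]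
  obtain ⟨η, hη⟩ := hm.exists_natTrans (Y := Y) (Y' := Y') η₀ fun q =>
    hm.hom_ext fun x => by
      rw [← Category.assoc, hη₀, hq, reassoc_of% (hη₀ x)]
  exact ⟨η, fun x => by rw [hη, hη₀]⟩

end IsGen

end

/-! ### The operators defined by the action -/

section

variable {k : Type u} [Field k] {M : Type u₂} [Category.{v₂} M] [Preadditive M] [Linear k M]
  {D : Type u₃} [Category.{v₃} D] [MonoidalCategory D] [Preadditive D] [Linear k D]
  [MonoidalLeftAction D M] [IsLinearAction k D M]

namespace Dual

/-- The operator on `m₀ ⟶ Y m₀` given by an object `d` and morphisms `p : m₀ ⟶ d ⊙ m₀`,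
`q : d ⊙ m₀ ⟶ m₀`. -/
def op {m₀ : M} (d : D) (p : m₀ ⟶ d ⊙ₗ m₀) (q : d ⊙ₗ m₀ ⟶ m₀) (Y : Dual k D M) :
    Module.End k (m₀ ⟶ Y.functor.obj m₀) where
  toFun x := p ≫ d ⊴ₗ x ≫ (Y.lineator d m₀).hom ≫ Y.functor.map q
  map_add' x y := by
    rw [IsLinearAction.actionHomRight_add k, Preadditive.add_comp, Preadditive.comp_add]
  map_smul' c x := by
    rw [IsLinearAction.actionHomRight_smul, Linear.smul_comp, Linear.comp_smul]
    rfl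

variable {m₀ : M}

lemma op_apply (d : D) (p : m₀ ⟶ d ⊙ₗ m₀) (q : d ⊙ₗ m₀ ⟶ m₀) (Y : Dual k D M)
    (x : m₀ ⟶ Y.functor.obj m₀) :
    op d p q Y x = p ≫ d ⊴ₗ x ≫ (Y.lineator d m₀).hom ≫ Y.functor.map q := rfl

/-- The operators for the unit object are the two actions of `End m₀`, so commuting with all
operators includes `End m₀`-bilinearity. -/
lemma op_unit (p q : m₀ ⟶ m₀) (Y : Dual k D M) (x : m₀ ⟶ Y.functor.obj m₀) :
    op (𝟙_ D) (p ≫ (λₗ[D] m₀).inv) ((λₗ[D] m₀).hom ≫ q) Y x = p ≫ x ≫ Y.functor.map q := by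
  have h := Functor.LaxLeftLinear.μₗ_unitality (C := D) Y.functor m₀
  rw [op_apply, Y.functor.map_comp, Category.assoc]
  rw [lineator_hom, ← reassoc_of% h, ← MonoidalLeftAction.actionUnitIso_hom_naturality_assoc,
    Iso.inv_hom_id_assoc]

/-- Operators multiply by tensoring the acting objects, so their linear span is already an algebra.
-/
lemma op_op (d d' : D) (p : m₀ ⟶ d ⊙ₗ m₀) (q : d ⊙ₗ m₀ ⟶ m₀) (p' : m₀ ⟶ d' ⊙ₗ m₀)
    (q' : d' ⊙ₗ m₀ ⟶ m₀) (Y : Dual k D M) (x : m₀ ⟶ Y.functor.obj m₀) :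
    op d p q Y (op d' p' q' Y x) = op (d ⊗ d') (p ≫ d ⊴ₗ p' ≫ (αₗ d d' m₀).inv)
      ((αₗ d d' m₀).hom ≫ d ⊴ₗ q' ≫ q) Y x := by
  have h := Functor.LaxLeftLinear.μₗ_associativity (C := D) Y.functor d d' m₀
  simp only [op_apply, MonoidalLeftAction.actionHomRight_comp, Functor.map_comp, Category.assoc]
  rw [reassoc_of% (lineator_naturality_right Y d q')]
  simp only [lineator_hom]
  rw [reassoc_of% h]
  simp

lemma op_comp_nat {Y Y' : Dual k D M} (η : Y ⟶ Y') (d : D) (p : m₀ ⟶ d ⊙ₗ m₀)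
    (q : d ⊙ₗ m₀ ⟶ m₀) (x : m₀ ⟶ Y.functor.obj m₀) :
    op d p q Y' (x ≫ (nat η).app m₀) = op d p q Y x ≫ (nat η).app m₀ := by
  simp only [op_apply, MonoidalLeftAction.actionHomRight_comp, Category.assoc,
    NatTrans.naturality]
  rw [reassoc_of% (nat_compat η d m₀)]

lemma compat_of_gen (hm : IsGen m₀) {Y Y' : Dual k D M} (η : Y.functor ⟶ Y'.functor) (d : D)
    (h : (Y.lineator d m₀).hom ≫ η.app (d ⊙ₗ m₀) = d ⊴ₗ η.app m₀ ≫ (Y'.lineator d m₀).hom) (m : M) :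
    (Y.lineator d m).hom ≫ η.app (d ⊙ₗ m) = d ⊴ₗ η.app m ≫ (Y'.lineator d m).hom := by
  have := actFunctor_additive (M := M) k d
  refine hm.map_hom_ext (Y.functor ⋙ actFunctor d) fun x => ?_
  change d ⊴ₗ Y.functor.map x ≫ _ = d ⊴ₗ Y.functor.map x ≫ _
  rw [reassoc_of% (lineator_naturality_right Y d x), NatTrans.naturality, reassoc_of% h,
    ← lineator_naturality_right, ← MonoidalLeftAction.actionHomRight_comp_assoc,
    ← MonoidalLeftAction.actionHomRight_comp_assoc, NatTrans.naturality]

/-- The operators for the unit object yield a natural transformation. The remaining ones test its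
module compatibility at `m₀` against all `t`, `p` and `u a`, which suffices because `m₀` generates.
-/
lemma exists_hom (hm : IsGen m₀) {Y Y' : Dual k D M}
    (τ : (m₀ ⟶ Y.functor.obj m₀) →ₗ[k] (m₀ ⟶ Y'.functor.obj m₀))
    (h : ∀ (d : D) (p : m₀ ⟶ d ⊙ₗ m₀) (q : d ⊙ₗ m₀ ⟶ m₀) x, τ (op d p q Y x) = op d p q Y' (τ x)) :
    ∃ η : Y ⟶ Y', ∀ x, x ≫ (nat η).app m₀ = τ x := by
  have hp : ∀ (p : m₀ ⟶ m₀) x, τ (p ≫ x) = p ≫ τ x := fun p x => by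
    have := h (𝟙_ D) (p ≫ (λₗ[D] m₀).inv) ((λₗ[D] m₀).hom ≫ 𝟙 m₀) x
    rwa [op_unit, op_unit, Y.functor.map_id, Y'.functor.map_id, Category.comp_id,
      Category.comp_id] at this
  have hq : ∀ (q : m₀ ⟶ m₀) x, τ (x ≫ Y.functor.map q) = τ x ≫ Y'.functor.map q := fun q x => by
    have := h (𝟙_ D) (𝟙 m₀ ≫ (λₗ[D] m₀).inv) ((λₗ[D] m₀).hom ≫ q) x
    rwa [op_unit, op_unit, Category.id_comp, Category.id_comp] at this
  obtain ⟨η, hη⟩ := hm.exists_natTrans_of_addHom τ.toAddMonoidHom hp hq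
  replace hη : ∀ x, x ≫ η.app m₀ = τ x := hη
  refine ⟨mkHom η fun d m => compat_of_gen hm η d ?_ m, hη⟩
  have := actFunctor_additive (M := M) k d
  refine hm.map_hom_ext (actFunctor d) fun t => hm.hom_ext fun p => ?_
  obtain ⟨l, u, v, huv⟩ := hm (d ⊙ₗ m₀)
  have hfun : 𝟙 (Y'.functor.obj (d ⊙ₗ m₀)) = ∑ a, Y'.functor.map (u a) ≫ Y'.functor.map (v a) := by
    rw [← Y'.functor.map_id, ← huv, Functor.map_sum]
    simp only [Functor.map_comp]
  rw [← Category.comp_id ((Y.lineator d m₀).hom ≫ η.app (d ⊙ₗ m₀)),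
    ← Category.comp_id (d ⊴ₗ η.app m₀ ≫ (Y'.lineator d m₀).hom), hfun]
  simp only [Preadditive.comp_sum, Category.assoc]
  refine Finset.sum_congr rfl fun a _ => ?_
  have h1 := h d p (u a) t
  simp only [op_apply] at h1
  rw [← hη, ← hη] at h1
  simp only [Category.assoc, NatTrans.naturality, MonoidalLeftAction.actionHomRight_comp] at h1
  change p ≫ d ⊴ₗ t ≫ _ = p ≫ d ⊴ₗ t ≫ _
  rw [← NatTrans.naturality_assoc]
  simp only [← Category.assoc] at h1 ⊢
  simp only [Category.assoc, NatTrans.naturality] at h1 ⊢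
  simp only [← Category.assoc] at h1 ⊢
  rw [h1]

/-- The family of operators given by `d`, `p`, `q`. -/
def opFamily (k : Type u) [Field k] [Linear k M] [Linear k D] [IsLinearAction k D M] {m₀ : M} (d : D)
    (p : m₀ ⟶ d ⊙ₗ m₀) (q : d ⊙ₗ m₀ ⟶ m₀) :
    ∀ Y : Dual k D M, Module.End k (m₀ ⟶ Y.functor.obj m₀) := op d p q

variable (k D m₀) in
/-- The algebra generated by the operators on the spaces `m₀ ⟶ Y m₀`. -/
def opAlg : Subalgebra k (∀ Y : Dual k D M, Module.End k (m₀ ⟶ Y.functor.obj m₀)) :=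
  (Submodule.span k {f | ∃ (d : D) (p : m₀ ⟶ d ⊙ₗ m₀) (q : d ⊙ₗ m₀ ⟶ m₀),
      f = opFamily k d p q}).toSubalgebra
    (Submodule.subset_span ⟨𝟙_ D, 𝟙 m₀ ≫ (λₗ[D] m₀).inv, (λₗ[D] m₀).hom ≫ 𝟙 m₀,
      funext fun Y => LinearMap.ext fun x => by
        change x = op _ _ _ Y x
        rw [op_unit, Y.functor.map_id, Category.id_comp, Category.comp_id]⟩)
    fun f g hf hg => by
      have := Submodule.mul_mem_mul hf hg
      rw [Submodule.span_mul_span] at this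
      refine Submodule.span_mono ?_ this
      rintro _ ⟨_, ⟨d, p, q, rfl⟩, _, ⟨d', p', q', rfl⟩, rfl⟩
      exact ⟨_, _, _, funext fun Y => LinearMap.ext fun x => op_op d d' p q p' q' Y x⟩

lemma opFamily_mem (d : D) (p : m₀ ⟶ d ⊙ₗ m₀) (q : d ⊙ₗ m₀ ⟶ m₀) :
    opFamily k d p q ∈ opAlg k D m₀ := Submodule.subset_span ⟨d, p, q, rfl⟩

variable (m₀) in
/-- The space `m₀ ⟶ Y m₀`, as a module over the algebra of operators. -/
def Fiber (Y : Dual k D M) : Type v₂ := m₀ ⟶ Y.functor.obj m₀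

instance (Y : Dual k D M) : AddCommGroup (Fiber m₀ Y) :=
  inferInstanceAs (AddCommGroup (m₀ ⟶ Y.functor.obj m₀))

instance (Y : Dual k D M) : Module k (Fiber m₀ Y) :=
  inferInstanceAs (Module k (m₀ ⟶ Y.functor.obj m₀))

instance (Y : Dual k D M) : Module (opAlg k D m₀) (Fiber m₀ Y) :=
  letI : Module (Module.End k (m₀ ⟶ Y.functor.obj m₀)) (Fiber m₀ Y) :=
    inferInstanceAs (Module (Module.End k (m₀ ⟶ Y.functor.obj m₀)) (m₀ ⟶ Y.functor.obj m₀))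
  Module.compHom (Fiber m₀ Y)
    ((Pi.evalRingHom (fun Y : Dual k D M => Module.End k (m₀ ⟶ Y.functor.obj m₀)) Y).comp
      (opAlg k D m₀).val.toRingHom)

instance (Y : Dual k D M) : IsScalarTower k (opAlg k D m₀) (Fiber m₀ Y) :=
  ⟨fun _ _ _ => rfl⟩

end Dual

end

end

section

section

variable {k : Type u} [Field k] {M : Type u₂} [Category.{v₂} M] [Preadditive M] [Linear k M]
  {D : Type u₃} [Category.{v₃} D] [MonoidalCategory D] [Preadditive D] [Linear k D]
  [MonoidalLeftAction D M] [IsLinearAction k D M]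

variable (k) in
include k in
lemma id_act_eq_sum {d : D} {l : ℕ} {e : Fin l → D} {u : ∀ a, d ⟶ e a} {v : ∀ a, e a ⟶ d}
    (h : ∑ a, u a ≫ v a = 𝟙 d) (n : M) : 𝟙 (d ⊙ₗ n) = ∑ a, u a ⊵ₗ n ≫ v a ⊵ₗ n := by
  let T : (d ⟶ d) →+ (d ⊙ₗ n ⟶ d ⊙ₗ n) :=
    { toFun := fun f => f ⊵ₗ n
      map_zero' := by
        have := IsLinearAction.actionHomLeft_smul (M := M) (0 : k) (0 : d ⟶ d) n
        simpa using this
      map_add' := fun f g => IsLinearAction.actionHomLeft_add k f g n }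
  have := congrArg T h
  rw [map_sum] at this
  simp only [T, AddMonoidHom.coe_mk, ZeroHom.coe_mk, MonoidalLeftAction.comp_actionHomLeft,
    MonoidalLeftAction.id_actionHomLeft] at this
  exact this.symm

namespace Dual

/-! ### Transport of natural transformations along the action -/

/-- `σ` corresponds to `ρ` under the action of `d`. -/
def Rel (d : D) {Y : Dual k D M} (ρ σ : Y.functor ⟶ Y.functor) : Prop :=
  ∀ m, (Y.lineator d m).hom ≫ σ.app (d ⊙ₗ m) = d ⊴ₗ ρ.app m ≫ (Y.lineator d m).hom

namespace Rel

variable {Y : Dual k D M} {ρ σ τ : Y.functor ⟶ Y.functor}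

/-- The relation is checked on pieces through which the identity of `d` decomposes; for `Vec_B^ω`
this reduces everything to lines. -/
lemma of_id_eq_sum {d : D} {l : ℕ} {e : Fin l → D} {u : ∀ a, d ⟶ e a} {v : ∀ a, e a ⟶ d}
    (h : ∑ a, u a ≫ v a = 𝟙 d) (hr : ∀ a, Rel (e a) ρ σ) : Rel d ρ σ := fun m => by
  have hsum : ∀ n : M, 𝟙 (d ⊙ₗ n) = ∑ a, u a ⊵ₗ n ≫ v a ⊵ₗ n := fun n =>
    id_act_eq_sum k h n
  rw [← Category.id_comp ((Y.lineator d m).hom ≫ _), hsum, ← Category.comp_id (d ⊴ₗ ρ.app m),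
    hsum, Preadditive.sum_comp, Preadditive.comp_sum, Preadditive.sum_comp]
  refine Finset.sum_congr rfl fun a _ => ?_
  rw [Category.assoc, reassoc_of% (lineator_naturality_left Y (v a) m), NatTrans.naturality,
    reassoc_of% (hr a m), ← lineator_naturality_left, MonoidalLeftAction.action_exchange_assoc]
  simp only [Category.assoc]
  rw [MonoidalLeftAction.action_exchange_assoc, MonoidalLeftAction.action_exchange_assoc]

lemma of_iso {d d' : D} (e : d ≅ d') (h : Rel d ρ σ) : Rel d' ρ σ :=
  of_id_eq_sum (l := 1) (e := fun _ => d) (u := fun _ => e.inv) (v := fun _ => e.hom) (by simp)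
    fun _ => h

lemma tensor {d d' : D} (h : Rel d ρ σ) (h' : Rel d' σ τ) : Rel (d' ⊗ d) ρ τ := fun m => by
  have ha := Functor.LaxLeftLinear.μₗ_associativity (C := D) Y.functor d' d m
  simp only [← lineator_hom] at ha
  rw [← cancel_mono (Y.functor.map (αₗ d' d m).hom)]
  simp only [Category.assoc]
  rw [← NatTrans.naturality, reassoc_of% ha, h' (d ⊙ₗ m), ha,
    ← MonoidalLeftAction.actionHomRight_comp_assoc, h m]
  simp

variable (Y ρ) in
lemma unit : Rel (𝟙_ D) ρ ρ := fun m => by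
  have ha := Functor.LaxLeftLinear.μₗ_unitality (C := D) Y.functor m
  rw [← lineator_hom] at ha
  rw [← cancel_mono (Y.functor.map (λₗ[D] m).hom)]
  simp only [Category.assoc]
  rw [← NatTrans.naturality, ← reassoc_of% ha, ← ha,
    ← MonoidalLeftAction.actionUnitIso_hom_naturality]

lemma sum {d : D} {I : Type*} {s : Finset I} {ρ σ : I → (Y.functor ⟶ Y.functor)}
    (h : ∀ i ∈ s, Rel d (ρ i) (σ i)) : Rel d (∑ i ∈ s, ρ i) (∑ i ∈ s, σ i) := fun m => by
  rw [NatTrans.app_sum, NatTrans.app_sum, act_sum k, Preadditive.comp_sum, Preadditive.sum_comp]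
  exact Finset.sum_congr rfl fun i hi => h i hi m

lemma smul {d : D} (c : k) (h : Rel d ρ σ) : Rel d (c • ρ) (c • σ) := fun m => by
  rw [NatTrans.app_smul, NatTrans.app_smul, IsLinearAction.actionHomRight_smul, Linear.comp_smul,
    Linear.smul_comp, h m]

/-- The relation prescribes `σ` on objects `d ⊙ m`; since `d` acts by an equivalence, whiskering
with it is fully faithful and `σ` extends, uniquely, to all objects. This conjugation is insensitive
to scalars, so the cocycle leaves no trace in it. -/
lemma exists_of_isEquivalence {d : D} (hd : (actFunctor (M := M) d).IsEquivalence)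
    (ρ : Y.functor ⟶ Y.functor) : ∃ σ, Rel d ρ σ := by
  let θ : actFunctor d ⋙ Y.functor ⟶ actFunctor d ⋙ Y.functor :=
    { app := fun m => (Y.lineator d m).inv ≫ d ⊴ₗ ρ.app m ≫ (Y.lineator d m).hom
      naturality := fun m n f => by
        change Y.functor.map (d ⊴ₗ f) ≫ _ = _ ≫ Y.functor.map (d ⊴ₗ f)
        have h1 : Y.functor.map (d ⊴ₗ f) ≫ (Y.lineator d n).inv =
            (Y.lineator d m).inv ≫ d ⊴ₗ Y.functor.map f := by
          rw [Iso.comp_inv_eq, Category.assoc, lineator_naturality_right, Iso.inv_hom_id_assoc]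
        rw [reassoc_of% h1, Category.assoc, Category.assoc, ← lineator_naturality_right,
          ← MonoidalLeftAction.actionHomRight_comp_assoc,
          ← MonoidalLeftAction.actionHomRight_comp_assoc, NatTrans.naturality] }
  refine ⟨((Functor.whiskeringLeft M M M).obj (actFunctor d)).preimage θ, fun m => ?_⟩
  have h := NatTrans.congr_app
    (((Functor.whiskeringLeft M M M).obj (actFunctor d)).map_preimage θ) m
  change NatTrans.app _ (d ⊙ₗ m) = (Y.lineator d m).inv ≫ d ⊴ₗ ρ.app m ≫ (Y.lineator d m).hom at h
  rw [h, Iso.hom_inv_id_assoc]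

lemma unique {d : D} (hd : (actFunctor (M := M) d).IsEquivalence) (h : Rel d ρ σ)
    (h' : Rel d ρ τ) : σ = τ := by
  refine ((Functor.whiskeringLeft M M M).obj (actFunctor d)).map_injective ?_
  ext m
  change σ.app (d ⊙ₗ m) = τ.app (d ⊙ₗ m)
  rw [← cancel_epi (Y.lineator d m).hom, h m, h' m]

end Rel

end Dual

/-! ### Invertible objects and averaging over the group -/

/-- Invertible objects indexed by a group, generating the category. -/
structure InvertibleFamily (D : Type u₃) [Category.{v₃} D] [MonoidalCategory D] [Preadditive D]
    (B : Type w) [Group B] where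
  obj : B → D
  mul : ∀ b c, obj b ⊗ obj c ≅ obj (b * c)
  one : 𝟙_ D ≅ obj 1
  exists_dec : ∀ d : D, ∃ (l : ℕ) (b : Fin l → B) (u : ∀ a, d ⟶ obj (b a)) (v : ∀ a, obj (b a) ⟶ d),
    ∑ a, u a ≫ v a = 𝟙 d

lemma isEquivalence_actFunctor {d d' : D} (e : d ⊗ d' ≅ 𝟙_ D) (e' : d' ⊗ d ≅ 𝟙_ D) :
    (actFunctor (M := M) d).IsEquivalence := by
  have key : ∀ {d d' : D} (_ : d' ⊗ d ≅ 𝟙_ D),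
      Nonempty (actFunctor (M := M) d ⋙ actFunctor d' ≅ 𝟭 M) := fun {d d'} e =>
    ⟨NatIso.ofComponents (fun m => (αₗ d' d m).symm ≪≫
      ⟨e.hom ⊵ₗ m, e.inv ⊵ₗ m, by simp, by simp⟩ ≪≫ λₗ[D] m) fun {m n} f => by
        change d' ⊴ₗ d ⊴ₗ f ≫ (αₗ d' d n).inv ≫ e.hom ⊵ₗ n ≫ (λₗ[D] n).hom =
          ((αₗ d' d m).inv ≫ e.hom ⊵ₗ m ≫ (λₗ[D] m).hom) ≫ f
        have h1 : d' ⊴ₗ d ⊴ₗ f ≫ (αₗ d' d n).inv = (αₗ d' d m).inv ≫ (d' ⊗ d) ⊴ₗ f := by simp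
        rw [reassoc_of% h1, MonoidalLeftAction.action_exchange_assoc,
          ← MonoidalLeftAction.actionUnitIso_hom_naturality]
        simp only [Category.assoc]⟩
  exact (CategoryTheory.Equivalence.mk (actFunctor d) (actFunctor d') (key e').some.symm
    (key e).some).isEquivalence_functor

namespace InvertibleFamily

variable {B : Type w} [Group B] (I : InvertibleFamily D B)

lemma isEquivalence (b : B) : (actFunctor (M := M) (I.obj b)).IsEquivalence :=
  isEquivalence_actFunctor (I.mul b b⁻¹ ≪≫ eqToIso (by rw [mul_inv_cancel]) ≪≫ I.one.symm)
    (I.mul b⁻¹ b ≪≫ eqToIso (by rw [inv_mul_cancel]) ≪≫ I.one.symm)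

open TensorCat.Dual

lemma rel_mul {Y : Dual k D M} {ρ σ τ : Y.functor ⟶ Y.functor} {b c : B} (h : Rel (I.obj b) ρ σ)
    (h' : Rel (I.obj c) σ τ) : Rel (I.obj (c * b)) ρ τ := (h.tensor h').of_iso (I.mul c b)

lemma rel_inv {Y : Dual k D M} {ρ σ : Y.functor ⟶ Y.functor} {b : B} (h : Rel (I.obj b) ρ σ) :
    Rel (I.obj b⁻¹) σ ρ := by
  obtain ⟨τ, hτ⟩ := Rel.exists_of_isEquivalence (I.isEquivalence b⁻¹) σ
  have h1 := I.rel_mul h hτ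
  rw [inv_mul_cancel] at h1
  rwa [Rel.unique (I.isEquivalence 1) h1 ((Rel.unit Y ρ).of_iso I.one)] at hτ

/-- The average of the transforms of a natural transformation. -/
lemma exists_average [Fintype B] {Y : Dual k D M} (ρ : Y.functor ⟶ Y.functor) :
    ∃ (σ : B → (Y.functor ⟶ Y.functor)) (η : Y ⟶ Y), (∀ b, Rel (I.obj b) ρ (σ b)) ∧
      nat η = (Fintype.card B : k)⁻¹ • ∑ b, σ b := by
  choose σ hσ using fun b => Rel.exists_of_isEquivalence (Y := Y) (I.isEquivalence b) ρ
  -- By uniqueness, the conjugates of `ρ` are permuted by left translation, so their sum is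
  -- invariant and hence a module transformation.
  have h1 : ∀ b c, Rel (I.obj c) (σ b) (σ (c * b)) := fun b c => by
    obtain ⟨τ, hτ⟩ := Rel.exists_of_isEquivalence (I.isEquivalence c) (σ b)
    rwa [Rel.unique (I.isEquivalence _) (I.rel_mul (hσ b) hτ) (hσ (c * b))] at hτ
  have h2 : ∀ c, Rel (I.obj c) (∑ b, σ b) (∑ b, σ b) := fun c => by
    have := Rel.sum (s := Finset.univ) fun b _ => h1 b c
    rwa [Fintype.sum_equiv (Equiv.mulLeft c) (fun b => σ (c * b)) σ fun _ => rfl] at this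
  refine ⟨σ, mkHom ((Fintype.card B : k)⁻¹ • ∑ b, σ b) fun d m => ?_, hσ, rfl⟩
  obtain ⟨l, b, u, v, h⟩ := I.exists_dec d
  exact Rel.of_id_eq_sum h (fun a => (h2 (b a)).smul _) m

end InvertibleFamily

end

end

/-! ### Operators and morphisms; natural transformations from linear maps -/

section

section

variable {k : Type u} [Field k] {M : Type u₂} [Category.{v₂} M] [Preadditive M] [Linear k M]
  {D : Type u₃} [Category.{v₃} D] [MonoidalCategory D] [Preadditive D] [Linear k D]
  [MonoidalLeftAction D M] [IsLinearAction k D M]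

namespace Dual

variable {m₀ : M} {Y Y' : Dual k D M}

/-- Morphisms of the dual category act on fibres by maps linear over the operator algebra;
`exists_hom` is the converse. -/
lemma opAlg_comp_nat (r : opAlg k D m₀) (η : Y ⟶ Y') (x : m₀ ⟶ Y.functor.obj m₀) :
    r.1 Y' (x ≫ (nat η).app m₀) = r.1 Y x ≫ (nat η).app m₀ := by
  obtain ⟨r, hr⟩ := r
  change r ∈ Submodule.span k _ at hr
  change r Y' (x ≫ (nat η).app m₀) = r Y x ≫ (nat η).app m₀
  induction hr using Submodule.span_induction with
  | mem r h =>
    obtain ⟨d, p, q, rfl⟩ := h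
    exact op_comp_nat η d p q x
  | zero => simp
  | add r s _ _ hr hs =>
    rw [Pi.add_apply, Pi.add_apply, LinearMap.add_apply, LinearMap.add_apply, hr, hs,
      Preadditive.add_comp]
  | smul c r _ hr =>
    rw [Pi.smul_apply, Pi.smul_apply, LinearMap.smul_apply, LinearMap.smul_apply, hr,
      Linear.smul_comp]

lemma op_mem {N : Submodule (opAlg k D m₀) (Fiber m₀ Y)} {x : m₀ ⟶ Y.functor.obj m₀}
    (hx : (show Fiber m₀ Y from x) ∈ N) (d : D) (p : m₀ ⟶ d ⊙ₗ m₀) (q : d ⊙ₗ m₀ ⟶ m₀) :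
    (show Fiber m₀ Y from p ≫ d ⊴ₗ x ≫ (Y.lineator d m₀).hom ≫ Y.functor.map q) ∈ N :=
  N.smul_mem ⟨_, opFamily_mem d p q⟩ hx

lemma comp_mem {N : Submodule (opAlg k D m₀) (Fiber m₀ Y)} {x : m₀ ⟶ Y.functor.obj m₀}
    (hx : (show Fiber m₀ Y from x) ∈ N) (p q : m₀ ⟶ m₀) :
    (show Fiber m₀ Y from p ≫ x ≫ Y.functor.map q) ∈ N := by
  have := N.smul_mem ⟨_, opFamily_mem (𝟙_ D) (p ≫ (λₗ[D] m₀).inv) ((λₗ[D] m₀).hom ≫ q)⟩ hx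
  exact (op_unit p q Y x) ▸ this

end Dual

/-- The projection of `⨁ L` onto a summand. -/
def Simples.proj (sm : Simples k M) [HasFiniteBiproducts M] (i : sm.ι) : (⨁ sm.L) ⟶ ⨁ sm.L :=
  biproduct.π sm.L i ≫ biproduct.ι sm.L i

namespace Simples

variable (sm : Simples k M) [HasFiniteBiproducts M]

lemma sum_proj : ∑ i, sm.proj i = 𝟙 (⨁ sm.L) := biproduct.total

lemma proj_proj (i : sm.ι) : sm.proj i ≫ sm.proj i = sm.proj i := by
  simp [proj]

lemma proj_proj_of_ne {i j : sm.ι} (h : i ≠ j) : sm.proj i ≫ sm.proj j = 0 := by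
  simp [proj, biproduct.ι_π_ne_assoc _ h]

lemma end_eq_sum (q : (⨁ sm.L) ⟶ ⨁ sm.L) : ∃ c : sm.ι → k, q = ∑ i, c i • sm.proj i := by
  choose c hc using fun i => sm.eq_smul i (biproduct.ι sm.L i ≫ q ≫ biproduct.π sm.L i)
  refine ⟨c, biproduct.hom_ext' _ _ fun i => biproduct.hom_ext _ _ fun j => ?_⟩
  classical
  by_cases hij : i = j
  · subst hij
    rw [Category.assoc, hc]
    simp only [Preadditive.comp_sum, Preadditive.sum_comp, Category.assoc, Linear.comp_smul,
      Linear.smul_comp]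
    rw [Finset.sum_eq_single i]
    · simp [proj]
    · intro j _ hj
      simp [proj, biproduct.ι_π_ne_assoc _ (Ne.symm hj)]
    · simp
  · exact (sm.eq_zero hij _).trans (sm.eq_zero hij _).symm

/-- The part of a linear map that commutes with all endomorphisms of `⨁ L`. -/
lemma exists_natTrans_of_linearMap {Y : M ⥤ M} [Y.Additive] [Y.Linear k]
    (p₀ : ((⨁ sm.L) ⟶ Y.obj (⨁ sm.L)) →ₗ[k] ((⨁ sm.L) ⟶ Y.obj (⨁ sm.L))) :
    ∃ ρ : Y ⟶ Y, ∀ x, x ≫ ρ.app (⨁ sm.L) =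
      ∑ i, ∑ j, sm.proj i ≫ p₀ (sm.proj i ≫ x ≫ Y.map (sm.proj j)) ≫ Y.map (sm.proj j) := by
  classical
  -- The endomorphism algebra of `⨁ L` is spanned by the orthogonal idempotents `proj i`, so keeping
  -- only the diagonal blocks of `p₀` makes it bilinear over that algebra.
  let τ : ((⨁ sm.L) ⟶ Y.obj (⨁ sm.L)) →+ ((⨁ sm.L) ⟶ Y.obj (⨁ sm.L)) :=
    { toFun := fun x =>
        ∑ i, ∑ j, sm.proj i ≫ p₀ (sm.proj i ≫ x ≫ Y.map (sm.proj j)) ≫ Y.map (sm.proj j)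
      map_zero' := by simp
      map_add' := fun x y => by simp [Finset.sum_add_distrib] }
  refine sm.isGen.exists_natTrans_of_addHom τ (fun p x => ?_) fun q x => ?_
  · obtain ⟨c, rfl⟩ := sm.end_eq_sum p
    have h1 : ∀ l, τ (sm.proj l ≫ x) = sm.proj l ≫ τ x := fun l => by
      change ∑ i, ∑ j, _ = sm.proj l ≫ ∑ i, ∑ j, _
      rw [Preadditive.comp_sum]
      refine (Finset.sum_eq_single l ?_ (by simp)).trans
        (Eq.trans ?_ (Finset.sum_eq_single l ?_ (by simp)).symm)
      · intro i _ hi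
        refine Finset.sum_eq_zero fun j _ => ?_
        simp only [← Category.assoc]
        rw [sm.proj_proj_of_ne hi]
        simp
      · rw [Preadditive.comp_sum]
        simp only [← Category.assoc, proj_proj]
      · intro i _ hi
        rw [Preadditive.comp_sum]
        refine Finset.sum_eq_zero fun j _ => ?_
        rw [← Category.assoc, sm.proj_proj_of_ne (Ne.symm hi), zero_comp]
    have h2 : ∀ (c : k) x, τ (c • x) = c • τ x := fun c x => by
      change ∑ i, ∑ j, _ = c • ∑ i, ∑ j, _
      simp only [Linear.smul_comp, Linear.comp_smul, map_smul, Finset.smul_sum]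
    simp only [Preadditive.sum_comp, map_sum, Linear.smul_comp, h2, h1]
  · obtain ⟨c, rfl⟩ := sm.end_eq_sum q
    have h1 : ∀ l, τ (x ≫ Y.map (sm.proj l)) = τ x ≫ Y.map (sm.proj l) := fun l => by
      change ∑ i, ∑ j, _ = (∑ i, ∑ j, _) ≫ _
      rw [Preadditive.sum_comp]
      refine Finset.sum_congr rfl fun i _ => ?_
      rw [Preadditive.sum_comp, Finset.sum_eq_single l, Finset.sum_eq_single l]
      · simp only [Category.assoc, ← Y.map_comp, proj_proj]
      · intro j _ hj
        simp only [Category.assoc, ← Y.map_comp]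
        rw [sm.proj_proj_of_ne hj]
        simp
      · simp
      · intro j _ hj
        simp only [Category.assoc, ← Y.map_comp]
        rw [sm.proj_proj_of_ne (Ne.symm hj)]
        simp
      · simp
    have h2 : ∀ (c : k) x, τ (c • x) = c • τ x := fun c x => by
      change ∑ i, ∑ j, _ = c • ∑ i, ∑ j, _
      simp only [Linear.smul_comp, Linear.comp_smul, map_smul, Finset.smul_sum]
    simp only [Preadditive.comp_sum, map_sum, Linear.comp_smul, Y.map_sum, Y.map_smul, h2, h1]

end Simples

/-! ### Semisimplicity of the fibres -/

namespace InvertibleFamily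

open TensorCat.Dual

variable {B : Type w} [Group B] [Fintype B] (I : InvertibleFamily D B)
  (sm : Simples k M) [HasFiniteBiproducts M]

include I in
-- Since `I b` acts by an equivalence, the identity of `m₀` factors through copies of `I b ⊙ m₀`.
-- This writes `x ≫ σ` as a sum of operators applied to elements of the form `t ≫ ρ`, all of which
-- lie in `N`.
lemma comp_rel_mem {b : B} {Y : Dual k D M} {ρ σ : Y.functor ⟶ Y.functor} (h : Rel (I.obj b) ρ σ)
    {m₀ : M} (hm : IsGen m₀) {N : Submodule (opAlg k D m₀) (Fiber m₀ Y)}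
    (hN : ∀ x : m₀ ⟶ Y.functor.obj m₀, (show Fiber m₀ Y from x ≫ ρ.app m₀) ∈ N)
    (x : m₀ ⟶ Y.functor.obj m₀) : (show Fiber m₀ Y from x ≫ σ.app m₀) ∈ N := by
  let T : M ⥤ M := actFunctor (I.obj b)
  have := I.isEquivalence (M := M) b
  have := actFunctor_additive (M := M) k (I.obj b)
  obtain ⟨l, u, v, huv⟩ := hm (T.objPreimage m₀)
  obtain ⟨l', s, t, hst⟩ := hm (Y.functor.obj m₀)
  let e := T.objObjPreimageIso m₀
  have h1 : ∑ a, (e.inv ≫ T.map (u a)) ≫ T.map (v a) ≫ e.hom = 𝟙 m₀ := by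
    have : ∑ a, T.map (u a) ≫ T.map (v a) = 𝟙 _ := by
      simp only [← T.map_comp, ← T.map_sum, huv, T.map_id]
    simp only [Category.assoc]
    rw [← Preadditive.comp_sum]
    simp only [← Category.assoc]
    rw [← Preadditive.sum_comp, this]
    simp
  have h2 : ∑ c, T.map (s c) ≫ T.map (t c) = 𝟙 (T.obj (Y.functor.obj m₀)) := by
    simp only [← T.map_comp, ← T.map_sum, hst, T.map_id]
  have h3 : x ≫ σ.app m₀ = ∑ a, ∑ c,
      (x ≫ Y.functor.map (e.inv ≫ T.map (u a)) ≫ (Y.lineator (I.obj b) m₀).inv ≫ T.map (s c)) ≫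
        I.obj b ⊴ₗ (t c ≫ ρ.app m₀) ≫ (Y.lineator (I.obj b) m₀).hom ≫
          Y.functor.map (T.map (v a) ≫ e.hom) := by
    have h4 : ∀ a, Y.functor.map (T.map (v a) ≫ e.hom) ≫ σ.app m₀ =
        σ.app (T.obj m₀) ≫ Y.functor.map (T.map (v a) ≫ e.hom) := fun a => σ.naturality _
    have h5 : σ.app (T.obj m₀) = (Y.lineator (I.obj b) m₀).inv ≫ T.map (ρ.app m₀) ≫
        (Y.lineator (I.obj b) m₀).hom := by
      rw [Iso.eq_inv_comp]; exact h m₀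
    conv_lhs => rw [← Category.comp_id x, ← Y.functor.map_id, ← h1, Y.functor.map_sum]
    rw [Preadditive.comp_sum, Preadditive.sum_comp]
    refine Finset.sum_congr rfl fun a _ => ?_
    rw [Y.functor.map_comp, Category.assoc, Category.assoc, h4, h5]
    conv_lhs => rw [← Category.id_comp (T.map (ρ.app m₀)), ← h2]
    simp only [Preadditive.sum_comp, Preadditive.comp_sum, Category.assoc]
    refine Finset.sum_congr rfl fun c _ => ?_
    rw [MonoidalLeftAction.actionHomRight_comp]
    simp only [Category.assoc]
    rfl
  rw [h3]
  refine N.sum_mem fun a _ => N.sum_mem fun c _ => ?_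
  exact op_mem (hN (t c)) _ _ _

include I in
-- Acting by `I b⁻¹` is faithful and turns `σ` back into `ρ`; operators for `I b⁻¹` keep `x` in `N`,
-- where `ρ` is the identity.
lemma comp_rel_eq {b : B} {Y : Dual k D M} {ρ σ : Y.functor ⟶ Y.functor} (h : Rel (I.obj b) ρ σ)
    {m₀ : M} (hm : IsGen m₀) {N : Submodule (opAlg k D m₀) (Fiber m₀ Y)}
    (hN : ∀ x : m₀ ⟶ Y.functor.obj m₀, (show Fiber m₀ Y from x) ∈ N → x ≫ ρ.app m₀ = x)
    (x : m₀ ⟶ Y.functor.obj m₀) (hx : (show Fiber m₀ Y from x) ∈ N) : x ≫ σ.app m₀ = x := by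
  let T : M ⥤ M := actFunctor (I.obj b⁻¹)
  have := I.isEquivalence (M := M) b⁻¹
  refine T.map_injective ?_
  have h' := I.rel_inv h m₀
  change I.obj b⁻¹ ⊴ₗ (x ≫ σ.app m₀) = I.obj b⁻¹ ⊴ₗ x
  rw [MonoidalLeftAction.actionHomRight_comp, ← cancel_mono (Y.lineator (I.obj b⁻¹) m₀).hom,
    Category.assoc, ← h']
  refine hm.hom_ext fun p => ?_
  obtain ⟨l, u, v, huv⟩ := hm (I.obj b⁻¹ ⊙ₗ m₀)
  have hfun : 𝟙 (Y.functor.obj (I.obj b⁻¹ ⊙ₗ m₀)) =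
      ∑ a, Y.functor.map (u a) ≫ Y.functor.map (v a) := by
    rw [← Y.functor.map_id, ← huv, Functor.map_sum]
    simp only [Functor.map_comp]
  have h1 : ∀ a, (p ≫ I.obj b⁻¹ ⊴ₗ x ≫ (Y.lineator (I.obj b⁻¹) m₀).hom ≫ Y.functor.map (u a)) ≫
      ρ.app m₀ = p ≫ I.obj b⁻¹ ⊴ₗ x ≫ (Y.lineator (I.obj b⁻¹) m₀).hom ≫ Y.functor.map (u a) :=
    fun a => hN _ (op_mem hx _ _ _)
  conv_lhs => rw [← Category.comp_id (ρ.app _), hfun]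
  conv_rhs => rw [← Category.comp_id (Y.lineator (I.obj b⁻¹) m₀).hom, hfun]
  simp only [Preadditive.comp_sum]
  refine Finset.sum_congr rfl fun a _ => ?_
  rw [← NatTrans.naturality_assoc]
  have := h1 a
  simp only [Category.assoc] at this ⊢
  rw [reassoc_of% this]

include I in
/-- Fibres are semisimple, by averaging projections. -/
lemma isSemisimple_fiber [CharZero k] (Y : Dual k D M) :
    IsSemisimpleModule (opAlg k D (⨁ sm.L)) (Fiber (⨁ sm.L) Y) := by
  refine { exists_isCompl := fun N => ?_ }
  let N' : Submodule k ((⨁ sm.L) ⟶ Y.functor.obj (⨁ sm.L)) := N.restrictScalars k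
  -- Maschke's argument in two stages: a `k`-linear projection onto `N` is first made `End
  -- m₀`-bilinear, giving `ρ`, and then averaged over `B`, giving a morphism `η`. Both stages keep
  -- the image in `N` and the identity on `N`.
  obtain ⟨g, hg⟩ := N'.subtype.exists_leftInverse_of_injective (Submodule.ker_subtype _)
  obtain ⟨ρ, hρ⟩ := sm.exists_natTrans_of_linearMap (Y := Y.functor) (N'.subtype ∘ₗ g)
  have h1 : ∀ x, (show Fiber (⨁ sm.L) Y from x ≫ ρ.app (⨁ sm.L)) ∈ N := fun x => by
    rw [hρ]
    exact N.sum_mem fun i _ => N.sum_mem fun j _ => comp_mem (g _).2 _ _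
  have h2 : ∀ x : (⨁ sm.L) ⟶ Y.functor.obj (⨁ sm.L), (show Fiber (⨁ sm.L) Y from x) ∈ N →
      x ≫ ρ.app (⨁ sm.L) = x := fun x hx => by
    have h3 : ∀ y : (⨁ sm.L) ⟶ Y.functor.obj (⨁ sm.L), (show Fiber (⨁ sm.L) Y from y) ∈ N →
        N'.subtype (g y) = y := fun y hy =>
      congrArg N'.subtype (LinearMap.congr_fun hg ⟨y, hy⟩)
    rw [hρ]
    have h4 : ∀ i j, sm.proj i ≫ (N'.subtype ∘ₗ g) (sm.proj i ≫ x ≫ Y.functor.map (sm.proj j)) ≫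
        Y.functor.map (sm.proj j) = sm.proj i ≫ x ≫ Y.functor.map (sm.proj j) := fun i j => by
      rw [LinearMap.comp_apply, h3 _ (comp_mem hx _ _)]
      simp only [Category.assoc, ← Y.functor.map_comp, sm.proj_proj]
      rw [← Category.assoc, sm.proj_proj]
    simp only [h4]
    simp only [← Preadditive.comp_sum, ← Preadditive.sum_comp, ← Y.functor.map_sum, sm.sum_proj]
    simp
  obtain ⟨σ, η, hσ, hη⟩ := I.exists_average ρ
  have hB : (Fintype.card B : k) ≠ 0 := Nat.cast_ne_zero.2 Fintype.card_ne_zero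
  have h5 : ∀ x : (⨁ sm.L) ⟶ Y.functor.obj (⨁ sm.L), x ≫ (nat η).app (⨁ sm.L) =
      (Fintype.card B : k)⁻¹ • ∑ b, x ≫ (σ b).app (⨁ sm.L) := fun x => by
    rw [hη, NatTrans.app_smul, NatTrans.app_sum, Linear.comp_smul, Preadditive.comp_sum]
  let f : Fiber (⨁ sm.L) Y →ₗ[opAlg k D (⨁ sm.L)] N :=
    { toFun := fun x => ⟨(show (⨁ sm.L) ⟶ Y.functor.obj (⨁ sm.L) from x) ≫
        (nat η).app (⨁ sm.L), by
          rw [h5]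
          exact N'.smul_mem _ (N'.sum_mem fun b _ => I.comp_rel_mem (hσ b) sm.isGen h1 x)⟩
      map_add' := fun x y => Subtype.ext (Preadditive.add_comp _ _ _ _ _ _)
      map_smul' := fun r x => Subtype.ext (opAlg_comp_nat r η x).symm }
  refine ⟨LinearMap.ker f, LinearMap.isCompl_of_proj fun x => Subtype.ext ?_⟩
  have h6 : ∀ y : (⨁ sm.L) ⟶ Y.functor.obj (⨁ sm.L), (show Fiber (⨁ sm.L) Y from y) ∈ N →
      (Fintype.card B : k)⁻¹ • ∑ b, y ≫ (σ b).app (⨁ sm.L) = y := fun y hy => by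
    rw [Finset.sum_congr rfl fun b _ => I.comp_rel_eq (hσ b) sm.isGen h2 y hy, Finset.sum_const,
      Finset.card_univ, ← Nat.cast_smul_eq_nsmul k, smul_smul, inv_mul_cancel₀ hB, one_smul]
  exact (h5 x.1).trans (h6 x.1 x.2)

end InvertibleFamily

end

end

section

/-! ### Independence of invertible functors -/

section

variable {k : Type u} [Field k] {M : Type u₂} [Category.{v₂} M] [Preadditive M] [Linear k M]
  {C : Type u₁} [Category.{v₁} C] [MonoidalCategory C] [Preadditive C] [Linear k C]
  [MonoidalLeftAction C M] [IsLinearAction k C M]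

namespace Dual

lemma lineator_inv_naturality_right (Y : Dual k C M) (c : C) {m n : M} (f : m ⟶ n) :
    Y.functor.map (c ⊴ₗ f) ≫ (Y.lineator c n).inv =
      (Y.lineator c m).inv ≫ c ⊴ₗ Y.functor.map f := by
  rw [Iso.comp_inv_eq, Category.assoc, lineator_naturality_right, Iso.inv_hom_id_assoc]

lemma lineator_inv_tensor (Y : Dual k C M) (c d : C) (m : M) :
    Y.functor.map (αₗ c d m).inv ≫ (Y.lineator (c ⊗ d) m).inv =
      (Y.lineator c (d ⊙ₗ m)).inv ≫ c ⊴ₗ (Y.lineator d m).inv ≫ (αₗ c d _).inv := by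
  have h := Functor.LaxLeftLinear.μₗ_associativity (C := C) Y.functor c d m
  simp only [← lineator_hom] at h
  rw [Iso.comp_inv_eq, ← cancel_mono (Y.functor.map (αₗ c d m).hom)]
  simp only [Category.assoc]
  rw [h, ← Y.functor.map_comp, Iso.inv_hom_id, Y.functor.map_id, Iso.inv_hom_id_assoc,
    ← MonoidalLeftAction.actionHomRight_comp_assoc, Iso.inv_hom_id,
    MonoidalLeftAction.actionHomRight_id, Category.id_comp, Iso.inv_hom_id]

lemma lineator_inv_unit (Y : Dual k C M) (m : M) :
    Y.functor.map (λₗ[C] m).inv ≫ (Y.lineator (𝟙_ C) m).inv = (λₗ[C] _).inv := by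
  have h := Functor.LaxLeftLinear.μₗ_unitality (C := C) Y.functor m
  rw [← lineator_hom] at h
  rw [Iso.comp_inv_eq, Iso.eq_inv_comp, h, Category.assoc, ← Y.functor.map_comp, Iso.hom_inv_id,
    Y.functor.map_id, Category.comp_id]

variable {τ : Type*} [Fintype τ] (T : τ → Dual k C M) {m₀ : M}
  (p : ∀ t, m₀ ⟶ (T t).functor.obj m₀)

/-- The families `q` for which all sums of the operators `(p t, q t)` vanish on the spaces
`m₀ ⟶ c ⊙ n`. -/
def annihilators (n n' : M) : AddSubgroup (∀ t, (T t).functor.obj n ⟶ n') where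
  carrier := {q | ∀ (c : C) (f : m₀ ⟶ c ⊙ₗ n),
    ∑ t, p t ≫ (T t).functor.map f ≫ ((T t).lineator c n).inv ≫ c ⊴ₗ q t = 0}
  add_mem' {q q'} h h' c f := by
    simp only [Pi.add_apply, IsLinearAction.actionHomRight_add k, Preadditive.comp_add,
      Finset.sum_add_distrib, h c f, h' c f, add_zero]
  zero_mem' c f := by simp [act_zero k]
  neg_mem' {q} h c f := by
    have := actFunctor_additive (M := M) k c
    have hn : ∀ t, c ⊴ₗ (-q t) = -(c ⊴ₗ q t) := fun t => (actFunctor c).map_neg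
    simp only [Pi.neg_apply, hn, Preadditive.comp_neg, Finset.sum_neg_distrib, h c f, neg_zero]

variable {T p} {n n' : M} {q : ∀ t, (T t).functor.obj n ⟶ n'}

lemma annihilators_comp (h : q ∈ annihilators T p n n') {n'' : M} (g : n' ⟶ n'') :
    (fun t => q t ≫ g) ∈ annihilators T p n n'' := fun c f => by
  have := congrArg (· ≫ c ⊴ₗ g) (h c f)
  simpa [Preadditive.sum_comp] using this

lemma annihilators_precomp (h : q ∈ annihilators T p n n') {m : M} (g : m ⟶ n) :
    (fun t => (T t).functor.map g ≫ q t) ∈ annihilators T p m n' := fun c f => by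
  refine (Finset.sum_congr rfl fun t _ => ?_).trans (h c (f ≫ c ⊴ₗ g))
  rw [Functor.map_comp, Category.assoc, reassoc_of% (lineator_inv_naturality_right (T t) c g),
    MonoidalLeftAction.actionHomRight_comp]

lemma annihilators_act (h : q ∈ annihilators T p n n') (d : C) :
    (fun t => ((T t).lineator d n).inv ≫ d ⊴ₗ q t) ∈ annihilators T p (d ⊙ₗ n) (d ⊙ₗ n') :=
    fun c f => by
  have h1 := h (c ⊗ d) (f ≫ (αₗ c d n).inv)
  rw [← cancel_mono (αₗ c d n').inv, zero_comp, ← h1, Preadditive.sum_comp]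
  refine Finset.sum_congr rfl fun t _ => ?_
  rw [Functor.map_comp]
  simp only [Category.assoc]
  rw [reassoc_of% (lineator_inv_tensor (T t) c d n)]
  simp

lemma annihilators_sum {I : Type*} (s : Finset I) {q : I → ∀ t, (T t).functor.obj n ⟶ n'}
    (h : ∀ i ∈ s, q i ∈ annihilators T p n n') :
    (fun t => ∑ i ∈ s, q i t) ∈ annihilators T p n n' := by
  have := AddSubgroup.sum_mem _ h
  rwa [show ∑ i ∈ s, q i = fun t => ∑ i ∈ s, q i t from funext fun t => Finset.sum_apply _ _ _]
    at this

variable (sm : Simples k M)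
  (hret : ∀ i j : sm.ι, ∃ (c : C) (f : sm.L j ⟶ c ⊙ₗ sm.L i) (g : c ⊙ₗ sm.L i ⟶ sm.L j), f ≫ g = 𝟙 _)
  (hT : ∀ t, (T t).PreservesBricks)

include hret hT in
/-- A nonzero annihilating family can be normalized to be the identity at a given index. -/
lemma exists_annihilator_id (hq : q ∈ annihilators T p n n') {t₀ : τ} (h0 : q t₀ ≠ 0) (m : M) :
    ∃ Q ∈ annihilators T p m ((T t₀).functor.obj m), Q t₀ = 𝟙 _ ∧ ∀ t, q t = 0 → Q t = 0 := by
  have h1 : ∃ i, ∃ Q ∈ annihilators T p (sm.L i) ((T t₀).functor.obj (sm.L i)),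
      Q t₀ = 𝟙 _ ∧ ∀ t, q t = 0 → Q t = 0 := by
    -- Restrict to a simple summand of `n` on which `q t₀` is nonzero. The source `T t₀ (L a)` is
    -- simple, so a retraction normalizes `q t₀` to the identity there; the action spreads this to
    -- all simples, and sums spread it to all objects, without enlarging the support.
    obtain ⟨l, s, u, v, huv, -⟩ := sm.exists_dec n
    have : ∃ a, (T t₀).functor.map (v a) ≫ q t₀ ≠ 0 := by
      by_contra! hz
      apply h0
      rw [← Category.id_comp (q t₀), ← (T t₀).functor.map_id, ← huv, Functor.map_sum,
        Preadditive.sum_comp]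
      simp [hz]
    obtain ⟨a, ha⟩ := this
    obtain ⟨j, ⟨e⟩⟩ := (hT t₀ _ (sm.isBrick (s a))).nonempty_iso sm
    have hne : e.hom ≫ (T t₀).functor.map (v a) ≫ q t₀ ≠ 0 := fun h => ha (by
      rw [← cancel_epi e.hom, h, comp_zero])
    obtain ⟨g, hg⟩ := sm.exists_retraction hne
    refine ⟨s a, _, annihilators_comp (annihilators_precomp hq (v a)) (g ≫ e.hom), ?_,
      fun t ht => by rw [ht, comp_zero, zero_comp]⟩
    rw [← cancel_epi e.hom, Category.comp_id]
    simpa using congrArg (· ≫ e.hom) hg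
  obtain ⟨i, Q₀, hQ₀, hQ₁, hQ₂⟩ := h1
  have h2 : ∀ j, ∃ Q ∈ annihilators T p (sm.L j) ((T t₀).functor.obj (sm.L j)),
      Q t₀ = 𝟙 _ ∧ ∀ t, q t = 0 → Q t = 0 := fun j => by
    obtain ⟨c, f, g, hfg⟩ := hret i j
    refine ⟨_, annihilators_comp (annihilators_precomp (annihilators_act hQ₀ c) f)
      (((T t₀).lineator c (sm.L i)).hom ≫ (T t₀).functor.map g), ?_, fun t ht => ?_⟩
    · rw [hQ₁, MonoidalLeftAction.actionHomRight_id, Category.comp_id, Category.assoc,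
        Iso.inv_hom_id_assoc, ← Functor.map_comp, hfg, CategoryTheory.Functor.map_id]
    · rw [hQ₂ t ht, act_zero k, comp_zero, comp_zero, zero_comp]
  choose Q hQ hQ1 hQ0 using h2
  obtain ⟨l, s, u, v, huv, -⟩ := sm.exists_dec m
  refine ⟨_, annihilators_sum Finset.univ fun a _ =>
    annihilators_comp (annihilators_precomp (hQ (s a)) (u a)) ((T t₀).functor.map (v a)), ?_,
    fun t ht => ?_⟩
  · simp only [hQ1, Category.comp_id, ← Functor.map_comp]
    rw [← Functor.map_sum, huv, CategoryTheory.Functor.map_id]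
  · simp [hQ0 _ t ht]

include sm hret hT in
/-- The independence theorem. -/
lemma annihilators_eq_zero
    (hp : ∀ (t₀ : τ) (φ : ∀ t, T t ⟶ T t₀), φ t₀ = 𝟙 _ → ∑ t, p t ≫ (nat (φ t)).app m₀ ≠ 0)
    (hq : q ∈ annihilators T p n n') : q = 0 := by
  classical
  -- Induction on the support, as in Dedekind's proof of the independence of characters.
  suffices h : ∀ (s : Finset τ) (n n' : M) (q : ∀ t, (T t).functor.obj n ⟶ n'),
      q ∈ annihilators T p n n' → (∀ t ∉ s, q t = 0) → q = 0 from
    h Finset.univ n n' q hq fun t ht => absurd (Finset.mem_univ t) ht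
  intro s
  induction s using Finset.induction_on with
  | empty => exact fun n n' q _ h => funext fun t => h t (Finset.notMem_empty t)
  | insert t₀ s _ ih =>
    intro n n' q hq hs
    by_contra hne
    have h0 : q t₀ ≠ 0 := fun h0 => hne (ih n n' q hq fun t ht => by
      by_cases htt : t = t₀
      · rw [htt, h0]
      · exact hs t (by simp [htt, ht]))
    choose Q hQ hQ1 hQ0 using exists_annihilator_id sm hret hT hq h0
    -- Two relations on this support that agree at `t₀` are equal, since their difference has
    -- smaller support. This uniqueness gives both the naturality and the module compatibility of
    -- the normalized relations.
    have key : ∀ (m m' : M) (x y : ∀ t, (T t).functor.obj m ⟶ m'), x ∈ annihilators T p m m' →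
        y ∈ annihilators T p m m' → (∀ t ∉ insert t₀ s, x t = 0) → (∀ t ∉ insert t₀ s, y t = 0) →
        x t₀ = y t₀ → ∀ t, x t = y t := fun m m' x y hx hy hx0 hy0 h t => by
      refine sub_eq_zero.1 (congrFun (ih m m' (x - y) (AddSubgroup.sub_mem _ hx hy)
        fun t ht => ?_) t)
      by_cases htt : t = t₀
      · subst htt; exact sub_eq_zero.2 h
      · have : t ∉ insert t₀ s := by simp [htt, ht]
        rw [Pi.sub_apply, hx0 t this, hy0 t this, sub_zero]
    have hnat : ∀ {m m' : M} (f : m ⟶ m') t, (T t).functor.map f ≫ Q m' t =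
        Q m t ≫ (T t₀).functor.map f := fun {m m'} f =>
      key _ _ _ _ (annihilators_precomp (hQ m') f) (annihilators_comp (hQ m) _)
        (fun t ht => by rw [hQ0 _ _ (hs t ht), comp_zero])
        (fun t ht => by rw [hQ0 _ _ (hs t ht), zero_comp])
        (by rw [hQ1, hQ1, Category.comp_id, Category.id_comp])
    have hlin : ∀ (c : C) (m : M) t, Q (c ⊙ₗ m) t =
        (((T t).lineator c m).inv ≫ c ⊴ₗ Q m t) ≫ ((T t₀).lineator c m).hom := fun c m =>
      key _ _ _ _ (hQ _) (annihilators_comp (annihilators_act (hQ m) c) _)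
        (fun t ht => hQ0 _ _ (hs t ht))
        (fun t ht => by rw [hQ0 _ _ (hs t ht), act_zero k, comp_zero, zero_comp])
        (by rw [hQ1, hQ1, MonoidalLeftAction.actionHomRight_id, Category.comp_id, Iso.inv_hom_id])
    let φ : ∀ t, T t ⟶ T t₀ := fun t =>
      mkHom { app := fun m => Q m t, naturality := fun m m' f => hnat f t } fun c m => by
        change _ ≫ Q (c ⊙ₗ m) t = c ⊴ₗ Q m t ≫ _
        rw [hlin, Category.assoc, Iso.hom_inv_id_assoc]
    refine hp t₀ φ (hom_ext fun m => hQ1 m) ?_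
    -- The relation for the unit object is exactly the dependence among the `p t ≫ φ t` that is
    -- excluded by `hp`.
    have h1 := hQ m₀ (𝟙_ C) (λₗ[C] m₀).inv
    rw [← cancel_mono (λₗ[C] _).inv, zero_comp, ← h1, Preadditive.sum_comp]
    refine Finset.sum_congr rfl fun t _ => ?_
    rw [reassoc_of% (lineator_inv_unit (T t) m₀), Category.assoc,
      MonoidalLeftAction.actionUnitIso_inv_naturality]
    rfl

end Dual

end

end

/-! ### Recovering objects and morphisms of the dual category from their fibres -/

section

section

variable {k : Type u} [Field k] {M : Type u₂} [Category.{v₂} M] [Preadditive M] [Linear k M]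
  {D : Type u₃} [Category.{v₃} D] [MonoidalCategory D] [Preadditive D] [Linear k D]
  [MonoidalLeftAction D M] [IsLinearAction k D M]

namespace Dual

variable {m₀ : M}

lemma exists_hom_of_fiber (hm : IsGen m₀) {Y Y' : Dual k D M}
    (τ : Fiber m₀ Y →ₗ[opAlg k D m₀] Fiber m₀ Y') :
    ∃ η : Y ⟶ Y', ∀ x : m₀ ⟶ Y.functor.obj m₀, x ≫ (nat η).app m₀ = τ x :=
  exists_hom hm (τ.restrictScalars k) fun d p q x => τ.map_smul ⟨_, opFamily_mem d p q⟩ x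

lemma hom_ext_of_gen (hm : IsGen m₀) {Y Y' : Dual k D M} {η θ : Y ⟶ Y'}
    (h : ∀ x : m₀ ⟶ Y.functor.obj m₀, x ≫ (nat η).app m₀ = x ≫ (nat θ).app m₀) : η = θ :=
  Subtype.ext (hm.natTrans_ext (hm.hom_ext h))

/-- An object on which every operator vanishes that vanishes on the objects of a finite family is a
retract of a sum of objects of this family. -/
lemma exists_id_eq_sum (sm : Simples k M) (hm : IsGen m₀) {J : Type} [Fintype J]
    (X : J → Dual k D M) (hX : ∀ j, IsSemisimpleModule (opAlg k D m₀) (Fiber m₀ (X j)))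
    (G : Dual k D M)
    (h : ∀ r : opAlg k D m₀, (∀ j (x : Fiber m₀ (X j)), r • x = 0) → ∀ x : Fiber m₀ G, r • x = 0) :
    ∃ (I : Type) (_ : Fintype I) (t : I → J) (α : ∀ a, G ⟶ X (t a)) (β : ∀ a, X (t a) ⟶ G),
      ∑ a, α a ≫ β a = 𝟙 G := by
  classical
  have hfin : ∀ Y : Dual k D M, Module.Finite k (Fiber m₀ Y) := fun Y => sm.finite_hom _ _
  obtain ⟨d, w, hw⟩ := Module.Finite.exists_fin (R := k) (M := ∀ j, Fiber m₀ (X j))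
  obtain ⟨e, v, hv⟩ := Module.Finite.exists_fin (R := k) (M := Fiber m₀ G)
  obtain ⟨i, p, hip⟩ := exists_retract_of_annihilator (R := opAlg k D m₀) w v (fun x => by
    have hx : x ∈ Submodule.span k (Set.range v) := hv ▸ Submodule.mem_top
    obtain ⟨c, rfl⟩ := (Submodule.mem_span_range_iff_exists_fun k).1 hx
    exact ⟨fun a => c a • 1, Finset.sum_congr rfl fun a _ => (smul_one_smul _ _ _).symm⟩)
    -- The vectors `w` span the product of the fibres over `k`, so an operator killing them kills
    -- every fibre of the family.
    (fun r hr => h r fun j x => by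
      let N : Submodule k (∀ j, Fiber m₀ (X j)) :=
        { carrier := {y | ∀ j, r.1 (X j) (y j) = 0}
          add_mem' := fun {y z} hy hz j => ((r.1 (X j)).map_add _ _).trans (by
            rw [hy j, hz j, add_zero])
          zero_mem' := fun j => (r.1 (X j)).map_zero
          smul_mem' := fun c y hy j => ((r.1 (X j)).map_smul _ _).trans (by
            rw [hy j, smul_zero]) }
      have hN : N = ⊤ := top_le_iff.1 (hw ▸ Submodule.span_le.2 (by
        rintro _ ⟨a, rfl⟩
        exact fun j => congrFun (hr a) j))
      have hmem : Pi.single j x ∈ N := hN ▸ Submodule.mem_top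
      have := hmem j
      rwa [Pi.single_eq_same] at this)
  -- The coordinates of `i` and `p` are linear over the operators, hence come from morphisms of the
  -- dual category.
  choose α hα using fun a : Fin e × Fin d × J => exists_hom_of_fiber hm
    (LinearMap.proj a.2.2 ∘ₗ LinearMap.proj a.2.1 ∘ₗ LinearMap.proj a.1 ∘ₗ i :
      Fiber m₀ G →ₗ[opAlg k D m₀] Fiber m₀ (X a.2.2))
  choose β hβ using fun a : Fin e × Fin d × J => exists_hom_of_fiber hm
    (p ∘ₗ LinearMap.single _ (fun _ => Fin d → ∀ j, Fiber m₀ (X j)) a.1 ∘ₗ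
      LinearMap.single _ (fun _ => ∀ j, Fiber m₀ (X j)) a.2.1 ∘ₗ
      LinearMap.single _ (fun j => Fiber m₀ (X j)) a.2.2 :
      Fiber m₀ (X a.2.2) →ₗ[opAlg k D m₀] Fiber m₀ G)
  refine ⟨Fin e × Fin d × J, inferInstance, fun a => a.2.2, α, β, hom_ext_of_gen hm fun x => ?_⟩
  have h1 : nat (∑ a, α a ≫ β a) = ∑ a, nat (α a) ≫ nat (β a) :=
    map_sum (⟨⟨nat, rfl⟩, fun _ _ => rfl⟩ : (G ⟶ G) →+ (G.functor ⟶ G.functor)) _ _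
  have h2 : ∀ a, x ≫ (nat (α a)).app m₀ ≫ (nat (β a)).app m₀ =
      p (Pi.single a.1 (Pi.single a.2.1 (Pi.single a.2.2 (i x a.1 a.2.1 a.2.2)))) := fun a => by
    rw [← Category.assoc]
    exact (congrArg (· ≫ (nat (β a)).app m₀) (hα a x)).trans (hβ a _)
  rw [h1, NatTrans.app_sum, Preadditive.comp_sum]
  simp only [NatTrans.comp_app, h2]
  have h3 : (x : m₀ ⟶ G.functor.obj m₀) = p (i x) := (LinearMap.congr_fun hip x).symm
  refine Eq.trans ?_ (h3.symm.trans (Category.comp_id x).symm)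
  refine (map_sum p _ _).symm.trans (congrArg p ?_)
  simp only [Fintype.sum_prod_type]
  funext a b j
  simp only [Finset.sum_apply]
  rw [Finset.sum_eq_single a, Finset.sum_eq_single b, Finset.sum_eq_single j]
  · simp
  · intro j' _ hj'
    simp [Pi.single_eq_of_ne (Ne.symm hj')]
  · simp
  · intro b' _ hb'
    simp [Pi.single_eq_of_ne (Ne.symm hb')]
  · simp
  · intro a' _ ha'
    simp [Pi.single_eq_of_ne (Ne.symm ha')]
  · simp

/-- `opFamily` as a bilinear map. -/
def opLin (d : D) : (m₀ ⟶ d ⊙ₗ m₀) →ₗ[k] (d ⊙ₗ m₀ ⟶ m₀) →ₗ[k]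
    (∀ Y : Dual k D M, Module.End k (m₀ ⟶ Y.functor.obj m₀)) :=
  LinearMap.mk₂ k (opFamily k d)
    (fun p p' q => funext fun Y => LinearMap.ext fun x => Preadditive.add_comp _ _ _ _ _ _)
    (fun c p q => funext fun Y => LinearMap.ext fun x => Linear.smul_comp _ _ _ _ _ _)
    (fun p q q' => funext fun Y => LinearMap.ext fun x =>
      (congrArg (fun z => p ≫ d ⊴ₗ x ≫ (Y.lineator d m₀).hom ≫ z) Y.functor.map_add).trans (by
        simp only [Preadditive.comp_add]
        rfl))
    (fun c p q => funext fun Y => LinearMap.ext fun x =>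
      (congrArg (fun z => p ≫ d ⊴ₗ x ≫ (Y.lineator d m₀).hom ≫ z) (Y.functor.map_smul c q)).trans (by
        simp only [Linear.comp_smul]
        rfl))

/-- A morphism of acting objects can be moved from one argument to the other, as in a coend. This
reduces arbitrary operators to those of the invertible objects. -/
lemma opLin_act {d e : D} (u : d ⟶ e) (p : m₀ ⟶ d ⊙ₗ m₀) (q : e ⊙ₗ m₀ ⟶ m₀) :
    opLin (k := k) d p (u ⊵ₗ m₀ ≫ q) = opLin e (p ≫ u ⊵ₗ m₀) q :=
  funext fun Y => LinearMap.ext fun x => by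
    change p ≫ d ⊴ₗ x ≫ (Y.lineator d m₀).hom ≫ Y.functor.map (u ⊵ₗ m₀ ≫ q) =
      (p ≫ u ⊵ₗ m₀) ≫ e ⊴ₗ x ≫ (Y.lineator e m₀).hom ≫ Y.functor.map q
    rw [Y.functor.map_comp, ← reassoc_of% (lineator_naturality_left Y u m₀)]
    simp only [Category.assoc]
    rw [MonoidalLeftAction.action_exchange_assoc]

end Dual

namespace InvertibleFamily

open TensorCat.Dual

variable {B : Type w} [Group B] (I : InvertibleFamily D B)

/-- Every operator is a sum of operators given by the objects of an invertible family and elements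
of spanning families of the spaces `m₀ ⟶ I b ⊙ m₀`. -/
lemma exists_eq_sum_opLin [Fintype B] {m₀ : M} {n : B → ℕ}
    (p : ∀ t : Σ b, Fin (n b), m₀ ⟶ I.obj t.1 ⊙ₗ m₀)
    (hp : ∀ b (x : m₀ ⟶ I.obj b ⊙ₗ m₀), ∃ r : Fin (n b) → k, x = ∑ s, r s • p ⟨b, s⟩)
    (r : opAlg k D m₀) : ∃ q : ∀ t : Σ b, Fin (n b), I.obj t.1 ⊙ₗ m₀ ⟶ m₀,
      r.1 = ∑ t, opLin (I.obj t.1) (p t) (q t) := by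
  classical
  let Φ : (∀ t : Σ b, Fin (n b), I.obj t.1 ⊙ₗ m₀ ⟶ m₀) →ₗ[k]
      (∀ Y : Dual k D M, Module.End k (m₀ ⟶ Y.functor.obj m₀)) :=
    ∑ t, opLin (I.obj t.1) (p t) ∘ₗ LinearMap.proj t
  suffices h : r.1 ∈ LinearMap.range Φ by
    obtain ⟨q, hq⟩ := h
    exact ⟨q, by rw [← hq]; simp [Φ, LinearMap.sum_apply]⟩
  have h1 : ∀ t q, opLin (I.obj t.1) (p t) q ∈ LinearMap.range Φ := fun t q => by
    refine ⟨Pi.single t q, ?_⟩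
    simp only [Φ, LinearMap.sum_apply, LinearMap.comp_apply, LinearMap.proj_apply]
    rw [Finset.sum_eq_single t, Pi.single_eq_same]
    · intro t' _ ht'
      rw [Pi.single_eq_of_ne ht', map_zero]
    · simp
  refine Submodule.span_le.2 ?_ r.2
  rintro _ ⟨d, p', q', rfl⟩
  obtain ⟨l, b, u, v, huv⟩ := I.exists_dec d
  change opLin d p' q' ∈ LinearMap.range Φ
  rw [← Category.id_comp q', id_act_eq_sum k huv, Preadditive.sum_comp, map_sum]
  refine Submodule.sum_mem _ fun a _ => ?_
  rw [Category.assoc, opLin_act]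
  obtain ⟨c, hc⟩ := hp (b a) (p' ≫ u a ⊵ₗ m₀)
  rw [hc, map_sum, LinearMap.sum_apply]
  refine Submodule.sum_mem _ fun s _ => ?_
  rw [map_smul, LinearMap.smul_apply]
  exact Submodule.smul_mem _ _ (h1 ⟨b a, s⟩ _)

end InvertibleFamily

end

/-! ### Faithfulness of the simple objects -/

section

variable {k : Type u} [Field k] {M : Type u₂} [Category.{v₂} M] [Preadditive M] [Linear k M]
  {C : Type u₁} [Category.{v₁} C] [MonoidalCategory C] [Preadditive C] [Linear k C]
  [MonoidalLeftAction C M] [IsLinearAction k C M]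
  {D : Type u₃} [Category.{v₃} D] [MonoidalCategory D] [Preadditive D] [Linear k D]
  (S : D ⥤ Dual k C M) [S.Monoidal] [S.Additive] [S.Linear k]

open TensorCat.Dual

/-- The lift of a morphism. -/
def liftHom {c c' : C} (f : c ⟶ c') :
    letI := pullAction S
    haveI := pullAction_linear (k := k) S
    liftObj S c ⟶ liftObj S c' :=
  letI := pullAction S
  haveI := pullAction_linear (k := k) S
  mkHom (F := liftObj S c) (G := liftObj S c')
    { app := fun m => f ⊵ₗ m
      naturality := fun _ _ g => MonoidalLeftAction.action_exchange f g } fun d m => by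
    rw [liftObj_lineator, liftObj_lineator, Iso.symm_hom, Iso.symm_hom, Iso.inv_comp_eq,
      ← Category.assoc, Iso.eq_comp_inv]
    exact Functor.LaxLeftLinear.μₗ_naturality_left (S.obj d).functor f m

variable {B : Type w} [Group B] [Fintype B] (I : InvertibleFamily D B) (sm : Simples k M)
  (hret : ∀ i j : sm.ι, ∃ (c : C) (f : sm.L j ⟶ c ⊙ₗ sm.L i) (g : c ⊙ₗ sm.L i ⟶ sm.L j), f ≫ g = 𝟙 _)
  (hS : ∀ b, (S.obj (I.obj b)).PreservesBricks)
  (hne : ∀ b b', b ≠ b' → ∀ η : S.obj (I.obj b) ⟶ S.obj (I.obj b'), η = 0)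

include hret hS hne in
-- Verifies the hypothesis of the independence theorem: only indices over the same `b` contribute,
-- there the `φ t` are scalars, and linear independence would force the scalar at `t₀`, which
-- belongs to the identity, to vanish.
lemma sum_comp_ne_zero [Nonempty sm.ι] {m₀ : M} {n : B → ℕ}
    (p : ∀ t : Σ b, Fin (n b), m₀ ⟶ (S.obj (I.obj t.1)).functor.obj m₀)
    (hp : ∀ b, LinearIndependent k fun s : Fin (n b) =>
      (show m₀ ⟶ (S.obj (I.obj b)).functor.obj m₀ from p ⟨b, s⟩)) (t₀ : Σ b, Fin (n b))
    (φ : ∀ t : Σ b, Fin (n b), S.obj (I.obj t.1) ⟶ S.obj (I.obj t₀.1)) (hφ : φ t₀ = 𝟙 _) :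
    ∑ t, p t ≫ (nat (φ t)).app m₀ ≠ 0 := fun h => by
  obtain ⟨b, s₀⟩ := t₀
  let i : sm.ι := Classical.arbitrary _
  have hid := id_ne_zero sm i (hS b)
  choose c hc using fun s => eq_smul_of_ne_zero sm hret (hS b) (hS b) i hid (φ ⟨b, s⟩)
  let p' : Fin (n b) → (m₀ ⟶ (S.obj (I.obj b)).functor.obj m₀) := fun s => p ⟨b, s⟩
  rw [Fintype.sum_sigma, Finset.sum_eq_single b] at h
  · have h1 : ∑ s, c s • p' s = 0 := by
      rw [← h]
      refine Finset.sum_congr rfl fun s _ => ?_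
      rw [hc s]
      change _ = p' s ≫ (c s • 𝟙 _)
      rw [Linear.comp_smul, Category.comp_id]
    have h2 := Fintype.linearIndependent_iff.1 (hp b) c h1 s₀
    apply hid
    rw [← hφ, hc, h2, zero_smul]
  · intro b' _ hb'
    refine Finset.sum_eq_zero fun s _ => ?_
    rw [hne b' b hb' (φ ⟨b', s⟩)]
    exact comp_zero
  · simp

include sm hret hS hne in
/-- An operator vanishing on the lifts of all simple objects vanishes. -/
lemma eq_zero_of_simples [Nonempty sm.ι] (smC : Simples k C) {m₀ : M} :
    letI := pullAction S
    haveI := pullAction_linear (k := k) S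
    ∀ r : opAlg k D m₀, (∀ j (x : Fiber m₀ (liftObj S (smC.L j))), r • x = 0) → r = 0 := by
  let := pullAction S
  have := pullAction_linear (k := k) S
  intro r hr
  -- Vanishing passes from simples to all `c`, because operators commute with the lifts of the
  -- inclusions of summands.
  have h1 : ∀ (c : C) (x : m₀ ⟶ c ⊙ₗ m₀), r.1 (liftObj S c) x = 0 := fun c x => by
    obtain ⟨l, t, u, v, huv, -⟩ := smC.exists_dec c
    have hx : x = ∑ a, (x ≫ u a ⊵ₗ m₀) ≫ v a ⊵ₗ m₀ := by
      simp only [Category.assoc]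
      rw [← Preadditive.comp_sum, ← id_act_eq_sum k huv, Category.comp_id]
    rw [hx]
    refine (map_sum (r.1 (liftObj S c)) _ _).trans (Finset.sum_eq_zero fun a _ => ?_)
    refine (opAlg_comp_nat r (liftHom S (v a)) (x ≫ u a ⊵ₗ m₀)).trans ?_
    exact (congrArg (· ≫ v a ⊵ₗ m₀) (hr (t a) (x ≫ u a ⊵ₗ m₀))).trans zero_comp
  have hfin : ∀ b, Module.Finite k (m₀ ⟶ I.obj b ⊙ₗ m₀) := fun b => sm.finite_hom _ _
  let bas := fun b => Module.finBasis k (m₀ ⟶ I.obj b ⊙ₗ m₀)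
  let p : ∀ t : Σ b, Fin (Module.finrank k (m₀ ⟶ I.obj b ⊙ₗ m₀)), m₀ ⟶ I.obj t.1 ⊙ₗ m₀ :=
    fun t => bas t.1 t.2
  obtain ⟨q, hq⟩ := I.exists_eq_sum_opLin p (fun b x => ⟨fun s => (bas b).repr x s,
    ((bas b).sum_repr x).symm⟩) r
  -- Written in bases of the spaces `m₀ ⟶ I b ⊙ m₀`, the operator `r` kills the fibres of all `c`
  -- exactly when its coefficients `q` form an annihilating family, because the lineator of `liftObj
  -- S c` is the inverse of that of `S d`.
  have hq0 : q = 0 := by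
    refine annihilators_eq_zero (T := fun t => S.obj (I.obj t.1)) (p := p) sm hret
      (fun t => hS t.1) (fun t₀ φ hφ => sum_comp_ne_zero S I sm hret hS hne p
        (fun b => (bas b).linearIndependent) t₀ φ hφ) fun c f => ?_
    have h2 := h1 c f
    rw [hq, Finset.sum_apply, LinearMap.sum_apply] at h2
    exact h2
  refine Subtype.ext (hq.trans ?_)
  rw [hq0]
  simp

end

end

/-! ### The essential image of the dual functor and the conclusion -/

section

open Functor.LaxMonoidal Functor.OplaxMonoidal

/-- The lines form an invertible family. -/
def GrVec.lines (k : Type u) [Field k] {B : Type w} [Group B] [Fintype B] (ω : ThreeCocycle B kˣ) :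
    InvertibleFamily (GrVec k B ω) B where
  obj := line
  mul _ _ := asIso (lineMul rfl)
  one := unitIso
  exists_dec V := by
    let e := (Fintype.equivFin (B × Fin (Module.finrank k V.carrier))).symm
    refine ⟨_, fun a => (e a).1, fun a => coord V (e a).1 (V.basis.coord (e a).2),
      fun a => ofHomog (V.homog_proj (e a).1 (V.basis (e a).2)), ?_⟩
    rw [V.id_eq_sum, ← Fintype.sum_prod_type']
    exact Equiv.sum_comp e fun x =>
      coord V x.1 (V.basis.coord x.2) ≫ ofHomog (V.homog_proj x.1 (V.basis x.2))

section

variable {k : Type u} [Field k] {M : Type u₂} [Category.{v₂} M] [Preadditive M] [Linear k M]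

lemma IsBrick.map_of_fullyFaithful (F : M ⥤ M) [F.Additive] [F.Linear k] [F.Full] [F.Faithful]
    {X : M} (hX : IsBrick k X) : IsBrick k (F.obj X) := by
  refine ⟨fun h => hX.1 (F.map_injective ?_), fun f => ?_⟩
  · rw [F.map_id, h, F.map_zero]
  · obtain ⟨c, hc⟩ := hX.2 (F.preimage f)
    exact ⟨c, by rw [← F.map_preimage f, hc, F.map_smul, F.map_id]⟩

lemma IsBrick.of_iso {X Y : M} (hX : IsBrick k X) (e : X ≅ Y) : IsBrick k Y := by
  refine ⟨fun h => hX.1 ?_, fun f => ?_⟩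
  · rw [← e.hom_inv_id, ← Category.id_comp e.inv, h, zero_comp, comp_zero]
  · obtain ⟨c, hc⟩ := hX.2 (e.hom ≫ f ≫ e.inv)
    refine ⟨c, ?_⟩
    rw [← cancel_epi e.hom, ← cancel_mono e.inv, Category.assoc, hc]
    simp

lemma Simples.nonempty (sm : Simples k M) (h : ∃ m : M, ¬ IsZero m) : Nonempty sm.ι := by
  obtain ⟨m, hm⟩ := h
  by_contra hι
  rw [not_nonempty_iff] at hι
  exact hm ((IsZero.iff_id_eq_zero m).2 (sm.eq_zero_of_forall fun i => hι.elim i))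

end

section

variable {k : Type u} [Field k] [CharZero k] {M : Type u₂} [Category.{v₂} M] [Preadditive M]
  [Linear k M] [HasFiniteBiproducts M]
  {V : Type u₁} [Category.{v₁} V] [MonoidalCategory V] [Preadditive V] [Linear k V]
  [MonoidalLeftAction V M] [IsLinearAction k V M]
  {D : Type u₃} [Category.{v₃} D] [MonoidalCategory D] [Preadditive D] [Linear k D]
  (P : ObjectProperty (Dual k V M)) [P.IsMonoidal] {F : V ⥤ D} [F.Monoidal]
  (S : D ⥤ Dual k P.FullSubcategory M) [S.Monoidal] [S.Additive] [S.Linear k] (Ψ : eval P ≅ F ⋙ S)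
  (hμ : ∀ X Y, (Ψ.hom.app X ⊗ₘ Ψ.hom.app Y) ≫ μ S (F.obj X) (F.obj Y) ≫ S.map (μ F X Y) =
    μ (eval P) X Y ≫ Ψ.hom.app (X ⊗ Y))
  (hε : ε (eval P) ≫ Ψ.hom.app (𝟙_ V) = ε S ≫ S.map (ε F))
  {B : Type w} [Group B] [Fintype B] (I : InvertibleFamily D B) (sm : Simples k M) [Nonempty sm.ι]
  (hret : ∀ i j : sm.ι, ∃ (c : P.FullSubcategory) (f : sm.L j ⟶ c ⊙ₗ sm.L i)
    (g : c ⊙ₗ sm.L i ⟶ sm.L j), f ≫ g = 𝟙 _)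
  (hS : ∀ b, (S.obj (I.obj b)).PreservesBricks)
  (hne : ∀ b b', b ≠ b' → ∀ η : S.obj (I.obj b) ⟶ S.obj (I.obj b'), η = 0)
  (smC : Simples k P.FullSubcategory) [HasFiniteBiproducts P.FullSubcategory]

include I sm hret hS hne smC in
-- Lifting gives one inclusion. For the other, only the zero operator kills the fibres of the lifted
-- simples of `C`, so the identity of any `G` decomposes through these lifts; restriction along `F`
-- carries this to a decomposition through simples of `C`.
lemma essImage_dualFunctor :
    letI := pullAction S
    haveI := pullAction_linear (k := k) S
    ((factorsOfIso P S Ψ hμ hε).dualFunctor (k := k)).essImage = P.isoClosure := by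
  let := pullAction S
  have := pullAction_linear (k := k) S
  let e := factorsOfIso P S Ψ hμ hε
  ext X
  constructor
  · rintro ⟨G, ⟨i⟩⟩
    refine P.isoClosure.prop_of_iso i ?_
    obtain ⟨J, _, t, α, β, h⟩ := Dual.exists_id_eq_sum sm sm.isGen
      (fun j => liftObj S (smC.L j)) (fun j => I.isSemisimple_fiber sm _) G fun r hr x => by
        rw [eq_zero_of_simples S I sm hret hS hne smC r hr, zero_smul]
    let φ : ∀ j, (e.dualFunctor (k := k)).obj (liftObj S (smC.L j)) ≅ (smC.L j).obj :=
      fun j => dualObjLiftIso P S Ψ hμ hε (smC.L j)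
    refine isoClosure_of_id_eq_sum P smC t (fun a => e.dualFunctor.map (α a) ≫ (φ (t a)).hom)
      (fun a => (φ (t a)).inv ≫ e.dualFunctor.map (β a)) ?_
    have h1 : (e.dualFunctor (k := k)).Additive := ⟨rfl⟩
    simp only [Category.assoc, Iso.hom_inv_id_assoc]
    rw [← e.dualFunctor.map_id, ← h, Functor.map_sum]
    simp only [Functor.map_comp]
  · rintro ⟨Y, hY, ⟨i⟩⟩
    exact ⟨liftObj S ⟨Y, hY⟩, ⟨dualObjLiftIso P S Ψ hμ hε ⟨Y, hY⟩ ≪≫ i.symm⟩⟩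

end

end

end TensorCat

end

theorem mainTheorem2 {k : Type u} [Field k] [IsAlgClosed k] [CharZero k]
    {A : Type w} [Group A] [Fintype A]
    {M : Type u₁} [Category.{v₁} M] [Preadditive M] [Linear k M]
    (hM : TensorCat.IsFiniteSemisimple k M) (hM_ne : ∃ m : M, ¬ IsZero m)
    [MonoidalLeftAction (TensorCat.Vec k A) M]
    [TensorCat.IsLinearAction k (TensorCat.Vec k A) M]
    (P : ObjectProperty (TensorCat.Dual k (TensorCat.Vec k A) M)) [P.IsMonoidal]
    (hP : TensorCat.IsMultiFusion k P.FullSubcategory)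
    (hind : TensorCat.IsIndecomposable P.FullSubcategory M) :
    ∃ (B : Type w) (_ : Group B) (_ : Fintype B) (ω : TensorCat.ThreeCocycle B kˣ)
      (F : TensorCat.Vec k A ⥤ TensorCat.GrVec k B ω) (_ : F.Monoidal)
      (_ : MonoidalLeftAction (TensorCat.GrVec k B ω) M)
      (_ : TensorCat.IsLinearAction k (TensorCat.GrVec k B ω) M)
      (e : TensorCat.FactorsThrough F M),
      F.Additive ∧ F.Linear k ∧ TensorCat.IsSurjective F ∧
      (e.dualFunctor (k := k)).Full ∧ (e.dualFunctor (k := k)).Faithful ∧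
      (e.dualFunctor (k := k)).essImage = P.isoClosure 
:= by
  obtain ⟨sm⟩ := hM.nonempty_simples
  have := hM.hasFiniteBiproducts
  obtain ⟨smC⟩ := hP.semisimple.nonempty_simples
  have := hP.semisimple.hasFiniteBiproducts
  have := sm.nonempty hM_ne
  let i : sm.ι := Classical.arbitrary _
  have hret := TensorCat.exists_retract_act sm hP.rightDual hind
  -- Lines are invertible, so they act on `M` by equivalences.
  have hbr : ∀ g : A, ((TensorCat.eval P).obj (TensorCat.GrVec.line g)).PreservesBricks :=
    fun g X hX => by
      let T : M ⥤ M := TensorCat.actFunctor (TensorCat.GrVec.line g : TensorCat.Vec k A)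
      have : T.IsEquivalence := (TensorCat.GrVec.lines k 1).isEquivalence g
      have : T.Additive := TensorCat.actFunctor_additive k _
      have : T.Linear k := TensorCat.actFunctor_linear k _
      exact hX.map_of_fullyFaithful T
  obtain ⟨R, hR⟩ := TensorCat.exists_reduction (TensorCat.eval (k := k) P)
    (fun g => TensorCat.Dual.id_ne_zero sm i (hbr g))
    (fun f f' hf => TensorCat.Dual.eq_smul_of_ne_zero sm hret (hbr _) (hbr _) i hf f')
  let := R.monoidalF
  let := R.monoidalS
  let := TensorCat.pullAction R.S
  have := TensorCat.pullAction_linear (k := k) R.S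
  have hsurj := TensorCat.GrVec.isSurjective_push (k := k)
    (ω := (1 : TensorCat.ThreeCocycle A kˣ)) (ω' := R.cocycle) R.π_s
  let ψ : ∀ b, R.T b ≅ R.S.obj (TensorCat.GrVec.line b) := fun b =>
    (TensorCat.eval P).mapIso (TensorCat.GrVec.pushLine R.s b)
  have hS : ∀ b, (R.S.obj ((TensorCat.GrVec.lines k R.cocycle).obj b)).PreservesBricks :=
    fun b X hX => (hbr (R.s b) X hX).of_iso (TensorCat.Dual.appIso (ψ b) X)
  -- By Schur's lemma a nonzero `η` would be an isomorphism between representatives of different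
  -- classes.
  have hne : ∀ b b', b ≠ b' → ∀ η : R.S.obj ((TensorCat.GrVec.lines k R.cocycle).obj b) ⟶
      R.S.obj ((TensorCat.GrVec.lines k R.cocycle).obj b'), η = 0 := fun b b' hb η => by
    by_contra h0
    exact hb (hR b b' ⟨ψ b ≪≫
      @asIso _ _ _ _ η (TensorCat.Dual.isIso_of_ne_zero sm hret (hS b) (hS b') h0) ≪≫
      (ψ b').symm⟩)
  exact ⟨_, inferInstance, inferInstance, R.cocycle, R.F, R.monoidalF, inferInstance, inferInstance,
    TensorCat.factorsOfIso P R.S R.factorIso R.factorIso_μ R.factorIso_ε, inferInstance,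
    inferInstance, hsurj, TensorCat.full_dualFunctor _ hsurj, TensorCat.faithful_dualFunctor _,
    TensorCat.essImage_dualFunctor P R.S R.factorIso R.factorIso_μ R.factorIso_ε
      (TensorCat.GrVec.lines k R.cocycle) sm hret hS hne smC⟩
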